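/- Let $L\ge 1$ be fixed. For every sample size $K$ let $N=N(K)$ and let $\mathbf R_N\in\mathbb C^{N\times N}$ be a Hermitian matrix such that the following hold. (A1) For all large $K$, $\mathbf R_N$ has exactly $L$ distinct eigenvalues $\lambda_1<\dots<\lambda_L$ (which may depend on $K$) with multiplicities $N_1,\dots,N_L\ge1$, $\sum_i N_i=N$, and $\lambda_{\min}<\lambda_1\le\lambda_L<\lambda_{\max}$ with constants $0<\lambda_{\min}<\lambda_{\max}<\infty$ independent of $K$. (A2) As $K\to\infty$, $c_K:=N/K\to c\in(0,1)$ and $N_i/K\to c_i\in(0,1)$ for every $i$. (A3) $\mathbf Y=K^{-1/2}\mathbf R_N^{1/2}\mathbf X$, where the entries of $\mathbf X\in\mathbb C^{N\times K}$ are i.i.d. circularly symmetric complex Gaussian variables with zero mean and unit variance. Let $\hat\sigma_1,\dots,\hat\sigma_N$ be the eigenvalues of $\hat{\mathbf R}_N=\mathbf Y\mathbf Y^H$, and for $z\in\mathbb C\setminus\mathbb R$ put $b_{\hat{\mathbf R}}(z)=\frac1N\sum_{i=1}^N\frac1{\hat\sigma_i-z}$. Let $b_K(z)=\int\frac{dF_K(x)}{x-z}$,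 where $F_K$ is the unique probability measure on $[0,\infty)$ whose Stieltjes transform satisfies $$b_K(z)=\frac1N\sum_{i=1}^L\frac{N_i}{\lambda_i\,(1-c_K-c_K z\,b_K(z))-z}\qquad\text{for all } z\in\mathbb C\setminus\mathbb R .$$ Then there exist real polynomials $P_{18},P_{24},P_{30},P_{40}$ with nonnegative coefficients, of degrees $18,24,30,40$ respectively and independent of $K$ and $z$, such that for all sufficiently large $K$ and all $z\in\mathbb C\setminus\mathbb R$ $$E\left[\left|b_{\hat{\mathbf R}}(z)-b_K(z)\right|^2\right]\le\frac1{K^2}\,P_{18}(|z|)\,P_{24}(|\mathrm{Im}\,z|^{-1}),$$ $$E\left[\left|b'_{\hat{\mathbf R}}(z)-b'_K(z)\right|^2\right]\le\frac1{K^2}\,P_{30}(|z|)\,P_{40}(|\mathrm{Im}\,z|^{-1}),$$ where $'$ denotes the derivative with respect to $z$. -/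

import Mathlib

open MeasureTheory ProbabilityTheory Filter Topology
open scoped NNReal

/-- The Hermitian matrix `R` has exactly the `L` distinct eigenvalues `lam 0 < ⋯ < lam (L - 1)`,
the `i`-th one having multiplicity `mult i`. -/
structure HasSpectrum {L N : ℕ} (R : Matrix (Fin N) (Fin N) ℂ) (lam : Fin L → ℝ)
    (mult : Fin L → ℕ) : Prop where
  isHermitian : R.IsHermitian
  strictMono : StrictMono lam
  mult_pos : ∀ i, 0 < mult i
  finrank_eigenspace : ∀ i,
    Module.finrank ℂ (Module.End.eigenspace (Matrix.toLin' R) (lam i : ℂ)) = mult i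
  sum_mult : ∑ i, mult i = N

/-- The law of a (circularly symmetric) complex Gaussian variable with zero mean and unit
variance: its real and imaginary parts are independent `N(0, 1/2)` variables. -/
noncomputable def stdComplexGaussian : Measure ℂ :=
  ((gaussianReal 0 (1 / 2)).prod (gaussianReal 0 (1 / 2))).map
    (fun p : ℝ × ℝ => (p.1 : ℂ) + (p.2 : ℂ) * Complex.I)

section
open scoped MatrixOrder

/-- The normalised observation matrix `Y = K^{-1/2} [y₁, …, y_K]`, where `y_k = R^{1/2} x_k` and
`x_k` is the `k`-th column of `X`. -/
noncomputable def observation {N K : ℕ} (R : Matrix (Fin N) (Fin N) ℂ)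
    (X : Matrix (Fin N) (Fin K) ℂ) : Matrix (Fin N) (Fin K) ℂ :=
  (((Real.sqrt K)⁻¹ : ℝ) : ℂ) • (CFC.sqrt R * X)

end

/-- The Stieltjes transform `N⁻¹ ∑ᵢ (σᵢ - z)⁻¹` of the empirical distribution of the eigenvalues
`σᵢ` (with multiplicity) of the sample covariance matrix `Y Yᴴ`. -/
noncomputable def sampleStieltjes {N K : ℕ} (Y : Matrix (Fin N) (Fin K) ℂ) (z : ℂ) : ℂ :=
  (N : ℂ)⁻¹ *
    ∑ i, (((Matrix.isHermitian_mul_conjTranspose_self Y).eigenvalues i : ℂ) - z)⁻¹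

/-- `F` is a probability measure on `[0, ∞)` whose Stieltjes transform `b z = ∫ (x - z)⁻¹ dF(x)`
solves `b z = N⁻¹ ∑ᵢ multᵢ / (lamᵢ (1 - c - c z b z) - z)` for every non-real `z`. -/
structure IsLimitSpectralMeasure {L : ℕ} (N : ℕ) (lam : Fin L → ℝ) (mult : Fin L → ℕ) (c : ℝ)
    (F : Measure ℝ) : Prop where
  isProbabilityMeasure : IsProbabilityMeasure F
  nonneg : F (Set.Iio 0) = 0
  equation : ∀ z : ℂ, z.im ≠ 0 →
    resolventTransform F z = (N : ℂ)⁻¹ *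
      ∑ i, (mult i : ℂ) / ((lam i : ℂ) * (1 - (c : ℂ) - (c : ℂ) * z * resolventTransform F z) - z)

open Classical in
/-- The deterministic spectral measure: the measure characterised by `IsLimitSpectralMeasure`.
For `N = ∑ᵢ multᵢ > 0`, `lamᵢ > 0` and `c > 0` there is exactly one such measure. -/
noncomputable def limitSpectralMeasure {L : ℕ} (N : ℕ) (lam : Fin L → ℝ) (mult : Fin L → ℕ)
    (c : ℝ) : Measure ℝ :=
  if h : ∃ F : Measure ℝ, IsLimitSpectralMeasure N lam mult c F then h.choose else 0

/-- The Stieltjes transform of the deterministic spectral measure for dimension `N` and sample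
size `K`, that is, with ratio `c = N / K`. -/
noncomputable def limitStieltjes {L : ℕ} (N K : ℕ) (lam : Fin L → ℝ) (mult : Fin L → ℕ)
    (z : ℂ) : ℂ :=
  resolventTransform (limitSpectralMeasure N lam mult ((N : ℝ) / (K : ℝ))) z

/-- `P` is a real polynomial of degree `m` with nonnegative coefficients. -/
def IsNonnegPoly (m : ℕ) (P : Polynomial ℝ) : Prop :=
  P.natDegree = m ∧ ∀ n, 0 ≤ P.coeff n

/-! Put `Q = (Y Yᴴ - z)⁻¹`. The sample transform is `N⁻¹ tr Q`, so its mean square distance to the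
limit transform is `N⁻²` times the variance of `tr Q` plus the squared distance from `E tr Q` to `N
b_K(z)`. Both are bounded independently of the dimension, with polynomial growth in `|z|` and `|Im
z|⁻¹`; as `N` is of order `K`, this gives the rate `K⁻²`.

Variance. The columns of `Y` are independent, so by Efron–Stein (`efron_stein`) it suffices to vary
one column at a time. By Sherman–Morrison, `tr Q` depends on a column `v` only through `vᴴ Q₀ v` and
`vᴴ Q₀² v`, where `Q₀` omits that column. These forms have variance `O(1/K)`
(`integral_norm_quadForm_sub_trace_sq_le`), and the `K` columns together contribute `O(1)`.

Bias. Compare `Q` with `T = (β R - z)⁻¹`, where `β = 1 - c - K⁻¹ z E tr Q`. The leave-one-out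
identity `trace_sub_trace_eq` writes `tr Q - tr T` as a fluctuation plus one defect per column, and
each defect has mean `O(1/K)` (`IsColumnLaw.norm_integral_columnDefect_le`). So `N⁻¹ E tr Q` solves
the equation of `b_K` up to `O(1/N)`. That equation is stable (`norm_sub_le_of_approx_fixedPoint`),
by a contraction estimate read off from imaginary parts. Stability applies to any solution that is a
Stieltjes transform, so uniqueness of `F_K` is not needed.

Existence of `F_K` comes from the same estimates: repeating each population eigenvalue many times
keeps the equation and the ratio `c` unchanged while the dimension grows, and a limit of the
resulting empirical spectral distributions is an exact solution (`exists_measure_of_approx`).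

The derivative bound follows from the first one through Cauchy's formula on a circle of radius `|Im
z| / 2`.

The fact that keeps every denominator under control is that, for positive semidefinite `H`, the
imaginary part of `z vᴴ (H - z)⁻¹ v` never has the sign opposite to `Im z`. -/

/-! ### Deterministic resolvent bounds and rank-one perturbations -/

section ResolventAlgebra
open Matrix
open scoped Matrix.Norms.L2Operator ComplexOrder

variable {n : Type*} [Fintype n] [DecidableEq n]

/-- The Hermitian form `vᴴ A v`. -/
noncomputable def quadForm (A : Matrix n n ℂ) (v : n → ℂ) : ℂ := star v ⬝ᵥ A *ᵥ v

/-- The resolvent `(H - z)⁻¹` of a matrix. -/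
noncomputable def matResolvent (H : Matrix n n ℂ) (z : ℂ) : Matrix n n ℂ :=
  (H - z • (1 : Matrix n n ℂ))⁻¹

theorem norm_quadForm_le (A : Matrix n n ℂ) (v : n → ℂ) :
    ‖quadForm A v‖ ≤ ‖A‖ * ∑ i, ‖v i‖ ^ 2 := by
  have h1 : quadForm A v = inner ℂ (WithLp.toLp 2 v) (WithLp.toLp 2 (A *ᵥ v)) := by
    rw [EuclideanSpace.inner_eq_star_dotProduct, quadForm, dotProduct_comm]
  have h2 : ∑ i, ‖v i‖ ^ 2 = ‖(WithLp.toLp 2 v : EuclideanSpace ℂ n)‖ ^ 2 := by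
    rw [EuclideanSpace.norm_sq_eq]
  rw [h1, h2]
  calc _ ≤ ‖(WithLp.toLp 2 v : EuclideanSpace ℂ n)‖ * ‖(WithLp.toLp 2 (A *ᵥ v) : EuclideanSpace ℂ n)‖ :=
        norm_inner_le_norm _ _
    _ ≤ ‖(WithLp.toLp 2 v : EuclideanSpace ℂ n)‖ * (‖A‖ * ‖(WithLp.toLp 2 v : EuclideanSpace ℂ n)‖) := by
        gcongr
        exact l2_opNorm_mulVec A (WithLp.toLp 2 v)
    _ = _ := by ring

theorem quadForm_single (A : Matrix n n ℂ) (i : n) : quadForm A (Pi.single i 1) = A i i := by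
  simp [quadForm]

theorem trace_eq_sum_quadForm (A : Matrix n n ℂ) :
    A.trace = ∑ i, quadForm A (Pi.single i 1) := by
  simp [quadForm_single, trace]

theorem norm_diag_le (A : Matrix n n ℂ) (i : n) : ‖A i i‖ ≤ ‖A‖ := by
  have := norm_quadForm_le A (Pi.single i 1)
  rw [quadForm_single] at this
  refine this.trans_eq ?_
  rw [Finset.sum_eq_single i] <;> simp +contextual

theorem norm_trace_le (A : Matrix n n ℂ) : ‖A.trace‖ ≤ Fintype.card n * ‖A‖ := by
  refine (norm_sum_le _ _).trans ((Finset.sum_le_sum fun i _ => norm_diag_le A i).trans_eq ?_)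
  simp

/-- The squared Frobenius norm is `tr (A Aᴴ)`. -/
theorem sum_norm_sq_entries_le (A : Matrix n n ℂ) :
    ∑ i, ∑ j, ‖A i j‖ ^ 2 ≤ Fintype.card n * ‖A‖ ^ 2 := by
  have h : ((∑ i, ∑ j, ‖A i j‖ ^ 2 : ℝ) : ℂ) = (A * Aᴴ).trace := by
    simp only [trace, diag, mul_apply, conjTranspose_apply]
    push_cast
    refine Finset.sum_congr rfl fun i _ => Finset.sum_congr rfl fun j _ => ?_
    rw [Complex.star_def, Complex.mul_conj, Complex.normSq_eq_norm_sq]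
    push_cast; rfl
  have h2 := norm_trace_le (A * Aᴴ)
  rw [← h, Complex.norm_real, Real.norm_of_nonneg (by positivity)] at h2
  refine h2.trans ?_
  gcongr
  refine (norm_mul_le _ _).trans_eq ?_
  rw [l2_opNorm_conjTranspose, sq]

section Spectral
variable {H : Matrix n n ℂ} (hH : H.IsHermitian)
include hH

/-- Diagonalise `H`. The affine form `a H + b` covers both the resolvent (`a = 1`) and the
deterministic comparison matrix `(β R - z)⁻¹`. -/
theorem Matrix.IsHermitian.affine_inv_eq (a b : ℂ) (hab : ∀ k, a * hH.eigenvalues k + b ≠ 0) :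
    (a • H + b • (1 : Matrix n n ℂ)) * ((hH.eigenvectorUnitary : Matrix n n ℂ) *
        diagonal (fun k => (a * hH.eigenvalues k + b)⁻¹) *
        star (hH.eigenvectorUnitary : Matrix n n ℂ)) = 1 := by
  have hU1 : star (hH.eigenvectorUnitary : Matrix n n ℂ) * (hH.eigenvectorUnitary : Matrix n n ℂ) = 1 :=
    Unitary.coe_star_mul_self _
  have hU2 : (hH.eigenvectorUnitary : Matrix n n ℂ) * star (hH.eigenvectorUnitary : Matrix n n ℂ) = 1 :=
    Unitary.coe_mul_star_self _
  have hs : a • H + b • (1 : Matrix n n ℂ) = (hH.eigenvectorUnitary : Matrix n n ℂ) *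
      diagonal (fun k => a * hH.eigenvalues k + b) * star (hH.eigenvectorUnitary : Matrix n n ℂ) := by
    have e : diagonal (fun k => a * (hH.eigenvalues k : ℂ) + b)
        = a • diagonal (RCLike.ofReal ∘ hH.eigenvalues) + b • (1 : Matrix n n ℂ) := by
      ext i j
      by_cases h : i = j
      · subst h; simp
      · simp [h]
    rw [e, mul_add, add_mul, mul_smul_comm, smul_mul_assoc, mul_smul_comm, smul_mul_assoc, mul_one,
      hU2]
    conv_lhs => rw [hH.spectral_theorem, Unitary.conjStarAlgAut_apply]
  rw [hs]
  generalize (hH.eigenvectorUnitary : Matrix n n ℂ) = U at hU1 hU2 ⊢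
  calc U * diagonal (fun k => a * (hH.eigenvalues k : ℂ) + b) * star U *
        (U * diagonal (fun k => (a * (hH.eigenvalues k : ℂ) + b)⁻¹) * star U)
      = U * diagonal (fun k => a * (hH.eigenvalues k : ℂ) + b) * (star U * U) *
        diagonal (fun k => (a * (hH.eigenvalues k : ℂ) + b)⁻¹) * star U := by
        simp only [mul_assoc]
    _ = 1 := by
        rw [hU1, mul_one, mul_assoc U, diagonal_mul_diagonal]
        simp [hab, hU2]

theorem Matrix.IsHermitian.affine_mul_inv (a b : ℂ) (hab : ∀ k, a * hH.eigenvalues k + b ≠ 0) :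
    (a • H + b • (1 : Matrix n n ℂ)) * (a • H + b • (1 : Matrix n n ℂ))⁻¹ = 1 := by
  have := hH.affine_inv_eq a b hab
  rw [inv_eq_right_inv this, this]

theorem Matrix.IsHermitian.norm_affine_inv_le (a b : ℂ) {y : ℝ} (hy : 0 < y)
    (hab : ∀ k, y ≤ ‖a * hH.eigenvalues k + b‖) :
    ‖(a • H + b • (1 : Matrix n n ℂ))⁻¹‖ ≤ y⁻¹ := by
  have h0 : ∀ k, a * hH.eigenvalues k + b ≠ 0 := fun k h => by
    have := hab k; rw [h, norm_zero] at this; linarith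
  rw [inv_eq_right_inv (hH.affine_inv_eq a b h0), ← Unitary.coe_star, CStarRing.norm_mul_coe_unitary,
    CStarRing.norm_coe_unitary_mul, l2_opNorm_diagonal]
  refine (pi_norm_le_iff_of_nonneg (by positivity)).2 fun k => ?_
  rw [norm_inv]
  exact inv_anti₀ hy (hab k)

theorem Matrix.IsHermitian.trace_affine_inv (a b : ℂ) (hab : ∀ k, a * hH.eigenvalues k + b ≠ 0) :
    (a • H + b • (1 : Matrix n n ℂ))⁻¹.trace = ∑ k, (a * hH.eigenvalues k + b)⁻¹ := by
  rw [inv_eq_right_inv (hH.affine_inv_eq a b hab), trace_mul_comm, ← mul_assoc,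
    Unitary.coe_star_mul_self, one_mul, trace_diagonal]

theorem abs_im_le_norm_eigenvalues_sub (z : ℂ) (k : n) :
    |z.im| ≤ ‖(1 : ℂ) * hH.eigenvalues k + -z‖ := by
  refine le_trans ?_ (Complex.abs_im_le_norm _)
  simp

theorem eigenvalues_sub_ne_zero {z : ℂ} (hz : z.im ≠ 0) (k : n) :
    (1 : ℂ) * hH.eigenvalues k + -z ≠ 0 := fun h => by
  have := abs_im_le_norm_eigenvalues_sub hH z k
  rw [h, norm_zero] at this
  exact hz (abs_eq_zero.1 (le_antisymm this (abs_nonneg _)))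

omit hH in
theorem matResolvent_eq_affine_inv (H : Matrix n n ℂ) (z : ℂ) :
    matResolvent H z = ((1 : ℂ) • H + (-z) • (1 : Matrix n n ℂ))⁻¹ := by
  rw [matResolvent, one_smul, neg_smul, sub_eq_add_neg]

theorem sub_mul_matResolvent {z : ℂ} (hz : z.im ≠ 0) :
    (H - z • (1 : Matrix n n ℂ)) * matResolvent H z = 1 := by
  have := hH.affine_mul_inv 1 (-z) (eigenvalues_sub_ne_zero hH hz)
  rwa [one_smul, neg_smul, ← sub_eq_add_neg] at this

theorem matResolvent_mul_sub {z : ℂ} (hz : z.im ≠ 0) :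
    matResolvent H z * (H - z • (1 : Matrix n n ℂ)) = 1 :=
  mul_eq_one_comm.1 (sub_mul_matResolvent hH hz)

theorem norm_matResolvent_le {z : ℂ} (hz : z.im ≠ 0) : ‖matResolvent H z‖ ≤ |z.im|⁻¹ := by
  rw [matResolvent_eq_affine_inv]
  exact hH.norm_affine_inv_le 1 (-z) (abs_pos.2 hz) (abs_im_le_norm_eigenvalues_sub hH z)

theorem trace_matResolvent {z : ℂ} (hz : z.im ≠ 0) :
    (matResolvent H z).trace = ∑ k, ((hH.eigenvalues k : ℂ) - z)⁻¹ := by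
  rw [matResolvent_eq_affine_inv, hH.trace_affine_inv 1 (-z) (eigenvalues_sub_ne_zero hH hz)]
  simp [sub_eq_add_neg]

end Spectral

/-- With `w = (H - z)⁻¹ v`, the form equals `wᴴ H w - z̄ ‖w‖²`. Multiplying by `z` makes the second
term real, leaving the imaginary part `(wᴴ H w) Im z`. -/
theorem Matrix.PosSemidef.im_mul_quadForm_matResolvent_nonneg {H : Matrix n n ℂ} (hH : H.PosSemidef)
    {z : ℂ} (hz : z.im ≠ 0) (v : n → ℂ) :
    0 ≤ (z * quadForm (matResolvent H z) v).im * z.im := by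
  set w := matResolvent H z *ᵥ v with hw
  have hv : v = H *ᵥ w - z • w := by
    have : (H - z • (1 : Matrix n n ℂ)) *ᵥ w = v := by
      rw [hw, mulVec_mulVec, sub_mul_matResolvent hH.1 hz, one_mulVec]
    rw [← this, sub_mulVec, smul_mulVec, one_mulVec]
  have h1 : quadForm (matResolvent H z) v = star w ⬝ᵥ H *ᵥ w - star z * (star w ⬝ᵥ w) := by
    rw [quadForm, ← hw]
    conv_lhs => rw [hv]
    rw [star_sub, sub_dotProduct, star_mulVec, hH.1, star_smul, smul_dotProduct, ← dotProduct_mulVec,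
      smul_eq_mul]
  have h2 := hH.dotProduct_mulVec_nonneg w
  have h3 : 0 ≤ star w ⬝ᵥ w := dotProduct_star_self_nonneg w
  obtain ⟨s, hs0, hs⟩ : ∃ s : ℝ, 0 ≤ s ∧ star w ⬝ᵥ H *ᵥ w = s :=
    ⟨_, (Complex.nonneg_iff.1 h2).1, Complex.ext rfl (by simp [(Complex.nonneg_iff.1 h2).2.symm])⟩
  obtain ⟨t, ht0, ht⟩ : ∃ t : ℝ, 0 ≤ t ∧ star w ⬝ᵥ w = t :=
    ⟨_, (Complex.nonneg_iff.1 h3).1, Complex.ext rfl (by simp [(Complex.nonneg_iff.1 h3).2.symm])⟩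
  rw [h1, hs, ht]
  have : (z * ((s : ℂ) - star z * t)).im = s * z.im := by
    simp [Complex.mul_im, Complex.mul_re]; ring
  rw [this, mul_assoc]
  positivity [mul_self_nonneg z.im]

/-- The two summands of `Im (z (1 + s)) = Im z + Im (z s)` do not have opposite signs, so `|z| |1 +
s| ≥ |Im z|`. -/
theorem norm_one_add_ge {z s : ℂ} (hz : z.im ≠ 0) (hs : 0 ≤ (z * s).im * z.im) :
    |z.im| / ‖z‖ ≤ ‖1 + s‖ := by
  have hz0 : 0 < ‖z‖ := norm_pos_iff.2 fun h => hz (by simp [h])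
  rw [div_le_iff₀ hz0, ← norm_mul]
  refine le_trans ?_ (Complex.abs_im_le_norm _)
  have : ((1 + s) * z).im = z.im + (z * s).im := by
    rw [add_mul, one_mul, Complex.add_im, mul_comm s]
  rw [this]
  exact sq_le_sq.1 (by nlinarith [sq_nonneg (z * s).im])

theorem one_add_ne_zero_of_im {z s : ℂ} (hz : z.im ≠ 0) (hs : 0 ≤ (z * s).im * z.im) :
    1 + s ≠ 0 := fun h => by
  have h1 := norm_one_add_ge hz hs
  have hz0 : 0 < ‖z‖ := norm_pos_iff.2 fun h => hz (by simp [h])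
  rw [h, norm_zero] at h1
  have : 0 < |z.im| / ‖z‖ := div_pos (abs_pos.2 hz) hz0
  linarith

theorem norm_inv_one_add_le {z s : ℂ} (hz : z.im ≠ 0) (hs : 0 ≤ (z * s).im * z.im) :
    ‖(1 + s)⁻¹‖ ≤ ‖z‖ / |z.im| := by
  have hz0 : 0 < ‖z‖ := norm_pos_iff.2 fun h => hz (by simp [h])
  rw [norm_inv, ← inv_div]
  exact inv_anti₀ (div_pos (abs_pos.2 hz) hz0) (norm_one_add_ge hz hs)

section RankOne
variable {G : Matrix n n ℂ} (hG : G.PosSemidef) {z : ℂ} (hz : z.im ≠ 0) (v : n → ℂ)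
include hG hz

omit [DecidableEq n] hz in
theorem posSemidef_add_vecMulVec : (G + vecMulVec v (star v)).PosSemidef :=
  hG.add (posSemidef_vecMulVec_self_star v)

/-- The resolvent identity for a rank-one perturbation. -/
theorem matResolvent_rankOne_sub :
    matResolvent G z - matResolvent (G + vecMulVec v (star v)) z
      = matResolvent (G + vecMulVec v (star v)) z * vecMulVec v (star v) * matResolvent G z := by
  have hG' := posSemidef_add_vecMulVec hG v
  have h1 := sub_mul_matResolvent hG.1 hz
  have h2 := matResolvent_mul_sub hG'.1 hz
  set Q := matResolvent G z
  set Q' := matResolvent (G + vecMulVec v (star v)) z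
  have e : vecMulVec v (star v) = (G + vecMulVec v (star v) - z • (1 : Matrix n n ℂ))
      - (G - z • (1 : Matrix n n ℂ)) := by abel
  calc Q - Q' = (Q' * (G + vecMulVec v (star v) - z • (1 : Matrix n n ℂ))) * Q
        - Q' * ((G - z • (1 : Matrix n n ℂ)) * Q) := by rw [h1, h2, one_mul, mul_one]
    _ = Q' * ((G + vecMulVec v (star v) - z • (1 : Matrix n n ℂ))
      - (G - z • (1 : Matrix n n ℂ))) * Q := by
        generalize G + vecMulVec v (star v) - z • (1 : Matrix n n ℂ) = A
        generalize G - z • (1 : Matrix n n ℂ) = B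
        rw [mul_sub, sub_mul, mul_assoc Q' B]
    _ = _ := by rw [← e]

/-- Sherman–Morrison: the perturbed resolvent acts on `v` as a scalar multiple of the unperturbed
one. -/
theorem matResolvent_rankOne_mulVec :
    matResolvent (G + vecMulVec v (star v)) z *ᵥ v
      = (1 + quadForm (matResolvent G z) v)⁻¹ • matResolvent G z *ᵥ v := by
  have h0 := one_add_ne_zero_of_im hz (hG.im_mul_quadForm_matResolvent_nonneg hz v)
  have h := congrArg (· *ᵥ v) (matResolvent_rankOne_sub hG hz v)
  simp only [sub_mulVec] at h
  rw [← mulVec_mulVec, ← mulVec_mulVec, vecMulVec_mulVec, op_smul_eq_smul, mulVec_smul] at h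
  change _ = quadForm (matResolvent G z) v • _ at h
  rw [eq_inv_smul_iff₀ h0, add_smul, one_smul, ← h]
  abel

theorem trace_mul_matResolvent_rankOne_sub (A : Matrix n n ℂ) :
    (A * matResolvent G z).trace - (A * matResolvent (G + vecMulVec v (star v)) z).trace
      = (1 + quadForm (matResolvent G z) v)⁻¹ *
        quadForm (matResolvent G z * A * matResolvent G z) v := by
  rw [← trace_sub, ← mul_sub, matResolvent_rankOne_sub hG hz v, mul_vecMulVec,
    matResolvent_rankOne_mulVec hG hz v, vecMulVec_mul, mul_vecMulVec, trace_vecMulVec, mulVec_smul,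
    smul_dotProduct, smul_eq_mul, dotProduct_comm, ← dotProduct_mulVec, mulVec_mulVec,
    mulVec_mulVec, quadForm, quadForm]

theorem quadForm_mul_matResolvent_rankOne (A : Matrix n n ℂ) :
    quadForm (A * matResolvent (G + vecMulVec v (star v)) z) v
      = (1 + quadForm (matResolvent G z) v)⁻¹ * quadForm (A * matResolvent G z) v := by
  rw [quadForm, ← mulVec_mulVec, matResolvent_rankOne_mulVec hG hz v, mulVec_smul, dotProduct_smul,
    smul_eq_mul, mulVec_mulVec, quadForm, quadForm]

end RankOne

theorem quadForm_one (v : n → ℂ) : quadForm (1 : Matrix n n ℂ) v = ((∑ i, ‖v i‖ ^ 2 : ℝ) : ℂ) := by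
  simp only [quadForm, one_mulVec, dotProduct, Pi.star_apply]
  push_cast
  refine Finset.sum_congr rfl fun i _ => ?_
  rw [Complex.star_def, mul_comm, Complex.mul_conj, Complex.normSq_eq_norm_sq]
  push_cast; rfl

omit [DecidableEq n] in
theorem trace_mul_vecMulVec_star (A : Matrix n n ℂ) (v : n → ℂ) :
    (A * vecMulVec v (star v)).trace = quadForm A v := by
  rw [mul_vecMulVec, trace_vecMulVec, dotProduct_comm, quadForm]

omit [DecidableEq n] in
theorem continuous_quadForm (A : Matrix n n ℂ) : Continuous (quadForm A) := by
  unfold quadForm; simp only [dotProduct, mulVec, Pi.star_apply]; fun_prop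

end ResolventAlgebra

/-! ### The Efron–Stein inequality -/

section EfronStein

variable {V : Type*} [MeasurableSpace V] {ι : Type*} [Fintype ι] [DecidableEq ι]
variable (ρ : Measure V) [IsProbabilityMeasure ρ]

omit [Fintype ι] in
theorem measurable_update_pair (i : ι) :
    Measurable (fun p : (ι → V) × V => Function.update p.1 i p.2) := by
  refine measurable_pi_iff.2 fun j => ?_
  by_cases h : j = i
  · subst h; simpa using measurable_snd
  · simp only [Function.update_of_ne h]
    exact (measurable_pi_apply j).comp measurable_fst

/-- Resampling one coordinate preserves a product measure. -/
theorem measurePreserving_update (i : ι) :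
    MeasurePreserving (fun p : (ι → V) × V => Function.update p.1 i p.2)
      ((Measure.pi fun _ : ι => ρ).prod ρ) (Measure.pi fun _ : ι => ρ) := by
  refine ⟨measurable_update_pair i, ?_⟩
  refine (Measure.pi_eq fun s hs => ?_).symm
  rw [Measure.map_apply (measurable_update_pair i) (MeasurableSet.univ_pi hs)]
  have : (fun p : (ι → V) × V => Function.update p.1 i p.2) ⁻¹' Set.univ.pi s
      = (Set.univ.pi (Function.update s i Set.univ)) ×ˢ s i := by
    ext ⟨x, v⟩
    simp only [Set.mem_preimage, Set.mem_pi, Set.mem_univ, true_imp_iff, Set.mem_prod]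
    constructor
    · intro h
      refine ⟨fun j => ?_, by simpa using h i⟩
      by_cases hj : j = i
      · subst hj; simp
      · simpa [Function.update_of_ne hj] using h j
    · rintro ⟨h1, h2⟩ j
      by_cases hj : j = i
      · subst hj; simpa using h2
      · simpa [Function.update_of_ne hj] using h1 j
  rw [this, Measure.prod_prod, Measure.pi_pi, ← Finset.mul_prod_erase _ _ (Finset.mem_univ i),
    ← Finset.mul_prod_erase Finset.univ (fun j => ρ (s j)) (Finset.mem_univ i)]
  simp only [Function.update_self, measure_univ, one_mul]
  rw [mul_comm]
  congr 1
  refine Finset.prod_congr rfl fun j hj => ?_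
  rw [Function.update_of_ne (Finset.ne_of_mem_erase hj)]

theorem integral_pi_eq_integral_update {E : Type*} [NormedAddCommGroup E] [NormedSpace ℝ E]
    (i : ι) {f : (ι → V) → E} (hf : Integrable f (Measure.pi fun _ : ι => ρ)) :
    ∫ x, f x ∂(Measure.pi fun _ : ι => ρ)
      = ∫ x, ∫ v, f (Function.update x i v) ∂ρ ∂(Measure.pi fun _ : ι => ρ) := by
  have hmp := measurePreserving_update ρ i
  have h1 : Integrable (fun p : (ι → V) × V => f (Function.update p.1 i p.2))
      ((Measure.pi fun _ : ι => ρ).prod ρ) := (hmp.integrable_comp hf.1).2 hf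
  have h2 := integral_map hmp.measurable.aemeasurable (f := f) (by rw [hmp.map_eq]; exact hf.1)
  rw [hmp.map_eq] at h2
  rw [← integral_prod _ h1, h2]

theorem norm_integral_pi_le_of_update {E : Type*} [NormedAddCommGroup E] [NormedSpace ℝ E]
    (i : ι) {f : (ι → V) → E} (hf : Integrable f (Measure.pi fun _ : ι => ρ)) {B : ℝ}
    (hB : ∀ x, ‖∫ v, f (Function.update x i v) ∂ρ‖ ≤ B) :
    ‖∫ x, f x ∂(Measure.pi fun _ : ι => ρ)‖ ≤ B := by
  rw [integral_pi_eq_integral_update ρ i hf]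
  refine (norm_integral_le_of_norm_le_const (ae_of_all _ hB)).trans_eq ?_
  simp

/-- Bounded measurable complex function. -/
structure IsBddMeas {X : Type*} [MeasurableSpace X] (f : X → ℂ) : Prop where
  stronglyMeasurable : StronglyMeasurable f
  bdd : ∃ M, ∀ x, ‖f x‖ ≤ M

namespace IsBddMeas
variable {X : Type*} [MeasurableSpace X] {f g : X → ℂ} {P : Measure X}

theorem integrable [IsFiniteMeasure P] (hf : IsBddMeas f) : Integrable f P := by
  obtain ⟨M, hM⟩ := hf.bdd
  exact Integrable.of_bound hf.1.aestronglyMeasurable M (ae_of_all _ hM)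

theorem sub (hf : IsBddMeas f) (hg : IsBddMeas g) : IsBddMeas (fun x => f x - g x) := by
  obtain ⟨M, hM⟩ := hf.bdd
  obtain ⟨M', hM'⟩ := hg.bdd
  exact ⟨hf.1.sub hg.1, M + M', fun x => (norm_sub_le _ _).trans (add_le_add (hM x) (hM' x))⟩

theorem const (c : ℂ) : IsBddMeas (fun _ : X => c) := ⟨stronglyMeasurable_const, ‖c‖, fun _ => le_rfl⟩

theorem comp {X' : Type*} [MeasurableSpace X'] {φ : X' → X} (hf : IsBddMeas f) (hφ : Measurable φ) :
    IsBddMeas (fun x => f (φ x)) :=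
  ⟨hf.1.comp_measurable hφ, hf.bdd.imp fun _ h _ => h _⟩

theorem integrable_norm_sq [IsFiniteMeasure P] (hf : IsBddMeas f) :
    Integrable (fun x => ‖f x‖ ^ 2) P := by
  obtain ⟨M, hM⟩ := hf.bdd
  refine Integrable.of_bound (hf.1.norm.pow 2).aestronglyMeasurable (M ^ 2) (ae_of_all _ fun x => ?_)
  rw [Real.norm_of_nonneg (by positivity)]
  gcongr
  exact hM x

end IsBddMeas

/-- Bias–variance decomposition: the cross term vanishes because `φ - ∫ φ` has mean zero. -/
theorem integral_norm_sub_sq_eq {φ : V → ℂ} (hφ : IsBddMeas φ) (c : ℂ) :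
    ∫ v, ‖φ v - c‖ ^ 2 ∂ρ = ∫ v, ‖φ v - ∫ w, φ w ∂ρ‖ ^ 2 ∂ρ + ‖(∫ w, φ w ∂ρ) - c‖ ^ 2 := by
  set a := ∫ w, φ w ∂ρ with ha
  have e : ∀ v, ‖φ v - c‖ ^ 2 = ‖φ v - a‖ ^ 2 + ‖a - c‖ ^ 2
      + 2 * ((φ v - a) * (starRingEnd ℂ) (a - c)).re := fun v => by
    have : φ v - c = (φ v - a) + (a - c) := by ring
    rw [this, Complex.sq_norm, Complex.normSq_add, ← Complex.sq_norm, ← Complex.sq_norm]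
  have hz : ∫ v, ((φ v - a) * (starRingEnd ℂ) (a - c)).re ∂ρ = 0 := by
    have h2 : Integrable (fun v => (φ v - a) * (starRingEnd ℂ) (a - c)) ρ :=
      (hφ.integrable.sub (integrable_const a)).mul_const _
    have := integral_re h2
    simp only [RCLike.re_to_complex] at this
    rw [this, integral_mul_const, integral_sub hφ.integrable (integrable_const a), ← ha]
    simp
  have h3 : Integrable (fun v => ((φ v - a) * (starRingEnd ℂ) (a - c)).re) ρ :=
    ((hφ.integrable.sub (integrable_const a)).mul_const _).re
  simp_rw [e]
  have h4 : Integrable (fun v => ‖φ v - a‖ ^ 2 + ‖a - c‖ ^ 2) ρ :=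
    (hφ.sub (IsBddMeas.const a)).integrable_norm_sq.add (integrable_const _)
  rw [integral_add h4 (h3.const_mul 2), integral_add (hφ.sub (IsBddMeas.const a)).integrable_norm_sq
    (integrable_const _), integral_const_mul, hz]
  simp

theorem integral_norm_sub_mean_sq_le {φ : V → ℂ} (hφ : IsBddMeas φ) (c : ℂ) :
    ∫ v, ‖φ v - ∫ w, φ w ∂ρ‖ ^ 2 ∂ρ ≤ ∫ v, ‖φ v - c‖ ^ 2 ∂ρ := by
  rw [integral_norm_sub_sq_eq ρ hφ c]
  exact le_add_of_nonneg_right (by positivity)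

theorem norm_integral_sq_le {φ : V → ℂ} (hφ : IsBddMeas φ) :
    ‖∫ v, φ v ∂ρ‖ ^ 2 ≤ ∫ v, ‖φ v‖ ^ 2 ∂ρ := by
  have := integral_norm_sub_sq_eq ρ hφ 0
  simp only [sub_zero] at this
  rw [this]
  exact le_add_of_nonneg_left (integral_nonneg fun _ => by positivity)

/-- Average of `f` over the `i`-th coordinate. -/
noncomputable def coordAvg (i : ι) (f : (ι → V) → ℂ) (x : ι → V) : ℂ :=
  ∫ v, f (Function.update x i v) ∂ρ

omit [Fintype ι] in
theorem IsBddMeas.coordAvg {f : (ι → V) → ℂ} (hf : IsBddMeas f) (i : ι) :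
    IsBddMeas (coordAvg ρ i f) := by
  obtain ⟨M, hM⟩ := hf.bdd
  refine ⟨?_, M, fun x => ?_⟩
  · exact (hf.1.comp_measurable (measurable_update_pair i)).integral_prod_right'
  · refine (norm_integral_le_of_norm_le_const (ae_of_all _ fun v => hM _)).trans_eq ?_
    simp

theorem integral_coordAvg {f : (ι → V) → ℂ} (hf : IsBddMeas f) (i : ι) :
    ∫ x, coordAvg ρ i f x ∂(Measure.pi fun _ : ι => ρ) = ∫ x, f x ∂(Measure.pi fun _ : ι => ρ) :=
  (integral_pi_eq_integral_update ρ i hf.integrable).symm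

omit [Fintype ι] [IsProbabilityMeasure ρ] in
theorem coordAvg_update_self (f : (ι → V) → ℂ) (i : ι) (x : ι → V) (w : V) :
    coordAvg ρ i f (Function.update x i w) = coordAvg ρ i f x := by
  simp [coordAvg]

/-- One step of Efron–Stein. With the other coordinates frozen, the average of `h` is a constant, so
bias–variance splits the error into the variance of `f` in coordinate `i`, at most `B`, and the
squared difference of the averages of `f` and `h`, which Jensen bounds by the mean of `‖f - h‖²`. -/
theorem integral_norm_sub_coordAvg_sq_le {f h : (ι → V) → ℂ} (hf : IsBddMeas f) (hh : IsBddMeas h)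
    (i : ι) {B : ℝ}
    (hB : ∀ x, ∃ g : ℂ, ∫ v, ‖f (Function.update x i v) - g‖ ^ 2 ∂ρ ≤ B) :
    ∫ x, ‖f x - coordAvg ρ i h x‖ ^ 2 ∂(Measure.pi fun _ : ι => ρ)
      ≤ B + ∫ x, ‖f x - h x‖ ^ 2 ∂(Measure.pi fun _ : ι => ρ) := by
  have hu : ∀ x : ι → V, Measurable (fun v => Function.update x i v) := fun x =>
    (measurable_update_pair i).comp measurable_prodMk_left
  rw [integral_pi_eq_integral_update ρ i (hf.sub (hh.coordAvg ρ i)).integrable_norm_sq,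
    integral_pi_eq_integral_update ρ i (hf.sub hh).integrable_norm_sq]
  have hint : Integrable (fun x => ∫ v, ‖f (Function.update x i v) - h (Function.update x i v)‖ ^ 2 ∂ρ)
      (Measure.pi fun _ : ι => ρ) :=
    ((measurePreserving_update ρ i).integrable_comp
      (hf.sub hh).integrable_norm_sq.1 |>.2 (hf.sub hh).integrable_norm_sq).integral_prod_left
  have hB' : B + ∫ x, ∫ v, ‖f (Function.update x i v) - h (Function.update x i v)‖ ^ 2 ∂ρ
        ∂(Measure.pi fun _ : ι => ρ)
      = ∫ x, (B + ∫ v, ‖f (Function.update x i v) - h (Function.update x i v)‖ ^ 2 ∂ρ)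
        ∂(Measure.pi fun _ : ι => ρ) := by
    rw [integral_add (integrable_const _) hint]; simp
  rw [hB']
  refine integral_mono_of_nonneg (ae_of_all _ fun x => integral_nonneg fun v => by positivity)
    ((integrable_const _).add hint) (ae_of_all _ fun x => ?_)
  have hfx : IsBddMeas (fun v => f (Function.update x i v)) := hf.comp (hu x)
  have hhx : IsBddMeas (fun v => h (Function.update x i v)) := hh.comp (hu x)
  simp only [coordAvg_update_self]
  rw [integral_norm_sub_sq_eq ρ hfx]
  refine add_le_add ?_ ?_
  · obtain ⟨g, hg⟩ := hB x
    exact (integral_norm_sub_mean_sq_le ρ hfx g).trans hg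
  · have := norm_integral_sq_le ρ (hfx.sub hhx)
    rwa [integral_sub hfx.integrable hhx.integrable] at this

/-- **Efron–Stein inequality** for bounded functions of independent variables. -/
theorem efron_stein {f : (ι → V) → ℂ} (hf : IsBddMeas f) (B : ι → ℝ)
    (hB : ∀ i x, ∃ g : ℂ, ∫ v, ‖f (Function.update x i v) - g‖ ^ 2 ∂ρ ≤ B i) :
    ∫ x, ‖f x - ∫ x', f x' ∂(Measure.pi fun _ : ι => ρ)‖ ^ 2 ∂(Measure.pi fun _ : ι => ρ)
      ≤ ∑ i, B i := by
  -- Average out the coordinates of `s` one after another; averaging over `i` costs `B i`.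
  have key : ∀ s : Finset ι, ∃ h : (ι → V) → ℂ, IsBddMeas h ∧
      ∫ x, h x ∂(Measure.pi fun _ : ι => ρ) = ∫ x, f x ∂(Measure.pi fun _ : ι => ρ) ∧
      (∀ i ∈ s, ∀ x w, h (Function.update x i w) = h x) ∧
      ∫ x, ‖f x - h x‖ ^ 2 ∂(Measure.pi fun _ : ι => ρ) ≤ ∑ i ∈ s, B i := by
    intro s
    induction s using Finset.induction_on with
    | empty => exact ⟨f, hf, rfl, by simp, by simp⟩
    | insert i s his ih =>
      obtain ⟨h, h1, h2, h3, h4⟩ := ih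
      refine ⟨coordAvg ρ i h, h1.coordAvg ρ i, by rw [integral_coordAvg ρ h1, h2], ?_, ?_⟩
      · intro j hj x w
        by_cases hji : j = i
        · subst hji; exact coordAvg_update_self ρ h j x w
        · have hjs : j ∈ s := (Finset.mem_insert.1 hj).resolve_left hji
          simp only [coordAvg]
          congr 1
          ext v
          rw [Function.update_comm hji, h3 j hjs]
      · rw [Finset.sum_insert his]
        exact (integral_norm_sub_coordAvg_sq_le ρ hf h1 i (hB i)).trans (by gcongr)
  obtain ⟨h, h1, h2, h3, h4⟩ := key Finset.univ
  -- A function that ignores each single coordinate is constant: change the coordinates of `x` into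
  -- those of `y` one by one.
  have hconst : ∀ x y, h x = h y := by
    intro x y
    have : ∀ s : Finset ι, h (s.piecewise y x) = h x := by
      intro s
      induction s using Finset.induction_on with
      | empty => simp
      | insert i s his ih =>
        rw [Finset.piecewise_insert, h3 i (Finset.mem_univ i), ih]
    simpa using (this Finset.univ).symm
  have hval : ∀ x, h x = ∫ x', f x' ∂(Measure.pi fun _ : ι => ρ) := by
    intro x
    rw [← h2]
    simp_rw [fun y => hconst y x]
    simp
  simp_rw [hval] at h4
  exact h4

end EfronStein

/-! ### Moments of the complex Gaussian law -/

section ComplexGaussian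

theorem measurable_ofReal_add_mul_I :
    Measurable (fun p : ℝ × ℝ => (p.1 : ℂ) + (p.2 : ℂ) * Complex.I) := by fun_prop

instance : IsProbabilityMeasure stdComplexGaussian :=
  Measure.isProbabilityMeasure_map measurable_ofReal_add_mul_I.aemeasurable

theorem map_I_mul_stdComplexGaussian :
    stdComplexGaussian.map (fun z => Complex.I * z) = stdComplexGaussian := by
  have h1 : ((gaussianReal 0 (1 / 2)).prod (gaussianReal 0 (1 / 2))).map
      (fun p : ℝ × ℝ => (-p.2, p.1)) = (gaussianReal 0 (1 / 2)).prod (gaussianReal 0 (1 / 2)) := by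
    have e : (fun p : ℝ × ℝ => (-p.2, p.1)) = (Prod.map (fun x : ℝ => -x) id) ∘ Prod.swap := rfl
    rw [e, ← Measure.map_map (by fun_prop) measurable_swap, Measure.prod_swap,
      ← Measure.map_prod_map _ _ (by fun_prop) (by fun_prop), gaussianReal_map_neg]
    simp
  conv_rhs => rw [stdComplexGaussian, ← h1, Measure.map_map measurable_ofReal_add_mul_I (by fun_prop)]
  rw [stdComplexGaussian, Measure.map_map (by fun_prop) measurable_ofReal_add_mul_I]
  congr 1
  ext p
  simp only [Function.comp_apply]
  push_cast
  linear_combination (p.2 : ℂ) * Complex.I_mul_I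

theorem memLp_id_stdComplexGaussian : MemLp (id : ℂ → ℂ) 4 stdComplexGaussian := by
  rw [stdComplexGaussian, memLp_map_measure_iff (by fun_prop) measurable_ofReal_add_mul_I.aemeasurable]
  have h := memLp_id_gaussianReal' (μ := 0) (v := 1 / 2) 4 (by simp)
  have h1 : MemLp (fun p : ℝ × ℝ => p.1) 4 ((gaussianReal 0 (1 / 2)).prod (gaussianReal 0 (1 / 2))) :=
    h.comp_measurePreserving measurePreserving_fst
  have h2 : MemLp (fun p : ℝ × ℝ => p.2) 4 ((gaussianReal 0 (1 / 2)).prod (gaussianReal 0 (1 / 2))) :=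
    h.comp_measurePreserving measurePreserving_snd
  have h3 : MemLp (fun p : ℝ × ℝ => (p.1 : ℂ)) 4
      ((gaussianReal 0 (1 / 2)).prod (gaussianReal 0 (1 / 2))) := h1.ofReal
  have h4 : MemLp (fun p : ℝ × ℝ => (p.2 : ℂ)) 4
      ((gaussianReal 0 (1 / 2)).prod (gaussianReal 0 (1 / 2))) := h2.ofReal
  have h5 : MemLp (fun p : ℝ × ℝ => (p.1 : ℂ) + Complex.I * (p.2 : ℂ)) 4
      ((gaussianReal 0 (1 / 2)).prod (gaussianReal 0 (1 / 2))) := h3.add (h4.const_mul Complex.I)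
  refine (memLp_congr_ae (ae_of_all _ fun p => ?_)).1 h5
  simp [mul_comm]

theorem integrable_norm_pow_four : Integrable (fun z : ℂ => ‖z‖ ^ 4) stdComplexGaussian := by
  have := memLp_id_stdComplexGaussian.integrable_norm_pow (by norm_num)
  simpa using this

/-- The mixed moment `E[zᵖ z̄^q]` of a standard complex Gaussian variable. -/
noncomputable def gaussMoment (p q : ℕ) : ℂ := ∫ z, z ^ p * star z ^ q ∂stdComplexGaussian

theorem integrable_gaussMoment {p q : ℕ} (hp : p ≤ 2) (hq : q ≤ 2) :
    Integrable (fun z : ℂ => z ^ p * star z ^ q) stdComplexGaussian := by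
  refine Integrable.mono' ((integrable_const (1 : ℝ)).add integrable_norm_pow_four)
    (by fun_prop) (ae_of_all _ fun z => ?_)
  rw [norm_mul, norm_pow, norm_pow, norm_star, ← pow_add]
  rcases le_total ‖z‖ 1 with h | h
  · exact (pow_le_one₀ (norm_nonneg _) h).trans (le_add_of_nonneg_right (by positivity))
  · exact (pow_le_pow_right₀ h (by omega)).trans (le_add_of_nonneg_left (by positivity))

/-- Invariance of the law under `z ↦ i z` multiplies the moment by `i^(p - q)`, which differs from
`1` because `0 < |p - q| ≤ 2`. -/
theorem gaussMoment_eq_zero {p q : ℕ} (hp : p ≤ 2) (hq : q ≤ 2) (hpq : p ≠ q) :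
    gaussMoment p q = 0 := by
  have h : gaussMoment p q = Complex.I ^ p * star Complex.I ^ q * gaussMoment p q := by
    conv_lhs => rw [gaussMoment, ← map_I_mul_stdComplexGaussian]
    rw [integral_map (by fun_prop) (by fun_prop), gaussMoment, ← integral_const_mul]
    congr 1
    ext z
    rw [star_mul, mul_pow, mul_pow]; ring
  have hI : Complex.I ^ p * star Complex.I ^ q ≠ 1 := by
    have e : star Complex.I = -Complex.I := by simp
    rw [e]
    interval_cases p <;> interval_cases q <;>
      simp_all [Complex.ext_iff, pow_two] <;> norm_num
  have : (1 - Complex.I ^ p * star Complex.I ^ q) * gaussMoment p q = 0 := by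
    linear_combination h
  exact (mul_eq_zero.1 this).resolve_left (sub_ne_zero.2 hI.symm)

theorem gaussMoment_zero : gaussMoment 0 0 = 1 := by simp [gaussMoment]

theorem integral_sq_gaussianReal_half : ∫ x, x ^ 2 ∂(gaussianReal 0 (1 / 2)) = 1 / 2 := by
  have h := variance_fun_id_gaussianReal (μ := 0) (v := 1 / 2)
  rw [variance_eq_integral (by fun_prop)] at h
  simpa using h

theorem gaussMoment_one : gaussMoment 1 1 = 1 := by
  have h := memLp_id_gaussianReal' (μ := 0) (v := 1 / 2) 2 (by simp)
  have hi : Integrable (fun x : ℝ => x ^ 2) (gaussianReal 0 (1 / 2)) := h.integrable_sq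
  have h1 : Integrable (fun p : ℝ × ℝ => p.1 ^ 2)
      ((gaussianReal 0 (1 / 2)).prod (gaussianReal 0 (1 / 2))) := hi.comp_fst _
  have h2 : Integrable (fun p : ℝ × ℝ => p.2 ^ 2)
      ((gaussianReal 0 (1 / 2)).prod (gaussianReal 0 (1 / 2))) := hi.comp_snd _
  have key : ∀ p : ℝ × ℝ, ((p.1 : ℂ) + (p.2 : ℂ) * Complex.I) ^ 1 *
      star ((p.1 : ℂ) + (p.2 : ℂ) * Complex.I) ^ 1 = ((p.1 ^ 2 + p.2 ^ 2 : ℝ) : ℂ) := by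
    intro p
    rw [pow_one, pow_one, Complex.star_def, Complex.mul_conj, Complex.normSq_add_mul_I]
  rw [gaussMoment, stdComplexGaussian, integral_map measurable_ofReal_add_mul_I.aemeasurable
    (by fun_prop)]
  simp_rw [key]
  rw [integral_complex_ofReal, integral_add h1 h2]
  have e1 := integral_fun_fst (μ := gaussianReal 0 (1 / 2)) (ν := gaussianReal 0 (1 / 2))
    (fun x : ℝ => x ^ 2)
  have e2 := integral_fun_snd (μ := gaussianReal 0 (1 / 2)) (ν := gaussianReal 0 (1 / 2))
    (fun x : ℝ => x ^ 2)
  rw [e1, e2, integral_sq_gaussianReal_half]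
  norm_num

variable {n : Type*} [Fintype n] [DecidableEq n]

/-- The law of a vector with i.i.d. standard complex Gaussian entries. -/
noncomputable abbrev gaussVec (n : Type*) [Fintype n] : Measure (n → ℂ) :=
  Measure.pi fun _ => stdComplexGaussian

omit [DecidableEq n] in
theorem integrable_monomial {p q : n → ℕ} (hp : ∀ m, p m ≤ 2) (hq : ∀ m, q m ≤ 2) :
    Integrable (fun x : n → ℂ => ∏ m, x m ^ p m * star (x m) ^ q m) (gaussVec n) :=
  Integrable.fintype_prod fun m => integrable_gaussMoment (hp m) (hq m)

omit [DecidableEq n] in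
theorem integral_monomial (p q : n → ℕ) :
    ∫ x : n → ℂ, ∏ m, x m ^ p m * star (x m) ^ q m ∂(gaussVec n) = ∏ m, gaussMoment (p m) (q m) :=
  integral_fintype_prod_eq_prod (fun m (z : ℂ) => z ^ p m * star z ^ q m)

theorem monomial_two (i j : n) (x : n → ℂ) :
    star (x i) * x j = ∏ m, x m ^ (if m = j then 1 else 0) * star (x m) ^ (if m = i then 1 else 0) := by
  simp only [Finset.prod_mul_distrib, pow_ite, pow_one, pow_zero, Finset.prod_ite_eq',
    Finset.mem_univ, if_true]
  ring

theorem monomial_four (i j k l : n) (x : n → ℂ) :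
    star (x i) * x j * star (star (x k) * x l)
      = ∏ m, x m ^ ((if m = j then 1 else 0) + (if m = k then 1 else 0)) *
        star (x m) ^ ((if m = i then 1 else 0) + (if m = l then 1 else 0)) := by
  simp only [Finset.prod_mul_distrib, pow_add, pow_ite, pow_one, pow_zero, Finset.prod_ite_eq',
    Finset.mem_univ, if_true, star_mul, star_star]
  ring

theorem integrable_two (i j : n) : Integrable (fun x : n → ℂ => star (x i) * x j) (gaussVec n) := by
  simp_rw [monomial_two]
  exact integrable_monomial (fun m => by split_ifs <;> simp) (fun m => by split_ifs <;> simp)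

theorem integrable_four (i j k l : n) :
    Integrable (fun x : n → ℂ => star (x i) * x j * star (star (x k) * x l)) (gaussVec n) := by
  simp_rw [monomial_four]
  exact integrable_monomial (fun m => by split_ifs <;> simp) (fun m => by split_ifs <;> simp)

theorem integral_two (i j : n) :
    ∫ x : n → ℂ, star (x i) * x j ∂(gaussVec n) = if i = j then 1 else 0 := by
  simp_rw [monomial_two]
  rw [integral_monomial]
  split_ifs with h
  · subst h
    refine Finset.prod_eq_one fun m _ => ?_
    split_ifs
    · exact gaussMoment_one
    · exact gaussMoment_zero
  · refine Finset.prod_eq_zero (Finset.mem_univ i) ?_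
    rw [if_neg h, if_pos rfl]
    exact gaussMoment_eq_zero (by simp) (by simp) (by simp)

/-- The products `x̄ᵢ xⱼ` are pairwise uncorrelated: a fourth moment survives only if each
coordinate occurs as often conjugated as unconjugated, which forces `{j, k} = {i, l}` as multisets,
and the pairing `i = j`, `k = l` is the product of means being subtracted. The value of `E |x|⁴` is
not needed. -/
theorem integral_four (i j k l : n) :
    ∫ x : n → ℂ, star (x i) * x j * star (star (x k) * x l) ∂(gaussVec n)
      - (if i = j then 1 else 0) * (if k = l then 1 else 0)
      = if k = i ∧ l = j then (if i = j then gaussMoment 2 2 - 1 else 1) else 0 := by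
  simp_rw [monomial_four]
  rw [integral_monomial]
  -- One unbalanced coordinate annihilates the whole product; `ho` and `hd` treat balanced products
  -- with two distinct indices and with one repeated index.
  have hz : ∀ m, (if m = j then 1 else 0) + (if m = k then 1 else 0) ≠
      (if m = i then 1 else 0) + (if m = l then 1 else 0) →
      ∏ m, gaussMoment ((if m = j then 1 else 0) + (if m = k then 1 else 0))
        ((if m = i then 1 else 0) + (if m = l then 1 else 0)) = 0 := fun m hm =>
    Finset.prod_eq_zero (Finset.mem_univ m) (gaussMoment_eq_zero (by split_ifs <;> simp)
      (by split_ifs <;> simp) hm)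
  have ho : ∀ a b : n, a ≠ b → ∏ m, gaussMoment ((if m = a then 1 else 0) + (if m = b then 1 else 0))
        ((if m = a then 1 else 0) + (if m = b then 1 else 0)) = 1 := fun a b hab => by
    refine Finset.prod_eq_one fun m _ => ?_
    by_cases h1 : m = a
    · have h2 : m ≠ b := fun h => hab (h1.symm.trans h)
      simp [h1, hab, gaussMoment_one]
    · by_cases h2 : m = b
      · simp [h2, hab.symm, gaussMoment_one]
      · simp [h1, h2, gaussMoment_zero]
  have hd : ∀ a : n, ∏ m, gaussMoment ((if m = a then 1 else 0) + (if m = a then 1 else 0))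
        ((if m = a then 1 else 0) + (if m = a then 1 else 0)) = gaussMoment 2 2 := fun a => by
    rw [Finset.prod_eq_single a]
    · simp
    · intro b _ hb; simp [hb, gaussMoment_zero]
    · simp
  by_cases hij : i = j
  · subst hij
    by_cases hkl : k = l
    · subst hkl
      by_cases hik : i = k
      · subst hik; simp [hd]
      · have hki : k ≠ i := fun h => hik h.symm
        simp [ho i k hik, hki]
    · rw [hz k]
      · have : ¬ (k = i ∧ l = i) := fun h => hkl (h.1.trans h.2.symm)
        simp [hkl, this]
      · simp [hkl]
  · by_cases hki : k = i
    · subst hki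
      by_cases hlj : l = j
      · subst hlj
        have := ho l k (fun h => hij h.symm)
        simp only [hij, add_comm] at this ⊢
        simp [this]
      · rw [hz j]
        · simp [hij, hlj]
        · have : j ≠ l := fun h => hlj h.symm
          have h' : j ≠ k := fun h => hij h.symm
          simp [this, h']
    · rw [hz i]
      · simp [hij, hki]
      · have : i ≠ k := fun h => hki h.symm
        simp only [hij, this, if_true, if_false]
        split_ifs <;> simp

end ComplexGaussian

/-! ### Concentration of Hermitian forms -/

section ColumnLaw
open Matrix
open scoped Matrix.Norms.L2Operator

variable {n : Type*} [Fintype n] [DecidableEq n]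

omit [DecidableEq n] in
theorem quadForm_eq_sum (A : Matrix n n ℂ) (x : n → ℂ) :
    quadForm A x = ∑ p : n × n, A p.1 p.2 * (star (x p.1) * x p.2) := by
  rw [Fintype.sum_prod_type]
  simp only [quadForm, dotProduct, mulVec, Finset.mul_sum, Pi.star_apply]
  exact Finset.sum_congr rfl fun i _ => Finset.sum_congr rfl fun j _ => by ring

theorem trace_eq_sum_ite (A : Matrix n n ℂ) :
    A.trace = ∑ p : n × n, A p.1 p.2 * (if p.1 = p.2 then 1 else 0) := by
  rw [Fintype.sum_prod_type]
  simp [trace]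

theorem integrable_quadForm_gaussVec (A : Matrix n n ℂ) : Integrable (quadForm A) (gaussVec n) := by
  have : quadForm A = fun x => ∑ p : n × n, A p.1 p.2 * (star (x p.1) * x p.2) :=
    funext (quadForm_eq_sum A)
  rw [this]
  exact integrable_finsetSum _ fun p _ => (integrable_two p.1 p.2).const_mul _

theorem integral_quadForm_gaussVec (A : Matrix n n ℂ) : ∫ x, quadForm A x ∂(gaussVec n) = A.trace := by
  simp_rw [quadForm_eq_sum]
  rw [integral_finsetSum _ fun p _ => (integrable_two p.1 p.2).const_mul _, trace_eq_sum_ite]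
  simp_rw [integral_const_mul, integral_two]

omit [DecidableEq n] in
theorem normSq_quadForm_eq (A : Matrix n n ℂ) (x : n → ℂ) :
    ((‖quadForm A x‖ ^ 2 : ℝ) : ℂ) = ∑ p : n × n, ∑ q : n × n, A p.1 p.2 * star (A q.1 q.2) *
      (star (x p.1) * x p.2 * star (star (x q.1) * x q.2)) := by
  rw [← Complex.normSq_eq_norm_sq, ← Complex.mul_conj, ← Complex.star_def, quadForm_eq_sum, star_sum,
    Finset.sum_mul_sum]
  refine Finset.sum_congr rfl fun p _ => Finset.sum_congr rfl fun q _ => ?_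
  rw [star_mul]
  ring

theorem integrable_normSq_quadForm (A : Matrix n n ℂ) :
    Integrable (fun x => ((‖quadForm A x‖ ^ 2 : ℝ) : ℂ)) (gaussVec n) := by
  simp_rw [normSq_quadForm_eq]
  exact integrable_finsetSum _ fun p _ => integrable_finsetSum _ fun q _ =>
    (integrable_four _ _ _ _).const_mul _

theorem memLp_quadForm_gaussVec (A : Matrix n n ℂ) : MemLp (quadForm A) 2 (gaussVec n) := by
  rw [memLp_two_iff_integrable_sq_norm (continuous_quadForm A).aestronglyMeasurable]
  have := (integrable_normSq_quadForm A).re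
  simpa only [RCLike.re_to_complex, Complex.ofReal_re] using this

/-- A bound for the variance of Hermitian forms in standard complex Gaussian vectors. -/
noncomputable def quadVarConst : ℝ := ‖gaussMoment 2 2‖ + 1

theorem quadVarConst_pos : 0 < quadVarConst := by unfold quadVarConst; positivity

/-- Since distinct products `x̄ᵢ xⱼ` are uncorrelated, the variance is a weighted sum of `|A i j|²`
with bounded weights, hence a multiple of the squared Frobenius norm. -/
theorem integral_norm_quadForm_sub_trace_sq_le (A : Matrix n n ℂ) :
    ∫ x, ‖quadForm A x - A.trace‖ ^ 2 ∂(gaussVec n)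
      ≤ quadVarConst * (Fintype.card n * ‖A‖ ^ 2) := by
  have hm := memLp_quadForm_gaussVec A
  have h1 : ((∫ x, ‖quadForm A x - A.trace‖ ^ 2 ∂(gaussVec n) : ℝ) : ℂ)
      = (∫ x, ((‖quadForm A x‖ ^ 2 : ℝ) : ℂ) ∂(gaussVec n)) - A.trace * star A.trace := by
    have e : ∀ x, ((‖quadForm A x - A.trace‖ ^ 2 : ℝ) : ℂ) = ((‖quadForm A x‖ ^ 2 : ℝ) : ℂ)
        - quadForm A x * star A.trace - star (quadForm A x) * A.trace + A.trace * star A.trace := by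
      intro x
      simp only [← Complex.normSq_eq_norm_sq, ← Complex.mul_conj, Complex.star_def, map_sub]
      ring
    rw [← integral_complex_ofReal]
    simp_rw [e]
    have i1 := integrable_normSq_quadForm A
    have i2 := (integrable_quadForm_gaussVec A).mul_const (star A.trace)
    have i3 : Integrable (fun x => star (quadForm A x) * A.trace) (gaussVec n) :=
      (Complex.conjCLE.toContinuousLinearMap.integrable_comp
        (integrable_quadForm_gaussVec A)).mul_const A.trace
    have i3' : ∫ x, star (quadForm A x) ∂(gaussVec n) = star A.trace := by
      rw [← integral_quadForm_gaussVec A]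
      exact integral_conj
    have i4 : Integrable (fun x => ((‖quadForm A x‖ ^ 2 : ℝ) : ℂ) - quadForm A x * star A.trace)
      (gaussVec n) := i1.sub i2
    have i5 : Integrable (fun x => ((‖quadForm A x‖ ^ 2 : ℝ) : ℂ) - quadForm A x * star A.trace
      - star (quadForm A x) * A.trace) (gaussVec n) := i4.sub i3
    rw [integral_add i5 (integrable_const _), integral_sub i4 i3, integral_sub i1 i2, integral_mul_const, integral_mul_const, integral_quadForm_gaussVec, i3']
    simp
    ring
  have h2 : (∫ x, ((‖quadForm A x‖ ^ 2 : ℝ) : ℂ) ∂(gaussVec n)) - A.trace * star A.trace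
      = ∑ p : n × n, A p.1 p.2 * star (A p.1 p.2) * (if p.1 = p.2 then gaussMoment 2 2 - 1 else 1) := by
    simp_rw [normSq_quadForm_eq]
    rw [integral_finsetSum _ fun p _ => integrable_finsetSum _ fun q _ =>
      (integrable_four _ _ _ _).const_mul _]
    rw [trace_eq_sum_ite, star_sum, Finset.sum_mul_sum, ← Finset.sum_sub_distrib]
    refine Finset.sum_congr rfl fun p _ => ?_
    rw [integral_finsetSum _ fun q _ => (integrable_four _ _ _ _).const_mul _,
      ← Finset.sum_sub_distrib]
    have : ∀ q : n × n, (∫ x : n → ℂ, A p.1 p.2 * star (A q.1 q.2) *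
        (star (x p.1) * x p.2 * star (star (x q.1) * x q.2)) ∂(gaussVec n))
        - A p.1 p.2 * (if p.1 = p.2 then 1 else 0) * star (A q.1 q.2 * (if q.1 = q.2 then 1 else 0))
        = A p.1 p.2 * star (A q.1 q.2) * (if q.1 = p.1 ∧ q.2 = p.2 then
          (if p.1 = p.2 then gaussMoment 2 2 - 1 else 1) else 0) := by
      intro q
      rw [← integral_four, integral_const_mul, star_mul]
      have : star (if q.1 = q.2 then (1 : ℂ) else 0) = if q.1 = q.2 then 1 else 0 := by
        split_ifs <;> simp
      rw [this]
      ring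
    rw [Finset.sum_congr rfl fun q _ => this q, Finset.sum_eq_single p]
    · simp
    · intro q _ hq
      rw [if_neg, mul_zero]
      exact fun h => hq (Prod.ext h.1 h.2)
    · simp
  have h3 : ‖((∫ x, ‖quadForm A x - A.trace‖ ^ 2 ∂(gaussVec n) : ℝ) : ℂ)‖
      ≤ ∑ p : n × n, ‖A p.1 p.2‖ ^ 2 * quadVarConst := by
    rw [h1, h2]
    refine (norm_sum_le _ _).trans (Finset.sum_le_sum fun p _ => ?_)
    rw [norm_mul, norm_mul, norm_star, ← sq]
    gcongr
    -- The weight is `gaussMoment 2 2 - 1` on the diagonal and `1` off it; the constant dominates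
    -- both.
    unfold quadVarConst
    split_ifs
    · simpa using norm_sub_le (gaussMoment 2 2) 1
    · simp
  rw [Complex.norm_real, ← Finset.sum_mul, Fintype.sum_prod_type] at h3
  refine (le_abs_self _).trans (h3.trans ?_)
  rw [mul_comm]
  exact mul_le_mul_of_nonneg_left (sum_norm_sq_entries_le A) quadVarConst_pos.le

/-- A law on `ℂⁿ` with covariance `κ⁻¹ R` whose Hermitian forms concentrate: their variance is
bounded by `D` times the squared operator norm. -/
structure IsColumnLaw (ρ : Measure (n → ℂ)) (R : Matrix n n ℂ) (κ D : ℝ) : Prop where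
  isProbabilityMeasure : IsProbabilityMeasure ρ
  memLp : ∀ A, MemLp (quadForm A) 2 ρ
  integral_quadForm : ∀ A, ∫ v, quadForm A v ∂ρ = (κ : ℂ)⁻¹ * (R * A).trace
  variance_le : ∀ A, ∫ v, ‖quadForm A v - (κ : ℂ)⁻¹ * (R * A).trace‖ ^ 2 ∂ρ ≤ D * ‖A‖ ^ 2

omit [DecidableEq n] in
theorem quadForm_smul_mulVec (s : ℝ) (S A : Matrix n n ℂ) (x : n → ℂ) :
    quadForm A ((s : ℂ) • S *ᵥ x) = (s : ℂ) ^ 2 * quadForm (Sᴴ * A * S) x := by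
  simp only [quadForm, mulVec_smul, star_smul, smul_dotProduct, dotProduct_smul, star_mulVec,
    smul_eq_mul]
  rw [← dotProduct_mulVec, mulVec_mulVec, mulVec_mulVec, Complex.star_def, Complex.conj_ofReal]
  ring

/-- The law of `κ^{-1/2} S x` for a standard complex Gaussian vector `x`. -/
noncomputable def columnLaw (S : Matrix n n ℂ) (κ : ℝ) : Measure (n → ℂ) :=
  (gaussVec n).map fun x => (((Real.sqrt κ)⁻¹ : ℝ) : ℂ) • S *ᵥ x

omit [DecidableEq n] in
theorem continuous_smul_mulVec (s : ℂ) (S : Matrix n n ℂ) :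
    Continuous (fun x : n → ℂ => s • S *ᵥ x) := by
  refine continuous_pi fun i => ?_
  simp only [Pi.smul_apply, mulVec, dotProduct]
  fun_prop

/-- A form in `κ^{-1/2} S x` is `κ⁻¹` times the form of `Sᴴ A S` in `x`, and `‖Sᴴ A S‖ ≤ ‖S‖² ‖A‖`.
-/
theorem isColumnLaw_columnLaw (S : Matrix n n ℂ) {κ : ℝ} (hκ : 0 < κ) :
    IsColumnLaw (columnLaw S κ) (S * Sᴴ) κ
      (quadVarConst * Fintype.card n * ‖S‖ ^ 4 / κ ^ 2) := by
  set s : ℝ := (Real.sqrt κ)⁻¹ with hs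
  have hs2 : (s : ℂ) ^ 2 = (κ : ℂ)⁻¹ := by
    rw [← Complex.ofReal_pow, hs, inv_pow, Real.sq_sqrt hκ.le, Complex.ofReal_inv]
  have hms : Measurable (fun x : n → ℂ => (s : ℂ) • S *ᵥ x) := (continuous_smul_mulVec _ S).measurable
  have htr : ∀ A, (Sᴴ * A * S).trace = (S * Sᴴ * A).trace := fun A => by
    rw [trace_mul_comm, ← Matrix.mul_assoc]
  have hq : ∀ A x, quadForm A ((s : ℂ) • S *ᵥ x) = (κ : ℂ)⁻¹ * quadForm (Sᴴ * A * S) x := fun A x => by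
    rw [quadForm_smul_mulVec, hs2]
  refine ⟨Measure.isProbabilityMeasure_map hms.aemeasurable, fun A => ?_, fun A => ?_, fun A => ?_⟩
  · rw [columnLaw, memLp_map_measure_iff (continuous_quadForm A).aestronglyMeasurable hms.aemeasurable]
    have : quadForm A ∘ (fun x : n → ℂ => (s : ℂ) • S *ᵥ x)
        = fun x => (κ : ℂ)⁻¹ * quadForm (Sᴴ * A * S) x := funext (hq A)
    rw [this]
    exact (memLp_quadForm_gaussVec _).const_mul _
  · rw [columnLaw, integral_map hms.aemeasurable (continuous_quadForm A).aestronglyMeasurable]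
    simp_rw [hq]
    rw [integral_const_mul, integral_quadForm_gaussVec, htr]
  · rw [columnLaw, integral_map hms.aemeasurable
      (Continuous.aestronglyMeasurable (by have := continuous_quadForm A; fun_prop))]
    simp_rw [hq, ← mul_sub, norm_mul, mul_pow, ← htr]
    rw [integral_const_mul]
    have h1 := integral_norm_quadForm_sub_trace_sq_le (Sᴴ * A * S)
    have h2 : ‖Sᴴ * A * S‖ ≤ ‖S‖ * ‖A‖ * ‖S‖ := by
      refine (norm_mul_le _ _).trans ?_
      gcongr
      refine (norm_mul_le _ _).trans_eq ?_
      rw [l2_opNorm_conjTranspose]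
    have h3 : ‖(κ : ℂ)⁻¹‖ ^ 2 = (κ ^ 2)⁻¹ := by
      rw [norm_inv, Complex.norm_real, Real.norm_of_nonneg hκ.le, inv_pow]
    rw [h3]
    calc (κ ^ 2)⁻¹ * ∫ x, ‖quadForm (Sᴴ * A * S) x - (Sᴴ * A * S).trace‖ ^ 2 ∂(gaussVec n)
        ≤ (κ ^ 2)⁻¹ * (quadVarConst * (Fintype.card n * (‖S‖ * ‖A‖ * ‖S‖) ^ 2)) := by
          have := quadVarConst_pos.le
          gcongr
          refine h1.trans ?_
          gcongr
      _ = _ := by field_simp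

namespace IsColumnLaw
variable {ρ : Measure (n → ℂ)} {R : Matrix n n ℂ} {κ D : ℝ} (h : IsColumnLaw ρ R κ D)
include h

theorem integrable (A : Matrix n n ℂ) : Integrable (quadForm A) ρ :=
  have := h.isProbabilityMeasure
  (h.memLp A).integrable (by norm_num)

theorem integrable_normSq : Integrable (fun v : n → ℂ => ∑ i, ‖v i‖ ^ 2) ρ := by
  have := (h.integrable 1).re
  simpa only [quadForm_one, RCLike.re_to_complex, Complex.ofReal_re] using this

theorem integral_normSq : ((∫ v : n → ℂ, ∑ i, ‖v i‖ ^ 2 ∂ρ : ℝ) : ℂ) = (κ : ℂ)⁻¹ * R.trace := by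
  have := h.integral_quadForm 1
  simp_rw [quadForm_one, mul_one] at this
  rwa [integral_complex_ofReal] at this

theorem integrable_sub_sq (A : Matrix n n ℂ) :
    Integrable (fun v => ‖quadForm A v - (κ : ℂ)⁻¹ * (R * A).trace‖ ^ 2) ρ := by
  have := h.isProbabilityMeasure
  exact ((h.memLp A).sub (memLp_const _)).integrable_norm_pow (by norm_num)

end IsColumnLaw

end ColumnLaw

/-! ### Gram matrices of the columns and leave-one-out versions -/

section Gram
open Matrix
open scoped ComplexOrder

variable {n k : Type*} [Fintype n] [DecidableEq n] [Fintype k] [DecidableEq k]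

omit [DecidableEq n] [DecidableEq k] [Fintype n] in
/-- The matrix `∑ⱼ xⱼ xⱼᴴ`. -/
noncomputable def colGram (x : k → n → ℂ) : Matrix n n ℂ := ∑ j, vecMulVec (x j) (star (x j))

/-- The matrix `∑ xₗ xₗᴴ` over `l ≠ j`. -/
noncomputable def gramErase (j : k) (x : k → n → ℂ) : Matrix n n ℂ :=
  ∑ l ∈ Finset.univ.erase j, vecMulVec (x l) (star (x l))

omit [Fintype n] [DecidableEq n] [DecidableEq k] [Fintype k] in
theorem posSemidef_sum_vecMulVec [Finite n] (s : Finset k) (x : k → n → ℂ) :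
    (∑ l ∈ s, vecMulVec (x l) (star (x l))).PosSemidef := by
  classical
  induction s using Finset.induction_on with
  | empty => simpa using PosSemidef.zero
  | insert a s ha ih =>
    rw [Finset.sum_insert ha]
    exact (posSemidef_vecMulVec_self_star _).add ih

omit [DecidableEq n] [DecidableEq k] in
theorem posSemidef_colGram (x : k → n → ℂ) : (colGram x).PosSemidef := posSemidef_sum_vecMulVec _ x

omit [DecidableEq n] in
theorem posSemidef_gramErase (j : k) (x : k → n → ℂ) : (gramErase j x).PosSemidef :=
  posSemidef_sum_vecMulVec _ x

omit [Fintype n] [DecidableEq n] in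
theorem colGram_eq_gramErase_add (j : k) (x : k → n → ℂ) :
    colGram x = gramErase j x + vecMulVec (x j) (star (x j)) := by
  rw [colGram, gramErase, Finset.sum_erase_add _ _ (Finset.mem_univ j)]

omit [Fintype n] [DecidableEq n] in
theorem gramErase_update (j : k) (x : k → n → ℂ) (v : n → ℂ) :
    gramErase j (Function.update x j v) = gramErase j x := by
  refine Finset.sum_congr rfl fun l hl => ?_
  rw [Function.update_of_ne (Finset.ne_of_mem_erase hl)]

omit [Fintype n] [DecidableEq n] in
theorem colGram_update (j : k) (x : k → n → ℂ) (v : n → ℂ) :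
    colGram (Function.update x j v) = gramErase j x + vecMulVec v (star v) := by
  rw [colGram_eq_gramErase_add j, gramErase_update, Function.update_self]

omit [Fintype n] [DecidableEq n] [DecidableEq k] [Fintype k] in
theorem continuous_sum_vecMulVec (s : Finset k) :
    Continuous fun x : k → n → ℂ => ∑ l ∈ s, vecMulVec (x l) (star (x l)) := by
  refine continuous_finsetSum _ fun l _ => ?_
  exact Continuous.matrix_vecMulVec (continuous_apply l) (continuous_star.comp (continuous_apply l))

/-- The inverse is the adjugate over the determinant, which is nonzero since the matrix is
invertible. Continuity is what supplies measurability of the random resolvents. -/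
theorem Continuous.matResolvent {T : Type*} [TopologicalSpace T] {H : T → Matrix n n ℂ} {z : T → ℂ}
    (hH : Continuous H) (hz : Continuous z) (hH' : ∀ t, (H t).IsHermitian) (hz' : ∀ t, (z t).im ≠ 0) :
    Continuous fun t => matResolvent (H t) (z t) := by
  have hc : Continuous fun t => H t - z t • (1 : Matrix n n ℂ) := hH.sub (hz.smul continuous_const)
  have hd : ∀ t, (H t - z t • (1 : Matrix n n ℂ)).det ≠ 0 := fun t h => by
    have := congrArg Matrix.det (sub_mul_matResolvent (hH' t) (hz' t))
    rw [det_mul, h, zero_mul, det_one] at this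
    exact zero_ne_one this
  simp only [_root_.matResolvent, Matrix.inv_def, Ring.inverse_eq_inv']
  exact (hc.matrix_det.inv₀ hd).smul hc.matrix_adjugate

variable {z : ℂ} (hz : z.im ≠ 0)
include hz

omit [DecidableEq k] in
theorem continuous_matResolvent_gram :
    Continuous fun x : k → n → ℂ => matResolvent (colGram x) z :=
  (continuous_sum_vecMulVec _).matResolvent continuous_const (fun x => (posSemidef_colGram x).1)
    fun _ => hz

theorem continuous_matResolvent_gramErase (j : k) :
    Continuous fun x : k → n → ℂ => matResolvent (gramErase j x) z :=
  (continuous_sum_vecMulVec _).matResolvent continuous_const (fun x => (posSemidef_gramErase j x).1)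
    fun _ => hz

omit [DecidableEq k] in
theorem continuous_trace_mul_matResolvent_gram (A : Matrix n n ℂ) :
    Continuous fun x : k → n → ℂ => (A * matResolvent (colGram x) z).trace :=
  (continuous_const.matrix_mul (continuous_matResolvent_gram hz)).matrix_trace

theorem continuous_quadForm_mul_gramErase (j : k) (A : Matrix n n ℂ) :
    Continuous fun x : k → n → ℂ => quadForm (A * matResolvent (gramErase j x) z) (x j) := by
  unfold quadForm
  exact (continuous_star.comp (continuous_apply j)).dotProduct
    ((continuous_const.matrix_mul (continuous_matResolvent_gramErase hz j)).matrix_mulVec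
      (continuous_apply j))

end Gram

/-! ### Variance of the resolvent trace and the leave-one-out identity -/

section RandomResolvent
open Matrix
open scoped Matrix.Norms.L2Operator ComplexOrder

variable {n k : Type*} [Fintype n] [DecidableEq n] [Fintype k] [DecidableEq k]

omit [DecidableEq k] in
theorem norm_trace_matResolvent_gram_le {z : ℂ} (hz : z.im ≠ 0) (x : k → n → ℂ) :
    ‖(matResolvent (colGram x) z).trace‖ ≤ Fintype.card n * |z.im|⁻¹ :=
  (norm_trace_le _).trans (by
    gcongr
    exact norm_matResolvent_le (posSemidef_colGram x).1 hz)

omit [DecidableEq k] in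
theorem isBddMeas_trace_matResolvent_gram {z : ℂ} (hz : z.im ≠ 0) :
    IsBddMeas fun x : k → n → ℂ => (matResolvent (colGram x) z).trace := by
  refine ⟨?_, _, norm_trace_matResolvent_gram_le hz⟩
  have := continuous_trace_mul_matResolvent_gram (n := n) (k := k) hz 1
  simp_rw [Matrix.one_mul] at this
  exact this.stronglyMeasurable

variable {ρ : Measure (n → ℂ)} {R : Matrix n n ℂ} {κ D : ℝ} (h : IsColumnLaw ρ R κ D)
  {z : ℂ} (hz : z.im ≠ 0)
include h hz

/-- The normalised trace is the mean of `quadForm (matResolvent G z)`, so it inherits the sign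
condition of each form. -/
theorem IsColumnLaw.im_mul_trace_nonneg {G : Matrix n n ℂ} (hG : G.PosSemidef) :
    0 ≤ (z * ((κ : ℂ)⁻¹ * (R * matResolvent G z).trace)).im * z.im := by
  have h1 : z * ((κ : ℂ)⁻¹ * (R * matResolvent G z).trace)
      = ∫ v, z * quadForm (matResolvent G z) v ∂ρ := by
    rw [integral_const_mul, h.integral_quadForm]
  have h2 := integral_im ((h.integrable (matResolvent G z)).const_mul z)
  simp only [RCLike.im_to_complex] at h2
  rw [h1, ← h2, ← integral_mul_const]
  exact integral_nonneg fun v => hG.im_mul_quadForm_matResolvent_nonneg hz v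

variable {t : ℝ} (ht : ∀ A, ‖(κ : ℂ)⁻¹ * (R * A).trace‖ ≤ t * ‖A‖)

omit [DecidableEq k] [Fintype k] in
include ht in
-- Adding the column `v` lowers `tr Q` by `(1 + q)⁻¹ p` with `q = vᴴ Q v` and `p = vᴴ Q² v`. The
-- centre `g` is obtained by replacing `p` and `q` by their means, so only the variances of two
-- Hermitian forms enter.
theorem IsColumnLaw.integral_trace_fluctuation_le (ht0 : 0 ≤ t) (hD : 0 ≤ D) {G : Matrix n n ℂ}
    (hG : G.PosSemidef) :
    ∃ g : ℂ, ∫ v, ‖(matResolvent (G + vecMulVec v (star v)) z).trace - g‖ ^ 2 ∂ρ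
      ≤ 2 * (‖z‖ / |z.im|) ^ 2 * (D / |z.im| ^ 4 + (t * ‖z‖ / |z.im| ^ 3) ^ 2 * (D / |z.im| ^ 2)) := by
  have hy : 0 < |z.im| := abs_pos.2 hz
  set y := |z.im| with hydef
  set Q := matResolvent G z with hQ
  have hQn : ‖Q‖ ≤ y⁻¹ := norm_matResolvent_le hG.1 hz
  have hQQ : ‖Q * Q‖ ≤ (y ^ 2)⁻¹ := by
    refine (norm_mul_le _ _).trans ?_
    rw [sq, mul_inv]
    gcongr
  set p0 : ℂ := (κ : ℂ)⁻¹ * (R * (Q * Q)).trace with hp0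
  set q0 : ℂ := (κ : ℂ)⁻¹ * (R * Q).trace with hq0
  have hq0z : 0 ≤ (z * q0).im * z.im := h.im_mul_trace_nonneg hz hG
  have hb0 := norm_inv_one_add_le hz hq0z
  have h10 := one_add_ne_zero_of_im hz hq0z
  refine ⟨Q.trace - (1 + q0)⁻¹ * p0, ?_⟩
  have hpt : ∀ v, ‖(matResolvent (G + vecMulVec v (star v)) z).trace
      - (Q.trace - (1 + q0)⁻¹ * p0)‖ ^ 2 ≤ 2 * (‖z‖ / y) ^ 2 * (‖quadForm (Q * Q) v - p0‖ ^ 2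
        + (t * ‖z‖ / y ^ 3) ^ 2 * ‖quadForm Q v - q0‖ ^ 2) := by
    intro v
    have hqz := hG.im_mul_quadForm_matResolvent_nonneg hz v
    have hb := norm_inv_one_add_le hz hqz
    have h1 := one_add_ne_zero_of_im hz hqz
    have htr := trace_mul_matResolvent_rankOne_sub hG hz v 1
    simp only [Matrix.one_mul, Matrix.mul_one] at htr
    rw [← hQ] at htr hqz hb h1
    -- Factoring out the random `(1 + q)⁻¹` makes the remainder linear in the two centred forms.
    have e : (matResolvent (G + vecMulVec v (star v)) z).trace - (Q.trace - (1 + q0)⁻¹ * p0)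
        = (1 + quadForm Q v)⁻¹ * (-(quadForm (Q * Q) v - p0)
          + (p0 * (1 + q0)⁻¹) * (quadForm Q v - q0)) := by
      have : (matResolvent (G + vecMulVec v (star v)) z).trace
          = Q.trace - (1 + quadForm Q v)⁻¹ * quadForm (Q * Q) v := by rw [← htr]; ring
      rw [this]
      field_simp
      ring
    have hp : ‖p0 * (1 + q0)⁻¹‖ ≤ t * ‖z‖ / y ^ 3 := by
      rw [norm_mul]
      calc ‖p0‖ * ‖(1 + q0)⁻¹‖ ≤ (t * (y ^ 2)⁻¹) * (‖z‖ / y) := by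
            gcongr
            exact (ht _).trans (by gcongr)
        _ = _ := by field_simp
    rw [e, norm_mul, mul_pow]
    have h3 : ‖-(quadForm (Q * Q) v - p0) + (p0 * (1 + q0)⁻¹) * (quadForm Q v - q0)‖ ^ 2
        ≤ 2 * (‖quadForm (Q * Q) v - p0‖ ^ 2
          + (t * ‖z‖ / y ^ 3) ^ 2 * ‖quadForm Q v - q0‖ ^ 2) := by
      have h4 : ‖-(quadForm (Q * Q) v - p0) + (p0 * (1 + q0)⁻¹) * (quadForm Q v - q0)‖
          ≤ ‖quadForm (Q * Q) v - p0‖ + (t * ‖z‖ / y ^ 3) * ‖quadForm Q v - q0‖ := by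
        refine (norm_add_le _ _).trans ?_
        rw [norm_neg, norm_mul]
        gcongr
      calc _ ≤ (‖quadForm (Q * Q) v - p0‖ + (t * ‖z‖ / y ^ 3) * ‖quadForm Q v - q0‖) ^ 2 := by
            gcongr
        _ ≤ _ := by
            rw [← mul_pow]
            exact add_sq_le
    calc _ ≤ (‖z‖ / y) ^ 2 * (2 * (‖quadForm (Q * Q) v - p0‖ ^ 2
          + (t * ‖z‖ / y ^ 3) ^ 2 * ‖quadForm Q v - q0‖ ^ 2)) := by gcongr
      _ = _ := by ring
  have i1 := h.integrable_sub_sq (Q * Q)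
  have i2 := h.integrable_sub_sq Q
  refine (integral_mono_of_nonneg (ae_of_all _ fun v => by positivity)
    ((i1.add (i2.const_mul ((t * ‖z‖ / y ^ 3) ^ 2))).const_mul (2 * (‖z‖ / y) ^ 2))
    (ae_of_all _ hpt)).trans ?_
  simp only [Pi.add_apply]
  rw [integral_const_mul, integral_add i1 (i2.const_mul _), integral_const_mul]
  have v1 := h.variance_le (Q * Q)
  have v2 := h.variance_le Q
  gcongr
  · refine v1.trans ?_
    calc D * ‖Q * Q‖ ^ 2 ≤ D * ((y ^ 2)⁻¹) ^ 2 := by gcongr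
      _ = D / y ^ 4 := by field_simp
  · refine v2.trans ?_
    calc D * ‖Q‖ ^ 2 ≤ D * (y⁻¹) ^ 2 := by gcongr
      _ = D / y ^ 2 := by field_simp

include ht in
-- Efron–Stein over the columns. In the application `D` is of order `1 / card k`, so the factor
-- `card k` cancels.
theorem IsColumnLaw.variance_trace_le (ht0 : 0 ≤ t) (hD : 0 ≤ D) :
    ∫ x : k → n → ℂ, ‖(matResolvent (colGram x) z).trace
        - ∫ x' : k → n → ℂ, (matResolvent (colGram x') z).trace ∂(Measure.pi fun _ => ρ)‖ ^ 2
        ∂(Measure.pi fun _ => ρ)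
      ≤ Fintype.card k * (2 * (‖z‖ / |z.im|) ^ 2 *
        (D / |z.im| ^ 4 + (t * ‖z‖ / |z.im| ^ 3) ^ 2 * (D / |z.im| ^ 2))) := by
  have := h.isProbabilityMeasure
  refine (efron_stein ρ (isBddMeas_trace_matResolvent_gram hz) (fun _ => 2 * (‖z‖ / |z.im|) ^ 2 *
    (D / |z.im| ^ 4 + (t * ‖z‖ / |z.im| ^ 3) ^ 2 * (D / |z.im| ^ 2))) fun j x => ?_).trans_eq
    (by rw [Finset.sum_const, Finset.card_univ, nsmul_eq_mul])
  simp_rw [colGram_update]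
  exact h.integral_trace_fluctuation_le hz ht ht0 hD (posSemidef_gramErase j x)

/-- The contribution of one column to the difference of `tr Q` and `tr T`. -/
noncomputable def columnDefect (R T : Matrix n n ℂ) (κ : ℝ) (z : ℂ) (j : k) (x : k → n → ℂ) : ℂ :=
  (1 + quadForm (matResolvent (gramErase j x) z) (x j))⁻¹ *
    ((κ : ℂ)⁻¹ * (R * T * matResolvent (colGram x) z).trace
      - quadForm (T * matResolvent (gramErase j x) z) (x j))

omit h in
-- Start from `Q - T = Q (β R - G) T`, where `G` is the Gram matrix, and expand `G` into its
-- columns. Sherman–Morrison turns column `j` into `bⱼ xⱼᴴ T Qⱼ xⱼ`, where `Qⱼ` omits the column and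
-- `bⱼ = (1 + xⱼᴴ Qⱼ xⱼ)⁻¹`. Replacing each form by `κ⁻¹ tr (R T Q)` leaves the defects, and the
-- replacements add up to `κ⁻¹ (∑ bⱼ) tr (R T Q)`, with `∑ bⱼ` known exactly in terms of `tr Q`.
theorem trace_sub_trace_eq (hκ : κ = Fintype.card k) (hκ0 : κ ≠ 0) {T : Matrix n n ℂ} (β : ℂ)
    (hT : (β • R - z • (1 : Matrix n n ℂ)) * T = 1) (x : k → n → ℂ) :
    (matResolvent (colGram x) z).trace - T.trace
      = (β - (κ : ℂ)⁻¹ * (κ - Fintype.card n - z * (matResolvent (colGram x) z).trace)) *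
          (R * T * matResolvent (colGram x) z).trace
        + ∑ j, columnDefect R T κ z j x := by
  set Q := matResolvent (colGram x) z with hQ
  have hQ1 : Q * (colGram x - z • (1 : Matrix n n ℂ)) = 1 := matResolvent_mul_sub (posSemidef_colGram x).1 hz
  have hsum : ∀ A : Matrix n n ℂ, (A * colGram x).trace = ∑ j, quadForm A (x j) := fun A => by
    rw [colGram, Finset.mul_sum, trace_sum]
    exact Finset.sum_congr rfl fun j _ => trace_mul_vecMulVec_star A (x j)
  set b : k → ℂ := fun j => (1 + quadForm (matResolvent (gramErase j x) z) (x j))⁻¹ with hb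
  have hne : ∀ j, 1 + quadForm (matResolvent (gramErase j x) z) (x j) ≠ 0 := fun j =>
    one_add_ne_zero_of_im hz ((posSemidef_gramErase j x).im_mul_quadForm_matResolvent_nonneg hz _)
  have hqf : ∀ (A : Matrix n n ℂ) j, quadForm (A * Q) (x j)
      = b j * quadForm (A * matResolvent (gramErase j x) z) (x j) := fun A j => by
    rw [hQ, colGram_eq_gramErase_add j x, quadForm_mul_matResolvent_rankOne (posSemidef_gramErase j x) hz]
  -- Evaluate `tr (Q G)` twice: `Q G = 1 + z Q` gives `n + z tr Q`, and the columns give `∑ (1 -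
  -- bⱼ)`.
  have hbsum : ∑ j, b j = κ - Fintype.card n - z * Q.trace := by
    have h1 : (Q * colGram x).trace = Fintype.card n + z * Q.trace := by
      have : Q * colGram x = 1 + z • Q := by
        rw [mul_sub, mul_smul_comm, Matrix.mul_one] at hQ1
        rw [← hQ1]; abel
      rw [this, trace_add, trace_one, trace_smul, smul_eq_mul]
    have h2 : ∀ j, quadForm Q (x j) = 1 - b j := fun j => by
      have := hqf 1 j
      rw [Matrix.one_mul, Matrix.one_mul] at this
      rw [this, hb]
      have := hne j
      field_simp
      ring
    rw [hsum, Finset.sum_congr rfl fun j _ => h2 j, Finset.sum_sub_distrib] at h1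
    simp only [Finset.sum_const, Finset.card_univ, nsmul_eq_mul, mul_one] at h1
    rw [hκ]
    push_cast
    linear_combination -h1
  have hdiff : Q - T = Q * (β • R - colGram x) * T := by
    have e : β • R - colGram x = (β • R - z • (1 : Matrix n n ℂ)) - (colGram x - z • (1 : Matrix n n ℂ)) := by
      abel
    rw [e]
    generalize β • R - z • (1 : Matrix n n ℂ) = A at *
    generalize colGram x - z • (1 : Matrix n n ℂ) = B at *
    rw [mul_sub, sub_mul, hQ1, Matrix.one_mul, Matrix.mul_assoc, hT, Matrix.mul_one]
  have htr : Q.trace - T.trace = β * (R * T * Q).trace - ∑ j, b j *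
      quadForm (T * matResolvent (gramErase j x) z) (x j) := by
    rw [← trace_sub, hdiff, mul_sub, sub_mul, trace_sub, mul_smul_comm, smul_mul_assoc, trace_smul,
      smul_eq_mul, Matrix.mul_assoc, trace_mul_comm, trace_mul_comm _ T, ← Matrix.mul_assoc, hsum]
    simp_rw [hqf]
  rw [htr]
  have hdef : ∀ j, columnDefect R T κ z j x = b j * ((κ : ℂ)⁻¹ * (R * T * Q).trace)
      - b j * quadForm (T * matResolvent (gramErase j x) z) (x j) := fun j => by
    rw [columnDefect, hb, hQ]; ring
  simp_rw [hdef]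
  rw [Finset.sum_sub_distrib, ← Finset.sum_mul, hbsum]
  have : (κ : ℂ) ≠ 0 := by exact_mod_cast hκ0
  ring

end RandomResolvent

/-! ### The self-consistent equation for the mean trace -/

section Bias
open Matrix
open scoped Matrix.Norms.L2Operator ComplexOrder

variable {n k : Type*} [Fintype n] [DecidableEq n] [Fintype k] [DecidableEq k]
  {ρ : Measure (n → ℂ)} {R : Matrix n n ℂ} {κ D : ℝ} (h : IsColumnLaw ρ R κ D)
  {z : ℂ} (hz : z.im ≠ 0) {t Λ : ℝ} (ht : ∀ A, ‖(κ : ℂ)⁻¹ * (R * A).trace‖ ≤ t * ‖A‖)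
  {T : Matrix n n ℂ} (hTn : ‖T‖ ≤ |z.im|⁻¹)

include h ht in
theorem IsColumnLaw.integral_normSq_le [Nonempty n] :
    ∫ v : n → ℂ, ∑ i, ‖v i‖ ^ 2 ∂ρ ≤ t := by
  have h1 := h.integral_normSq
  have h2 := ht 1
  rw [Matrix.mul_one, ← h1, Complex.norm_real, norm_one, mul_one] at h2
  exact (le_abs_self _).trans h2

include hz hTn in
theorem norm_mul_matResolvent_le {G : Matrix n n ℂ} (hG : G.IsHermitian) :
    ‖T * matResolvent G z‖ ≤ (|z.im| ^ 2)⁻¹ := by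
  refine (norm_mul_le _ _).trans ?_
  rw [sq, mul_inv]
  gcongr
  exact norm_matResolvent_le hG hz

include h hz ht hTn in
theorem IsColumnLaw.integrable_columnDefect (j : k) :
    Integrable (columnDefect R T κ z j) (Measure.pi fun _ : k => ρ) := by
  have := h.isProbabilityMeasure
  have hcont : Continuous (columnDefect R T κ z j) := by
    have h1 := continuous_quadForm_mul_gramErase (n := n) hz j (1 : Matrix n n ℂ)
    simp_rw [Matrix.one_mul] at h1
    have h2 := continuous_quadForm_mul_gramErase (n := n) hz j T
    have h3 := continuous_trace_mul_matResolvent_gram (n := n) (k := k) hz (R * T)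
    unfold columnDefect
    refine ((continuous_const.add h1).inv₀ fun x => ?_).mul ((continuous_const.mul h3).sub h2)
    exact one_add_ne_zero_of_im hz
      ((posSemidef_gramErase j x).im_mul_quadForm_matResolvent_nonneg hz _)
  have hi : Integrable (fun x : k → n → ℂ => ∑ i, ‖x j i‖ ^ 2) (Measure.pi fun _ : k => ρ) :=
    (measurePreserving_eval (fun _ : k => ρ) j).integrable_comp
      h.integrable_normSq.1 |>.2 h.integrable_normSq
  refine Integrable.mono' (((integrable_const (|t| * (|z.im| ^ 2)⁻¹)).add
    (hi.const_mul (|z.im| ^ 2)⁻¹)).const_mul (‖z‖ / |z.im|)) hcont.aestronglyMeasurable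
    (ae_of_all _ fun x => ?_)
  rw [columnDefect, norm_mul]
  simp only [Pi.add_apply]
  gcongr
  · exact norm_inv_one_add_le hz
      ((posSemidef_gramErase j x).im_mul_quadForm_matResolvent_nonneg hz _)
  · refine (norm_sub_le _ _).trans ?_
    gcongr
    · rw [Matrix.mul_assoc]
      refine (ht _).trans ?_
      gcongr
      · exact le_abs_self t
      · exact norm_mul_matResolvent_le hz hTn (posSemidef_colGram x).1
    · refine (norm_quadForm_le _ _).trans ?_
      gcongr
      exact norm_mul_matResolvent_le hz hTn (posSemidef_gramErase j x).1

include h hz ht hTn in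
-- Only column `j` is integrated. To first order the defect is a constant times a centred form, with
-- mean zero. What remains is the effect of removing one column inside `tr (R T Q)`, of relative
-- size `κ⁻¹`, and a product of two centred forms, controlled by their variances `D`.
theorem IsColumnLaw.norm_integral_columnDefect_le [Nonempty n] (hκ : 0 < κ) (hD : 0 ≤ D)
    (hR : ‖R‖ ≤ Λ)
    (j : k) (x : k → n → ℂ) :
    ‖∫ v, columnDefect R T κ z j (Function.update x j v) ∂ρ‖
      ≤ ‖z‖ ^ 2 / |z.im| ^ 5 * (κ⁻¹ * Λ * t + D) := by
  have := h.isProbabilityMeasure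
  have hy : 0 < |z.im| := abs_pos.2 hz
  set y := |z.im| with hydef
  have hG := posSemidef_gramErase j x
  simp only [columnDefect, gramErase_update, colGram_update, Function.update_self]
  set G := gramErase j x
  set Q := matResolvent G z with hQ
  have hΛ : 0 ≤ Λ := (norm_nonneg _).trans hR
  have hQn : ‖Q‖ ≤ y⁻¹ := norm_matResolvent_le hG.1 hz
  have hTQ : ‖T * Q‖ ≤ (y ^ 2)⁻¹ := norm_mul_matResolvent_le hz hTn hG.1
  set q0 : ℂ := (κ : ℂ)⁻¹ * (R * Q).trace with hq0
  set w0 : ℂ := (κ : ℂ)⁻¹ * (R * (T * Q)).trace with hw0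
  have hq0z : 0 ≤ (z * q0).im * z.im := h.im_mul_trace_nonneg hz hG
  have hb0 := norm_inv_one_add_le hz hq0z
  have h10 := one_add_ne_zero_of_im hz hq0z
  have i1 := h.integrable_sub_sq Q
  have i2 := h.integrable_sub_sq (T * Q)
  have i3 := h.integrable (T * Q)
  -- subtract the mean zero term
  have hzero : ∫ v, (1 + q0)⁻¹ * (w0 - quadForm (T * Q) v) ∂ρ = 0 := by
    rw [integral_const_mul, integral_sub (integrable_const _) i3, h.integral_quadForm]
    simp [hw0]
  have hpt : ∀ v, ‖(1 + quadForm Q v)⁻¹ * ((κ : ℂ)⁻¹ * (R * T * matResolvent (G +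
      vecMulVec v (star v)) z).trace - quadForm (T * Q) v)
      - (1 + q0)⁻¹ * (w0 - quadForm (T * Q) v)‖
      ≤ (‖z‖ / y) ^ 2 * (κ⁻¹ * (Λ / y ^ 3)) * ∑ i, ‖v i‖ ^ 2
        + (‖z‖ / y) ^ 2 * (1 / 2 * (‖quadForm Q v - q0‖ ^ 2 / y
          + y * ‖quadForm (T * Q) v - w0‖ ^ 2)) := by
    intro v
    have hqz := hG.im_mul_quadForm_matResolvent_nonneg hz v
    have hb := norm_inv_one_add_le hz hqz
    have h1 := one_add_ne_zero_of_im hz hqz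
    have htr := trace_mul_matResolvent_rankOne_sub hG hz v (R * T)
    rw [← hQ] at htr hqz hb h1
    -- The first summand is the rank-one correction to the trace; the second comes from replacing
    -- `(1 + q)⁻¹` by `(1 + q0)⁻¹`.
    have e : (1 + quadForm Q v)⁻¹ * ((κ : ℂ)⁻¹ * (R * T * matResolvent (G +
        vecMulVec v (star v)) z).trace - quadForm (T * Q) v)
        - (1 + q0)⁻¹ * (w0 - quadForm (T * Q) v)
        = -((1 + quadForm Q v)⁻¹ * (1 + quadForm Q v)⁻¹ * (κ : ℂ)⁻¹ * quadForm (Q * (R * T) * Q) v)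
          + (1 + quadForm Q v)⁻¹ * (1 + q0)⁻¹ * ((quadForm Q v - q0) * (quadForm (T * Q) v - w0)) := by
      have e1 : (R * T * matResolvent (G + vecMulVec v (star v)) z).trace
          = (R * (T * Q)).trace - (1 + quadForm Q v)⁻¹ * quadForm (Q * (R * T) * Q) v := by
        rw [← htr, Matrix.mul_assoc R T Q]; ring
      have e2 : (1 + quadForm Q v)⁻¹ - (1 + q0)⁻¹
          = -((1 + quadForm Q v)⁻¹ * (1 + q0)⁻¹ * (quadForm Q v - q0)) := by
        field_simp
        ring
      rw [e1]
      linear_combination (w0 - quadForm (T * Q) v) * e2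
    rw [e]
    refine (norm_add_le _ _).trans (add_le_add ?_ ?_)
    · have hκn : ‖(κ : ℂ)⁻¹‖ = κ⁻¹ := by
        rw [norm_inv, Complex.norm_real, Real.norm_of_nonneg hκ.le]
      rw [norm_neg, norm_mul, norm_mul, norm_mul, ← sq, hκn]
      have : ‖quadForm (Q * (R * T) * Q) v‖ ≤ Λ / y ^ 3 * ∑ i, ‖v i‖ ^ 2 := by
        refine (norm_quadForm_le _ _).trans ?_
        gcongr
        calc ‖Q * (R * T) * Q‖ ≤ ‖Q‖ * (‖R‖ * ‖T‖) * ‖Q‖ := by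
              refine (norm_mul_le _ _).trans ?_
              gcongr
              refine (norm_mul_le _ _).trans ?_
              gcongr
              exact norm_mul_le _ _
          _ ≤ y⁻¹ * (Λ * y⁻¹) * y⁻¹ := by gcongr
          _ = _ := by field_simp
      calc _ ≤ (‖z‖ / y) ^ 2 * κ⁻¹ * (Λ / y ^ 3 * ∑ i, ‖v i‖ ^ 2) := by gcongr
        _ = _ := by ring
    · rw [norm_mul, norm_mul, norm_mul]
      -- Weighted AM–GM: the variances are at most `D / y²` and `D / y⁴`, so the weights `1 / y` and
      -- `y` bring both to `D / y³`.
      have hm : ‖quadForm Q v - q0‖ * ‖quadForm (T * Q) v - w0‖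
          ≤ 1 / 2 * (‖quadForm Q v - q0‖ ^ 2 / y + y * ‖quadForm (T * Q) v - w0‖ ^ 2) := by
        generalize ‖quadForm Q v - q0‖ = a
        generalize ‖quadForm (T * Q) v - w0‖ = b
        have : 1 / 2 * (a ^ 2 / y + y * b ^ 2) - a * b = (a - y * b) ^ 2 / (2 * y) := by
          field_simp
          ring
        have : 0 ≤ (a - y * b) ^ 2 / (2 * y) := by positivity
        linarith
      calc _ ≤ (‖z‖ / y * (‖z‖ / y)) * (1 / 2 * (‖quadForm Q v - q0‖ ^ 2 / y
          + y * ‖quadForm (T * Q) v - w0‖ ^ 2)) := by gcongr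
        _ = _ := by ring
  have j1 := h.integrable_normSq.const_mul ((‖z‖ / y) ^ 2 * (κ⁻¹ * (Λ / y ^ 3)))
  have j2 : Integrable (fun v => ‖quadForm Q v - q0‖ ^ 2 / y) ρ := i1.div_const y
  have j3 : Integrable (fun v => y * ‖quadForm (T * Q) v - w0‖ ^ 2) ρ := i2.const_mul y
  have j4 : Integrable (fun v => ‖quadForm Q v - q0‖ ^ 2 / y
    + y * ‖quadForm (T * Q) v - w0‖ ^ 2) ρ := j2.add j3
  have j5 : Integrable (fun v => (‖z‖ / y) ^ 2 * (1 / 2 * (‖quadForm Q v - q0‖ ^ 2 / y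
          + y * ‖quadForm (T * Q) v - w0‖ ^ 2))) ρ := (j4.const_mul _).const_mul _
  have hcont : Continuous fun v : n → ℂ => matResolvent (G + vecMulVec v (star v)) z :=
    Continuous.matResolvent (continuous_const.add
      (Continuous.matrix_vecMulVec continuous_id continuous_star)) continuous_const
      (fun v => (hG.add (posSemidef_vecMulVec_self_star v)).1) fun _ => hz
  have hint : Integrable (fun v => (1 + quadForm Q v)⁻¹ * ((κ : ℂ)⁻¹ * (R * T * matResolvent (G +
      vecMulVec v (star v)) z).trace - quadForm (T * Q) v)
      - (1 + q0)⁻¹ * (w0 - quadForm (T * Q) v)) ρ := by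
    refine (j1.add j5).mono' (Continuous.aestronglyMeasurable ?_) (ae_of_all _ hpt)
    have c1 := continuous_quadForm Q
    have c2 := continuous_quadForm (T * Q)
    have c3 : Continuous fun v => (R * T * matResolvent (G + vecMulVec v (star v)) z).trace :=
      (continuous_const.matrix_mul hcont).matrix_trace
    refine (((continuous_const.add c1).inv₀ fun v => ?_).mul
      ((continuous_const.mul c3).sub c2)).sub (continuous_const.mul (continuous_const.sub c2))
    exact one_add_ne_zero_of_im hz (hG.im_mul_quadForm_matResolvent_nonneg hz v)
  have i4 : Integrable (fun v => (1 + q0)⁻¹ * (w0 - quadForm (T * Q) v)) ρ :=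
    ((integrable_const _).sub i3).const_mul _
  have hsub : ∫ v, (1 + quadForm Q v)⁻¹ * ((κ : ℂ)⁻¹ * (R * T * matResolvent (G +
      vecMulVec v (star v)) z).trace - quadForm (T * Q) v) ∂ρ
      = ∫ v, ((1 + quadForm Q v)⁻¹ * ((κ : ℂ)⁻¹ * (R * T * matResolvent (G +
      vecMulVec v (star v)) z).trace - quadForm (T * Q) v)
      - (1 + q0)⁻¹ * (w0 - quadForm (T * Q) v)) ∂ρ := by
    have := integral_add hint i4
    rw [hzero, add_zero] at this
    rw [← this]
    congr 1
    ext v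
    ring
  rw [hsub]
  refine (norm_integral_le_of_norm_le (j1.add j5) (ae_of_all _ hpt)).trans ?_
  rw [integral_add' j1 j5, integral_const_mul, integral_const_mul, integral_const_mul,
    integral_add j2 j3, integral_div, integral_const_mul]
  have v1 : ∫ v, ‖quadForm Q v - q0‖ ^ 2 ∂ρ ≤ D / y ^ 2 := by
    refine (h.variance_le Q).trans ?_
    calc D * ‖Q‖ ^ 2 ≤ D * (y⁻¹) ^ 2 := by gcongr
      _ = D / y ^ 2 := by field_simp
  have v2 : ∫ v, ‖quadForm (T * Q) v - w0‖ ^ 2 ∂ρ ≤ D / y ^ 4 := by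
    refine (h.variance_le (T * Q)).trans ?_
    calc D * ‖T * Q‖ ^ 2 ≤ D * ((y ^ 2)⁻¹) ^ 2 := by gcongr
      _ = D / y ^ 4 := by field_simp
  have v3 := h.integral_normSq_le ht
  calc _ ≤ (‖z‖ / y) ^ 2 * (κ⁻¹ * (Λ / y ^ 3)) * t
        + (‖z‖ / y) ^ 2 * (1 / 2 * (D / y ^ 2 / y + y * (D / y ^ 4))) := by gcongr
    _ = _ := by
      field_simp
      ring

include h hz ht hTn in
/-- The mean of `tr Q` is close to `tr T`, where `T` is the resolvent-like matrix
`(β R - z)⁻¹` at the self-consistent coefficient `β`. -/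
theorem IsColumnLaw.norm_integral_trace_sub_le [Nonempty n] (ht0 : 0 ≤ t) (hκ : κ = Fintype.card k)
    (hκ0 : 0 < κ) (hD : 0 ≤ D) (hR : ‖R‖ ≤ Λ) {V : ℝ}
    (hV : ∫ x : k → n → ℂ, ‖(matResolvent (colGram x) z).trace
        - ∫ x' : k → n → ℂ, (matResolvent (colGram x') z).trace ∂(Measure.pi fun _ => ρ)‖ ^ 2
        ∂(Measure.pi fun _ => ρ) ≤ V ^ 2) (hV0 : 0 ≤ V)
    (hT : (((κ : ℂ)⁻¹ * (κ - Fintype.card n - z * ∫ x : k → n → ℂ, (matResolvent (colGram x) z).trace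
      ∂(Measure.pi fun _ => ρ))) • R - z • (1 : Matrix n n ℂ)) * T = 1) :
    ‖(∫ x : k → n → ℂ, (matResolvent (colGram x) z).trace ∂(Measure.pi fun _ => ρ)) - T.trace‖
      ≤ ‖z‖ * t / |z.im| ^ 2 * V + κ * (‖z‖ ^ 2 / |z.im| ^ 5 * (κ⁻¹ * Λ * t + D)) := by
  have := h.isProbabilityMeasure
  have hbm := isBddMeas_trace_matResolvent_gram (n := n) (k := k) hz
  set P : Measure (k → n → ℂ) := Measure.pi fun _ => ρ with hP
  set A : ℂ := ∫ x : k → n → ℂ, (matResolvent (colGram x) z).trace ∂P with hA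
  -- The first absolute moment is at most the square root of the second.
  have hfirst : ∫ x : k → n → ℂ, ‖(matResolvent (colGram x) z).trace - A‖ ∂P ≤ V := by
    refine abs_le_of_sq_le_sq' ?_ hV0 |>.2
    refine le_trans ?_ hV
    have hb2 : IsBddMeas fun x : k → n → ℂ =>
        ((‖(matResolvent (colGram x) z).trace - A‖ : ℝ) : ℂ) := by
      obtain ⟨M, hM⟩ := (hbm.sub (IsBddMeas.const A)).bdd
      refine ⟨Complex.continuous_ofReal.comp_stronglyMeasurable
        (hbm.sub (IsBddMeas.const A)).1.norm, M, fun x => ?_⟩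
      simpa using hM x
    have := norm_integral_sq_le P hb2
    rw [integral_complex_ofReal, Complex.norm_real, Real.norm_eq_abs, sq_abs] at this
    simpa using this
  -- With this choice of `β`, the scalar coefficient in the leave-one-out identity becomes `κ⁻¹ z
  -- (tr Q - E tr Q)`.
  have hid : ∀ x : k → n → ℂ, (matResolvent (colGram x) z).trace - T.trace
      = (κ : ℂ)⁻¹ * z * (((matResolvent (colGram x) z).trace - A) *
          (R * T * matResolvent (colGram x) z).trace)
        + ∑ j, columnDefect R T κ z j x := fun x => by
    rw [trace_sub_trace_eq hz hκ hκ0.ne' _ hT x]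
    ring
  have hsumI : Integrable (fun x => ∑ j, columnDefect R T κ z j x) P :=
    integrable_finsetSum _ fun j _ => h.integrable_columnDefect hz ht hTn j
  have hdiffI : Integrable (fun x : k → n → ℂ => (matResolvent (colGram x) z).trace - T.trace) P :=
    (hbm.sub (IsBddMeas.const _)).integrable
  -- Integrability is read off from the identity, since the other terms are integrable.
  have hcross : Integrable (fun x : k → n → ℂ => (κ : ℂ)⁻¹ * z *
      (((matResolvent (colGram x) z).trace - A) * (R * T * matResolvent (colGram x) z).trace)) P := by
    refine (hdiffI.sub hsumI).congr (ae_of_all _ fun x => ?_)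
    simp only [Pi.sub_apply]
    rw [hid x]; ring
  have hmain : A - T.trace = (∫ x : k → n → ℂ, (κ : ℂ)⁻¹ * z *
      (((matResolvent (colGram x) z).trace - A) * (R * T * matResolvent (colGram x) z).trace) ∂P)
      + ∑ j, ∫ x, columnDefect R T κ z j x ∂P := by
    rw [← integral_finsetSum _ fun j _ => h.integrable_columnDefect hz ht hTn j,
      ← integral_add hcross hsumI]
    simp_rw [← hid]
    rw [integral_sub hbm.integrable (integrable_const _), ← hA]
    simp
  rw [hmain]
  refine (norm_add_le _ _).trans (add_le_add ?_ ?_)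
  · have hpt : ∀ x : k → n → ℂ, ‖(κ : ℂ)⁻¹ * z *
      (((matResolvent (colGram x) z).trace - A) * (R * T * matResolvent (colGram x) z).trace)‖
        ≤ ‖z‖ * t / |z.im| ^ 2 * ‖(matResolvent (colGram x) z).trace - A‖ := fun x => by
      have h1 : ‖(κ : ℂ)⁻¹ * (R * T * matResolvent (colGram x) z).trace‖ ≤ t * (|z.im| ^ 2)⁻¹ := by
        rw [Matrix.mul_assoc]
        refine (ht _).trans ?_
        gcongr
        exact norm_mul_matResolvent_le hz hTn (posSemidef_colGram x).1
      calc _ = ‖z‖ * ‖(κ : ℂ)⁻¹ * (R * T * matResolvent (colGram x) z).trace‖ *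
            ‖(matResolvent (colGram x) z).trace - A‖ := by
            simp only [norm_mul]; ring
        _ ≤ ‖z‖ * (t * (|z.im| ^ 2)⁻¹) * ‖(matResolvent (colGram x) z).trace - A‖ := by gcongr
        _ = _ := by ring
    refine (norm_integral_le_of_norm_le ((hbm.sub (IsBddMeas.const A)).integrable.norm.const_mul _)
      (ae_of_all _ hpt)).trans ?_
    rw [integral_const_mul]
    gcongr
  · refine (norm_sum_le _ _).trans ((Finset.sum_le_sum fun j _ =>
      norm_integral_pi_le_of_update ρ j (h.integrable_columnDefect hz ht hTn j) fun x =>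
        h.norm_integral_columnDefect_le hz ht hTn hκ0 hD hR j x).trans_eq ?_)
    rw [Finset.sum_const, Finset.card_univ, nsmul_eq_mul, hκ]

end Bias

/-! ### Stability of the self-consistent equation -/

section Stability

variable {ι : Type*} [Fintype ι] [Nonempty ι] {lam : ι → ℝ} {Λ K c : ℝ} {z : ℂ}

omit [Nonempty ι] in
/-- For `b` in the half-plane of `z`, the imaginary part of the identity
`z = -1/b + K⁻¹ ∑ λ/(1+bλ) + η`. -/
theorem im_companion_eq {b η : ℂ} (hb : b ≠ 0)
    (h : z * b = -1 + b * ((K : ℂ)⁻¹ * ∑ k, (lam k : ℂ) * (1 + b * lam k)⁻¹) + b * η) :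
    z.im = b.im * ((‖b‖ ^ 2)⁻¹ - K⁻¹ * ∑ k, lam k ^ 2 * ‖(1 + b * lam k)⁻¹‖ ^ 2) + η.im := by
  have h1 : z = -b⁻¹ + (K : ℂ)⁻¹ * ∑ k, (lam k : ℂ) * (1 + b * lam k)⁻¹ + η := by
    refine mul_left_cancel₀ hb ?_
    have : b * b⁻¹ = 1 := mul_inv_cancel₀ hb
    linear_combination h + this
  have h2 : ∀ k, ((lam k : ℂ) * (1 + b * lam k)⁻¹).im
      = -(b.im * (lam k ^ 2 * ‖(1 + b * lam k)⁻¹‖ ^ 2)) := fun k => by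
    rw [Complex.im_ofReal_mul, Complex.inv_im, norm_inv, inv_pow, ← Complex.normSq_eq_norm_sq]
    simp
    ring
  rw [← Complex.ofReal_inv] at h1
  conv_lhs => rw [h1]
  rw [Complex.add_im, Complex.add_im, Complex.im_ofReal_mul, Complex.im_sum,
    Finset.sum_congr rfl fun k _ => h2 k, Complex.neg_im, Complex.inv_im, Finset.sum_neg_distrib,
    ← Finset.mul_sum, Complex.normSq_eq_norm_sq]
  ring

omit [Nonempty ι] in
-- Subtracting the two equations gives a linear relation for `α - m`, because `b - a` is a multiple
-- of `α - m`. Multiplying by `b` and inserting the exact equation for `b` replaces the coefficient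
-- by `1` minus a symmetric product of `a` and `b`, to which Cauchy–Schwarz type bounds apply.
theorem approx_fixedPoint_sub_mul {N : ℂ} {a b m α ε : ℂ} (hz : z ≠ 0) (hN : N ≠ 0) (hK : (K : ℂ) ≠ 0)
    (hc : (c : ℂ) = N / K)
    (hane : ∀ k, 1 + a * lam k ≠ 0) (hbne : ∀ k, 1 + b * lam k ≠ 0)
    (hb : z * b = -1 + b * ((K : ℂ)⁻¹ * ∑ k, (lam k : ℂ) * (1 + b * lam k)⁻¹))
    (hba : b - a = -(c * (α - m)))
    (hdiff : α - m = N⁻¹ * (-z⁻¹ * (∑ k, (1 + a * (lam k : ℂ))⁻¹ - ∑ k, (1 + b * (lam k : ℂ))⁻¹)) + ε) :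
    (α - m) * (1 - a * b * ((K : ℂ)⁻¹ * ∑ k, (lam k : ℂ) ^ 2 *
      ((1 + a * lam k)⁻¹ * (1 + b * lam k)⁻¹))) = -(z * b * ε) := by
  have e1 : ∑ k, (1 + a * (lam k : ℂ))⁻¹ - ∑ k, (1 + b * (lam k : ℂ))⁻¹
      = (b - a) * ∑ k, (lam k : ℂ) * ((1 + a * lam k)⁻¹ * (1 + b * lam k)⁻¹) := by
    rw [← Finset.sum_sub_distrib, Finset.mul_sum]
    refine Finset.sum_congr rfl fun k _ => ?_
    linear_combination (-(1 + a * (lam k : ℂ))⁻¹) * mul_inv_cancel₀ (hbne k)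
      + (1 + b * (lam k : ℂ))⁻¹ * mul_inv_cancel₀ (hane k)
  have e4 : ∑ k, (lam k : ℂ) * (1 + b * lam k)⁻¹
      - ∑ k, (lam k : ℂ) * ((1 + a * lam k)⁻¹ * (1 + b * lam k)⁻¹)
      = a * ∑ k, (lam k : ℂ) ^ 2 * ((1 + a * lam k)⁻¹ * (1 + b * lam k)⁻¹) := by
    rw [← Finset.sum_sub_distrib, Finset.mul_sum]
    refine Finset.sum_congr rfl fun k _ => ?_
    linear_combination (-(lam k * (1 + b * (lam k : ℂ))⁻¹)) * mul_inv_cancel₀ (hane k)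
  rw [e1, hba] at hdiff
  generalize ∑ k, (lam k : ℂ) ^ 2 * ((1 + a * lam k)⁻¹ * (1 + b * lam k)⁻¹) = t2 at *
  generalize ∑ k, (lam k : ℂ) * ((1 + a * lam k)⁻¹ * (1 + b * lam k)⁻¹) = t1 at *
  generalize ∑ k, (lam k : ℂ) * (1 + b * lam k)⁻¹ = w at *
  have e3 : z * (α - m) = (α - m) * ((K : ℂ)⁻¹ * t1) + z * ε := by
    have h1 : N⁻¹ * c = (K : ℂ)⁻¹ := by rw [hc]; field_simp
    have h2 : z * z⁻¹ = 1 := mul_inv_cancel₀ hz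
    linear_combination z * hdiff + (α - m) * t1 * N⁻¹ * c * h2 + (α - m) * t1 * h1
  linear_combination (α - m) * hb - b * e3 + (α - m) * b * (K : ℂ)⁻¹ * e4

set_option maxHeartbeats 800000 in
-- Pass to the companion variables `a` and `b`. Taking imaginary parts of their equations gives
-- `‖a‖² Sa ≤ 1` and `‖b‖² Sb ≤ 1 - ‖b‖ |Im z|`; AM–GM then keeps the linear coefficient at least
-- `‖b‖ |Im z| / 2` away from zero, and `‖b‖` cancels against the right-hand side. The bound on `a`
-- needs a small `ε`; for large `ε` the trivial bound `2 / |Im z|` on `‖α - m‖` suffices and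
-- produces the last two terms.
theorem norm_sub_le_of_approx_fixedPoint (hlam : ∀ k, 0 ≤ lam k ∧ lam k ≤ Λ) (hK : 0 < K)
    (hc : c = Fintype.card ι / K) (hc1 : c ≤ 1) (hz : z.im ≠ 0) {m α ε : ℂ}
    (hm : m = (Fintype.card ι : ℂ)⁻¹ * ∑ k, ((lam k : ℂ) * (1 - c - c * z * m) - z)⁻¹)
    (hα : α = (Fintype.card ι : ℂ)⁻¹ * ∑ k, ((lam k : ℂ) * (1 - c - c * z * α) - z)⁻¹ + ε)
    (him : 0 < m.im * z.im) (hia : 0 < α.im * z.im)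
    (hza : 0 ≤ (z * α).im * z.im)
    (hmn : ‖m‖ ≤ |z.im|⁻¹) (han : ‖α‖ ≤ |z.im|⁻¹) :
    ‖α - m‖ ≤ ‖ε‖ * (2 * ‖z‖ / |z.im| + 4 * ‖z‖ ^ 2 / |z.im| ^ 2 + 4 * Λ * ‖z‖ ^ 2 / |z.im| ^ 3) := by
  have hz0 : z ≠ 0 := fun h => hz (by simp [h])
  have hy : 0 < |z.im| := abs_pos.2 hz
  have hnz : 0 < ‖z‖ := norm_pos_iff.2 hz0
  have hyz : |z.im| ≤ ‖z‖ := Complex.abs_im_le_norm z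
  have hN : (0 : ℝ) < Fintype.card ι := by exact_mod_cast Fintype.card_pos
  have hNC : (Fintype.card ι : ℂ) ≠ 0 := by exact_mod_cast hN.ne'
  have hKC : (K : ℂ) ≠ 0 := by exact_mod_cast hK.ne'
  have hc0 : 0 < c := hc ▸ div_pos hN hK
  have hcC : (c : ℂ) = Fintype.card ι / K := by rw [hc]; push_cast; rfl
  have hΛ : 0 ≤ Λ := (hlam (Classical.arbitrary ι)).1.trans (hlam (Classical.arbitrary ι)).2
  -- the trivial bound
  by_cases hsmall : 2 * ‖z‖ ^ 2 * (1 + Λ / |z.im|) * ‖ε‖ ≤ |z.im|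
  swap
  · have h1 : ‖α - m‖ ≤ 2 / |z.im| := by
      refine (norm_sub_le _ _).trans ((add_le_add han hmn).trans_eq ?_)
      ring
    have h2 : 2 / |z.im| ≤ 2 / |z.im| * (2 * ‖z‖ ^ 2 * (1 + Λ / |z.im|) * ‖ε‖ / |z.im|) := by
      refine le_mul_of_one_le_right (by positivity) ?_
      rw [one_le_div hy]
      exact (not_le.1 hsmall).le
    have h3 : 2 / |z.im| * (2 * ‖z‖ ^ 2 * (1 + Λ / |z.im|) * ‖ε‖ / |z.im|)
        = ‖ε‖ * (4 * ‖z‖ ^ 2 / |z.im| ^ 2 + 4 * Λ * ‖z‖ ^ 2 / |z.im| ^ 3) := by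
      field_simp
      ring
    refine h1.trans (h2.trans (h3.le.trans ?_))
    gcongr
    have : 0 ≤ 2 * ‖z‖ / |z.im| := by positivity
    linarith
  set a : ℂ := c * α - (1 - c) / z with ha
  set b : ℂ := c * m - (1 - c) / z with hb
  have hzia : z * a = c * (z * α) - (1 - c) := by rw [ha]; field_simp
  have hzib : z * b = c * (z * m) - (1 - c) := by rw [hb]; field_simp
  -- Passing to the companion variable keeps the half-plane: `-(1 - c) / z` contributes an imaginary
  -- part of the right sign because `c ≤ 1`.
  have himgen : ∀ s : ℂ, 0 < s.im * z.im → 0 < (c * s - (1 - c) / z).im * z.im := fun s hs => by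
    have : (c * s - (1 - c) / z).im * z.im
        = c * (s.im * z.im) + (1 - c) * (z.im * z.im) / Complex.normSq z := by
      have e : (1 - (c : ℂ)) / z = ((1 - c : ℝ) : ℂ) * z⁻¹ := by push_cast; rw [div_eq_mul_inv]
      rw [e, Complex.sub_im, Complex.im_ofReal_mul, Complex.im_ofReal_mul, Complex.inv_im]
      ring
    rw [this]
    have h1 : 0 < c * (s.im * z.im) := mul_pos hc0 hs
    have h2 : 0 ≤ (1 - c) * (z.im * z.im) / Complex.normSq z :=
      div_nonneg (mul_nonneg (sub_nonneg.2 hc1) (mul_self_nonneg _)) (Complex.normSq_nonneg _)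
    linarith
  have hai : 0 < a.im * z.im := himgen α hia
  have hbi : 0 < b.im * z.im := himgen m him
  have ha0 : a ≠ 0 := fun h => by simp [h] at hai
  have hb0 : b ≠ 0 := fun h => by simp [h] at hbi
  have hnegen : ∀ s : ℂ, 0 < s.im * z.im → ∀ k, 1 + s * lam k ≠ 0 := fun s hs k h => by
    have him0 := congrArg Complex.im h
    have hre0 := congrArg Complex.re h
    simp at him0 hre0
    rcases him0 with h1 | h1
    · simp [h1] at hs
    · simp [h1] at hre0
  have hane := hnegen a hai
  have hbne := hnegen b hbi
  have hterm : ∀ s s' : ℂ, z * s' = c * (z * s) - (1 - c) → ∀ k, (lam k : ℂ) * (1 - c - c * z * s) - z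
      = -z * (1 + s' * lam k) := fun s s' h k => by linear_combination (lam k : ℂ) * h
  have hsuminv : ∀ s s' : ℂ, z * s' = c * (z * s) - (1 - c) → (∀ k, 1 + s' * lam k ≠ 0) →
      ∑ k, ((lam k : ℂ) * (1 - c - c * z * s) - z)⁻¹ = -z⁻¹ * ∑ k, (1 + s' * lam k)⁻¹ :=
    fun s s' h hne => by
      rw [Finset.mul_sum]
      refine Finset.sum_congr rfl fun k _ => ?_
      rw [hterm s s' h k, mul_inv, neg_inv]
  rw [hsuminv α a hzia hane] at hα
  rw [hsuminv m b hzib hbne] at hm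
  -- companion equations
  have hcomp : ∀ s s' δ : ℂ, z * s' = c * (z * s) - (1 - c) → (∀ k, 1 + s' * lam k ≠ 0) →
      s = (Fintype.card ι : ℂ)⁻¹ * (-z⁻¹ * ∑ k, (1 + s' * lam k)⁻¹) + δ →
      z * s' = -1 + s' * ((K : ℂ)⁻¹ * ∑ k, (lam k : ℂ) * (1 + s' * lam k)⁻¹) + c * z * δ := by
    intro s s' δ h1 h2 h3
    have h4 : z * s = -(Fintype.card ι : ℂ)⁻¹ * ∑ k, (1 + s' * lam k)⁻¹ + z * δ := by
      rw [h3]; field_simp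
    have h5 : s' * ∑ k, (lam k : ℂ) * (1 + s' * lam k)⁻¹
        = Fintype.card ι - ∑ k, (1 + s' * lam k)⁻¹ := by
      have : (Fintype.card ι : ℂ) = ∑ k : ι, 1 := by simp
      rw [this, ← Finset.sum_sub_distrib, Finset.mul_sum]
      refine Finset.sum_congr rfl fun k _ => ?_
      have := h2 k
      field_simp
      ring
    rw [h1, h4]
    have h6 : s' * ((K : ℂ)⁻¹ * ∑ k, (lam k : ℂ) * (1 + s' * lam k)⁻¹)
        = (K : ℂ)⁻¹ * (Fintype.card ι - ∑ k, (1 + s' * lam k)⁻¹) := by rw [← h5]; ring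
    rw [h6, hcC]
    field_simp
    ring
  have hca := hcomp α a ε hzia hane hα
  have hcb := hcomp m b 0 hzib hbne (by rw [add_zero]; exact hm)
  -- lower bound for `a`
  have hεc : ‖(c : ℂ) * z * ε‖ ≤ ‖z‖ * ‖ε‖ := by
    rw [norm_mul, norm_mul, Complex.norm_real, Real.norm_of_nonneg hc0.le, mul_assoc]
    exact mul_le_of_le_one_left (by positivity) hc1
  have hzam : 0 ≤ (z * a).im * z.im := by
    have : (z * a).im = c * (z * α).im := by
      rw [hzia, Complex.sub_im, Complex.im_ofReal_mul]; simp
    rw [this, mul_assoc]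
    exact mul_nonneg hc0.le hza
  have hu : ∀ k, ‖(1 + a * lam k)⁻¹‖ ≤ ‖z‖ / |z.im| := fun k => by
    refine norm_inv_one_add_le hz ?_
    have : (z * (a * lam k)).im = lam k * (z * a).im := by
      rw [← Complex.im_ofReal_mul]; congr 1; ring
    rw [this, mul_assoc]
    exact mul_nonneg (hlam k).1 hzam
  have hsumu : ‖(K : ℂ)⁻¹ * ∑ k, (lam k : ℂ) * (1 + a * lam k)⁻¹‖ ≤ Λ * (‖z‖ / |z.im|) := by
    rw [norm_mul, norm_inv, Complex.norm_real, Real.norm_of_nonneg hK.le]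
    calc K⁻¹ * ‖∑ k, (lam k : ℂ) * (1 + a * lam k)⁻¹‖
        ≤ K⁻¹ * ∑ k : ι, Λ * (‖z‖ / |z.im|) := by
          gcongr
          refine (norm_sum_le _ _).trans (Finset.sum_le_sum fun k _ => ?_)
          rw [norm_mul, Complex.norm_real, Real.norm_of_nonneg (hlam k).1]
          gcongr
          · exact (hlam k).2
          · exact hu k
      _ = c * (Λ * (‖z‖ / |z.im|)) := by
          rw [Finset.sum_const, Finset.card_univ, nsmul_eq_mul, hc]; ring
      _ ≤ Λ * (‖z‖ / |z.im|) := mul_le_of_le_one_left (by positivity) hc1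
  have hzε : ‖z‖ * ‖ε‖ ≤ 1 / 2 := by
    have h1 : 2 * ‖z‖ ^ 2 * ‖ε‖ ≤ 2 * ‖z‖ ^ 2 * (1 + Λ / |z.im|) * ‖ε‖ := by
      have : 0 ≤ Λ / |z.im| := by positivity
      have h2 : 0 ≤ ‖z‖ ^ 2 * ‖ε‖ := by positivity
      nlinarith
    have h2 : ‖z‖ * (2 * (‖z‖ * ‖ε‖)) ≤ ‖z‖ * 1 := by nlinarith
    have := le_of_mul_le_mul_left h2 hnz
    linarith
  -- The companion equation expresses `1` as two multiples of `a` plus an error of norm at most `1 /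
  -- 2`, so `a` cannot be small.
  have halow : 1 ≤ 2 * ‖z‖ * (1 + Λ / |z.im|) * ‖a‖ := by
    have h1 : (1 : ℂ) = -(z * a) + a * ((K : ℂ)⁻¹ * ∑ k, (lam k : ℂ) * (1 + a * lam k)⁻¹)
        + c * z * ε := by rw [hca]; ring
    have h2 : (1 : ℝ) ≤ ‖z‖ * ‖a‖ + ‖a‖ * (Λ * (‖z‖ / |z.im|)) + 1 / 2 := by
      calc (1 : ℝ) = ‖(1 : ℂ)‖ := norm_one.symm
        _ ≤ _ := by
          rw [h1]
          refine (norm_add_le _ _).trans (add_le_add ((norm_add_le _ _).trans (add_le_add ?_ ?_)) ?_)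
          · rw [norm_neg, norm_mul]
          · rw [norm_mul]; gcongr
          · exact hεc.trans hzε
    have h3 : 2 * ‖z‖ * (1 + Λ / |z.im|) * ‖a‖
        = 2 * (‖z‖ * ‖a‖ + ‖a‖ * (Λ * (‖z‖ / |z.im|))) := by ring
    linarith
  -- The smallness threshold on `ε` is chosen for exactly this: the perturbation cannot exceed `Im
  -- z` in the imaginary part.
  have hηa : |((c * z * ε) / a).im| ≤ |z.im| := by
    refine (Complex.abs_im_le_norm _).trans ?_
    have hapos : 0 < ‖a‖ := norm_pos_iff.2 ha0
    rw [norm_div, div_le_iff₀ hapos]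
    refine hεc.trans ?_
    have h1 : (2 * ‖z‖ ^ 2 * (1 + Λ / |z.im|) * ‖ε‖) * ‖a‖ ≤ |z.im| * ‖a‖ := by gcongr
    have h2 : ‖z‖ * ‖ε‖ * 1 ≤ ‖z‖ * ‖ε‖ * (2 * ‖z‖ * (1 + Λ / |z.im|) * ‖a‖) := by gcongr
    linarith
  -- the contraction estimate
  have hIa := im_companion_eq (η := (c * z * ε) / a) ha0
    (by rw [mul_div_cancel₀ _ ha0]; exact hca)
  have hIb := im_companion_eq (η := 0) hb0 (by rw [hcb, mul_zero, mul_zero])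
  set Sa := K⁻¹ * ∑ k, lam k ^ 2 * ‖(1 + a * lam k)⁻¹‖ ^ 2 with hSa
  set Sb := K⁻¹ * ∑ k, lam k ^ 2 * ‖(1 + b * lam k)⁻¹‖ ^ 2 with hSb
  -- The perturbation may use up all of `Im z`, so no slack is left here; the strict gain comes from
  -- `b`, whose equation is exact.
  have hva : ‖a‖ ^ 2 * Sa ≤ 1 := by
    have hapos : 0 < ‖a‖ ^ 2 := by positivity
    have h1 : 0 ≤ (a.im * z.im) * ((‖a‖ ^ 2)⁻¹ - Sa) := by
      have : (a.im * z.im) * ((‖a‖ ^ 2)⁻¹ - Sa) = z.im * z.im - ((c * z * ε) / a).im * z.im := by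
        linear_combination (-z.im) * hIa
      rw [this]
      have h2 : ((c * z * ε) / a).im * z.im ≤ |z.im| * |z.im| := by
        refine (le_abs_self _).trans ?_
        rw [abs_mul]; gcongr
      rw [abs_mul_abs_self] at h2
      linarith
    have h2 := nonneg_of_mul_nonneg_right h1 hai
    have h3 : ‖a‖ ^ 2 * Sa ≤ ‖a‖ ^ 2 * (‖a‖ ^ 2)⁻¹ := by gcongr; linarith
    rwa [mul_inv_cancel₀ hapos.ne'] at h3
  have hvb : ‖b‖ ^ 2 * Sb ≤ 1 - ‖b‖ * |z.im| := by
    have hbpos : 0 < ‖b‖ := norm_pos_iff.2 hb0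
    rw [Complex.zero_im, add_zero] at hIb
    have h1 : |z.im| = |b.im| * ((‖b‖ ^ 2)⁻¹ - Sb) := by
      have h2 : 0 ≤ (‖b‖ ^ 2)⁻¹ - Sb := by
        refine nonneg_of_mul_nonneg_right (a := b.im * z.im) ?_ hbi
        have : b.im * z.im * ((‖b‖ ^ 2)⁻¹ - Sb) = z.im * z.im := by
          linear_combination (-z.im) * hIb
        rw [this]; exact mul_self_nonneg _
      rw [hIb, abs_mul, abs_of_nonneg h2]
    have h2 : 0 ≤ (‖b‖ ^ 2)⁻¹ - Sb := by
      by_contra hcon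
      have := mul_nonpos_of_nonneg_of_nonpos (abs_nonneg b.im) (not_le.1 hcon).le
      linarith
    have h3 : |z.im| ≤ ‖b‖ * ((‖b‖ ^ 2)⁻¹ - Sb) := by
      rw [h1]; gcongr; exact Complex.abs_im_le_norm b
    have h4 : ‖b‖ * |z.im| ≤ ‖b‖ * (‖b‖ * ((‖b‖ ^ 2)⁻¹ - Sb)) := by gcongr
    have h5 : ‖b‖ * (‖b‖ * ((‖b‖ ^ 2)⁻¹ - Sb)) = 1 - ‖b‖ ^ 2 * Sb := by field_simp
    linarith
  set t2 : ℂ := (K : ℂ)⁻¹ * ∑ k, (lam k : ℂ) ^ 2 * ((1 + a * lam k)⁻¹ * (1 + b * lam k)⁻¹) with ht2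
  have ht2n : ‖a * b * t2‖ ≤ 1 - ‖b‖ * |z.im| / 2 := by
    have h1 : a * b * t2 = (K : ℂ)⁻¹ * ∑ k, (a * (lam k * (1 + a * lam k)⁻¹)) *
        (b * (lam k * (1 + b * lam k)⁻¹)) := by
      rw [ht2, mul_left_comm, Finset.mul_sum]
      congr 1
      exact Finset.sum_congr rfl fun k _ => by ring
    have h2 : ‖a * b * t2‖ ≤ (‖a‖ ^ 2 * Sa + ‖b‖ ^ 2 * Sb) / 2 := by
      rw [h1, norm_mul, norm_inv, Complex.norm_real, Real.norm_of_nonneg hK.le]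
      have h3 : (‖a‖ ^ 2 * Sa + ‖b‖ ^ 2 * Sb) / 2 = K⁻¹ * ∑ k,
          ((‖a‖ ^ 2 * (lam k ^ 2 * ‖(1 + a * lam k)⁻¹‖ ^ 2)
            + ‖b‖ ^ 2 * (lam k ^ 2 * ‖(1 + b * lam k)⁻¹‖ ^ 2)) / 2) := by
        rw [← Finset.sum_div, Finset.sum_add_distrib, ← Finset.mul_sum, ← Finset.mul_sum, hSa, hSb]
        ring
      rw [h3]
      gcongr
      refine (norm_sum_le _ _).trans (Finset.sum_le_sum fun k _ => ?_)
      simp only [norm_mul, Complex.norm_real, Real.norm_of_nonneg (hlam k).1]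
      generalize ‖(1 + a * (lam k : ℂ))⁻¹‖ = p
      generalize ‖(1 + b * (lam k : ℂ))⁻¹‖ = q
      nlinarith [sq_nonneg (‖a‖ * (lam k * p) - ‖b‖ * (lam k * q))]
    linarith
  have hlow : ‖b‖ * |z.im| / 2 ≤ ‖1 - a * b * t2‖ := by
    have := norm_sub_norm_le (1 : ℂ) (a * b * t2)
    rw [norm_one] at this
    linarith
  have hkey : (α - m) * (1 - a * b * t2) = -(z * b * ε) := by
    refine approx_fixedPoint_sub_mul hz0 hNC hKC hcC hane hbne (by rw [hcb]; ring)
      (by rw [ha, hb]; ring) ?_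
    linear_combination hα - hm
  have hfin : ‖α - m‖ * (‖b‖ * |z.im| / 2) ≤ ‖z‖ * ‖b‖ * ‖ε‖ := by
    calc _ ≤ ‖α - m‖ * ‖1 - a * b * t2‖ := by gcongr
      _ = ‖z‖ * ‖b‖ * ‖ε‖ := by rw [← norm_mul, hkey, norm_neg, norm_mul, norm_mul]
  have hbpos : 0 < ‖b‖ := norm_pos_iff.2 hb0
  have h1 : ‖α - m‖ ≤ ‖ε‖ * (2 * ‖z‖ / |z.im|) := by
    rw [mul_div_assoc', le_div_iff₀ hy]
    have : ‖b‖ * (‖α - m‖ * |z.im|) ≤ ‖b‖ * (‖ε‖ * (2 * ‖z‖)) := by linarith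
    exact le_of_mul_le_mul_left this hbpos
  refine h1.trans ?_
  gcongr
  have : 0 ≤ 4 * ‖z‖ ^ 2 / |z.im| ^ 2 := by positivity
  have : 0 ≤ 4 * Λ * ‖z‖ ^ 2 / |z.im| ^ 3 := by positivity
  linarith

end Stability

/-! ### Specialisation to Gaussian columns -/

section GaussianModel
open Matrix
open scoped Matrix.Norms.L2Operator ComplexOrder

variable {n k : Type*} [Fintype n] [DecidableEq n] [Fintype k] [DecidableEq k]

/-- A bound for the standard deviation of `tr Q`. -/
noncomputable def sdBound (Λ : ℝ) (z : ℂ) : ℝ :=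
  Real.sqrt (2 * quadVarConst) * Λ * ‖z‖ * (1 / |z.im| ^ 3 + Λ * ‖z‖ / |z.im| ^ 5)

/-- A bound for the error in the self-consistent equation for `E tr Q`. -/
noncomputable def biasBound (Λ : ℝ) (z : ℂ) : ℝ :=
  ‖z‖ * Λ / |z.im| ^ 2 * sdBound Λ z + ‖z‖ ^ 2 / |z.im| ^ 5 * (Λ ^ 2 + quadVarConst * Λ ^ 2)

/-- The law of the columns of the observation. -/
noncomputable abbrev columnsLaw (k : Type*) [Fintype k] (S : Matrix n n ℂ) : Measure (k → n → ℂ) :=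
  Measure.pi fun _ => columnLaw S (Fintype.card k)

variable {S : Matrix n n ℂ} {Λ : ℝ} (hS : ‖S * Sᴴ‖ ≤ Λ) (hcard : Fintype.card n ≤ Fintype.card k)
  {z : ℂ} (hz : z.im ≠ 0)

omit [DecidableEq k] in
theorem norm_normalized_trace_le {R : Matrix n n ℂ} (hR : ‖R‖ ≤ Λ) [Nonempty n] [Nonempty k]
    (hcard : Fintype.card n ≤ Fintype.card k) (A : Matrix n n ℂ) :
    ‖((Fintype.card k : ℝ) : ℂ)⁻¹ * (R * A).trace‖ ≤ Λ * ‖A‖ := by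
  have hk : (0 : ℝ) < Fintype.card k := by exact_mod_cast Fintype.card_pos
  have hΛ : 0 ≤ Λ := (norm_nonneg _).trans hR
  rw [norm_mul, norm_inv, Complex.norm_real, Real.norm_of_nonneg hk.le, inv_mul_le_iff₀ hk]
  calc ‖(R * A).trace‖ ≤ Fintype.card n * (‖R‖ * ‖A‖) :=
        (norm_trace_le _).trans (by gcongr; exact norm_mul_le _ _)
    _ ≤ Fintype.card k * (Λ * ‖A‖) := by gcongr

omit [DecidableEq k] in
include hS hcard in
-- By `‖S‖⁴ = ‖S Sᴴ‖²` and `card n ≤ card k`, the variance constant is of order `1 / card k`.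
theorem isColumnLaw_columnLaw_card [Nonempty k] :
    IsColumnLaw (columnLaw S (Fintype.card k)) (S * Sᴴ) (Fintype.card k)
      (quadVarConst * Λ ^ 2 / Fintype.card k) := by
  have hk : (0 : ℝ) < Fintype.card k := by exact_mod_cast Fintype.card_pos
  have h := isColumnLaw_columnLaw S hk
  refine ⟨h.1, h.2, h.3, fun A => (h.variance_le A).trans ?_⟩
  have h1 : ‖S‖ ^ 4 ≤ Λ ^ 2 := by
    have e : ‖S * Sᴴ‖ = ‖S‖ ^ 2 := by rw [sq]; exact CStarRing.norm_self_mul_star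
    have : ‖S‖ ^ 4 = ‖S * Sᴴ‖ ^ 2 := by rw [e]; ring
    rw [this]
    gcongr
  have hq := quadVarConst_pos.le
  refine mul_le_mul_of_nonneg_right ?_ (by positivity)
  rw [div_le_div_iff₀ (by positivity) hk]
  calc quadVarConst * Fintype.card n * ‖S‖ ^ 4 * Fintype.card k
      ≤ quadVarConst * Fintype.card k * Λ ^ 2 * Fintype.card k := by gcongr
    _ = _ := by ring

include hS hcard hz in
theorem variance_trace_columnsLaw_le [Nonempty n] [Nonempty k] :
    ∫ x : k → n → ℂ, ‖(matResolvent (colGram x) z).trace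
        - ∫ x' : k → n → ℂ, (matResolvent (colGram x') z).trace ∂(columnsLaw k S)‖ ^ 2
        ∂(columnsLaw k S) ≤ sdBound Λ z ^ 2 := by
  have hk : (0 : ℝ) < Fintype.card k := by exact_mod_cast Fintype.card_pos
  have hΛ : 0 ≤ Λ := (norm_nonneg _).trans hS
  have hq := quadVarConst_pos.le
  have hy : 0 < |z.im| := abs_pos.2 hz
  refine ((isColumnLaw_columnLaw_card hS hcard).variance_trace_le hz
    (norm_normalized_trace_le hS hcard) hΛ (by positivity)).trans ?_
  have e : (Fintype.card k : ℝ) * (2 * (‖z‖ / |z.im|) ^ 2 *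
      (quadVarConst * Λ ^ 2 / Fintype.card k / |z.im| ^ 4
        + (Λ * ‖z‖ / |z.im| ^ 3) ^ 2 * (quadVarConst * Λ ^ 2 / Fintype.card k / |z.im| ^ 2)))
      = 2 * quadVarConst * Λ ^ 2 * ‖z‖ ^ 2 *
        ((1 / |z.im| ^ 3) ^ 2 + (Λ * ‖z‖ / |z.im| ^ 5) ^ 2) := by
    generalize |z.im| = y at *
    field_simp
  rw [e, sdBound, mul_pow, mul_pow, mul_pow, Real.sq_sqrt (by positivity)]
  gcongr
  have h1 : 0 ≤ 1 / |z.im| ^ 3 := by positivity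
  have h2 : 0 ≤ Λ * ‖z‖ / |z.im| ^ 5 := by positivity
  nlinarith [mul_nonneg h1 h2]

theorem im_mul_trace_matResolvent_nonneg {G : Matrix n n ℂ} (hG : G.PosSemidef) (hz : z.im ≠ 0) :
    0 ≤ (z * (matResolvent G z).trace).im * z.im := by
  rw [trace_eq_sum_quadForm, Finset.mul_sum, Complex.im_sum, Finset.sum_mul]
  exact Finset.sum_nonneg fun i _ => hG.im_mul_quadForm_matResolvent_nonneg hz _

theorem im_trace_matResolvent_mul_pos [Nonempty n] {G : Matrix n n ℂ} (hG : G.IsHermitian)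
    (hz : z.im ≠ 0) : 0 < (matResolvent G z).trace.im * z.im := by
  rw [trace_matResolvent hG hz, Complex.im_sum, Finset.sum_mul]
  refine Finset.sum_pos (fun i _ => ?_) Finset.univ_nonempty
  have hne : (hG.eigenvalues i : ℂ) - z ≠ 0 := fun h => hz (by simpa using congrArg Complex.im h)
  rw [Complex.inv_im]
  have : -((hG.eigenvalues i : ℂ) - z).im / Complex.normSq ((hG.eigenvalues i : ℂ) - z) * z.im
      = z.im ^ 2 / Complex.normSq ((hG.eigenvalues i : ℂ) - z) := by
    simp; ring
  rw [this]
  exact div_pos (by positivity) (Complex.normSq_pos.2 hne)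

/-- The mean of `tr Q`. -/
noncomputable def meanTrace (k : Type*) [Fintype k] (S : Matrix n n ℂ) (z : ℂ) : ℂ :=
  ∫ x : k → n → ℂ, (matResolvent (colGram x) z).trace ∂(columnsLaw k S)

instance [Nonempty k] : IsProbabilityMeasure (columnLaw S (Fintype.card k)) :=
  (isColumnLaw_columnLaw S (by exact_mod_cast Fintype.card_pos)).1

omit [DecidableEq k] in
include hz in
theorem im_mul_meanTrace_nonneg [Nonempty k] : 0 ≤ (z * meanTrace k S z).im * z.im := by
  have hbm := isBddMeas_trace_matResolvent_gram (n := n) (k := k) hz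
  have h2 := integral_im ((hbm.integrable (P := columnsLaw k S)).const_mul z)
  simp only [RCLike.im_to_complex] at h2
  rw [meanTrace, ← integral_const_mul, ← h2, ← integral_mul_const]
  exact integral_nonneg fun x => im_mul_trace_matResolvent_nonneg (posSemidef_colGram x) hz

omit [DecidableEq k] in
include hz in
theorem im_meanTrace_mul_pos [Nonempty n] [Nonempty k] : 0 < (meanTrace k S z).im * z.im := by
  have hbm := isBddMeas_trace_matResolvent_gram (n := n) (k := k) hz
  have hi := hbm.integrable (P := columnsLaw k S)
  have h2 := integral_im hi
  simp only [RCLike.im_to_complex] at h2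
  rw [meanTrace, ← h2, ← integral_mul_const]
  have hI : Integrable (fun x : k → n → ℂ => (matResolvent (colGram x) z).trace.im * z.im)
    (columnsLaw k S) := (hi.im).mul_const _
  have hpos : ∀ x : k → n → ℂ, 0 < (matResolvent (colGram x) z).trace.im * z.im := fun x =>
    im_trace_matResolvent_mul_pos (posSemidef_colGram x).1 hz
  rw [integral_pos_iff_support_of_nonneg (fun x => (hpos x).le) hI]
  have : Function.support (fun x : k → n → ℂ => (matResolvent (colGram x) z).trace.im * z.im)
      = Set.univ := Set.eq_univ_of_forall fun x => (hpos x).ne'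
  rw [this]
  simp

omit [DecidableEq k] in
include hz in
theorem norm_meanTrace_le [Nonempty k] : ‖meanTrace k S z‖ ≤ Fintype.card n * |z.im|⁻¹ := by
  refine (norm_integral_le_of_norm_le_const
    (ae_of_all _ (norm_trace_matResolvent_gram_le hz))).trans_eq ?_
  simp

include hS hcard hz in
/-- The self-consistent equation for `E tr Q`, up to a bounded error. -/
theorem norm_meanTrace_sub_le [Nonempty n] [Nonempty k] (hR : (S * Sᴴ).IsHermitian) :
    ‖meanTrace k S z - ∑ i, ((hR.eigenvalues i : ℂ) *
      (1 - ((Fintype.card n / Fintype.card k : ℝ) : ℂ) - ((Fintype.card k : ℝ) : ℂ)⁻¹ * z *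
        meanTrace k S z) - z)⁻¹‖ ≤ biasBound Λ z := by
  have hk : (0 : ℝ) < Fintype.card k := by exact_mod_cast Fintype.card_pos
  have hkC : ((Fintype.card k : ℝ) : ℂ) ≠ 0 := by exact_mod_cast hk.ne'
  have hΛ : 0 ≤ Λ := (norm_nonneg _).trans hS
  have hq := quadVarConst_pos.le
  have hy : 0 < |z.im| := abs_pos.2 hz
  set β : ℂ := ((Fintype.card k : ℝ) : ℂ)⁻¹ * ((Fintype.card k : ℝ) - Fintype.card n
    - z * meanTrace k S z) with hβ
  have hβ' : 1 - ((Fintype.card n / Fintype.card k : ℝ) : ℂ) - ((Fintype.card k : ℝ) : ℂ)⁻¹ * z *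
      meanTrace k S z = β := by
    rw [hβ]; push_cast; push_cast at hkC; field_simp
  -- The imaginary part of `β` is opposite in sign to `Im z` or zero, so `|Im (β λ - z)| ≥ |Im z|`
  -- for every `λ ≥ 0`; this gives the existence and the norm bound of the comparison matrix.
  have hβim : β.im * z.im ≤ 0 := by
    have h1 := im_mul_meanTrace_nonneg (k := k) (S := S) hz
    have : β.im = -((Fintype.card k : ℝ)⁻¹ * (z * meanTrace k S z).im) := by
      rw [hβ, ← Complex.ofReal_inv, Complex.im_ofReal_mul]; simp; ring
    rw [this, neg_mul, mul_assoc]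
    exact neg_nonpos.2 (mul_nonneg (by positivity) h1)
  have hpsd : (S * Sᴴ).PosSemidef := posSemidef_self_mul_conjTranspose S
  have hge : ∀ i, |z.im| ≤ ‖β * hR.eigenvalues i + -z‖ := fun i => by
    refine le_trans ?_ (Complex.abs_im_le_norm _)
    have h0 : 0 ≤ hR.eigenvalues i := hpsd.eigenvalues_nonneg i
    have : (β * hR.eigenvalues i + -z).im = hR.eigenvalues i * β.im - z.im := by simp; ring
    rw [this]
    refine sq_le_sq.1 ?_
    nlinarith [mul_nonneg h0 (neg_nonneg.2 hβim), sq_nonneg (hR.eigenvalues i * β.im)]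
  have hne : ∀ i, β * hR.eigenvalues i + -z ≠ 0 := fun i h => by
    have := hge i; rw [h, norm_zero] at this; linarith
  have hT := hR.affine_mul_inv β (-z) hne
  have hT' : (β • (S * Sᴴ) - z • (1 : Matrix n n ℂ)) *
      (β • (S * Sᴴ) + (-z) • (1 : Matrix n n ℂ))⁻¹ = 1 := by
    rw [sub_eq_add_neg, ← neg_smul]
    exact hT
  have hTn := hR.norm_affine_inv_le β (-z) hy hge
  have htr := hR.trace_affine_inv β (-z) hne
  have hsd : 0 ≤ sdBound Λ z := by unfold sdBound; positivity
  have hmain := (isColumnLaw_columnLaw_card hS hcard).norm_integral_trace_sub_le hz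
    (norm_normalized_trace_le hS hcard) hTn hΛ rfl hk (by positivity) hS
    (variance_trace_columnsLaw_le hS hcard hz) hsd hT'
  rw [htr] at hmain
  rw [hβ']
  have e : ∑ i, ((hR.eigenvalues i : ℂ) * β - z)⁻¹ = ∑ i, (β * (hR.eigenvalues i : ℂ) + -z)⁻¹ :=
    Finset.sum_congr rfl fun i _ => by rw [mul_comm, sub_eq_add_neg]
  rw [e]
  refine hmain.trans_eq ?_
  rw [biasBound]
  congr 1
  field_simp

end GaussianModel

/-! ### Elementary properties of Stieltjes transforms -/

section StieltjesTransform

variable {z : ℂ}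

theorem ofReal_sub_ne_zero (hz : z.im ≠ 0) (x : ℝ) : (x : ℂ) - z ≠ 0 :=
  fun h => hz (by simpa using congrArg Complex.im h)

theorem norm_inv_ofReal_sub_le (hz : z.im ≠ 0) (x : ℝ) : ‖((x : ℂ) - z)⁻¹‖ ≤ |z.im|⁻¹ := by
  rw [norm_inv]
  have := Complex.abs_im_le_norm ((x : ℂ) - z)
  have h2 : |((x : ℂ) - z).im| = |z.im| := by simp
  rw [h2] at this
  exact inv_anti₀ (abs_pos.2 hz) this

theorem resolventTransform_eq_integral (F : Measure ℝ) (z : ℂ) :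
    resolventTransform F z = ∫ x : ℝ, ((x : ℂ) - z)⁻¹ ∂F := by
  rw [resolventTransform_apply]
  refine integral_congr_ae (ae_of_all _ fun x => ?_)
  simp only [resolvent]
  rw [Ring.inverse_eq_inv']
  rfl

theorem continuous_inv_ofReal_sub (hz : z.im ≠ 0) : Continuous fun x : ℝ => ((x : ℂ) - z)⁻¹ :=
  (Complex.continuous_ofReal.sub continuous_const).inv₀ (ofReal_sub_ne_zero hz)

variable {F : Measure ℝ} [IsProbabilityMeasure F]

theorem integrable_inv_ofReal_sub (hz : z.im ≠ 0) :
    Integrable (fun x : ℝ => ((x : ℂ) - z)⁻¹) F :=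
  Integrable.of_bound (continuous_inv_ofReal_sub hz).aestronglyMeasurable |z.im|⁻¹
    (ae_of_all _ (norm_inv_ofReal_sub_le hz))

theorem norm_resolventTransform_le (hz : z.im ≠ 0) : ‖resolventTransform F z‖ ≤ |z.im|⁻¹ := by
  rw [resolventTransform_eq_integral]
  refine (norm_integral_le_of_norm_le_const (ae_of_all _ (norm_inv_ofReal_sub_le hz))).trans_eq ?_
  simp

theorem im_inv_ofReal_sub_mul (z : ℂ) (x : ℝ) :
    (((x : ℂ) - z)⁻¹).im * z.im = z.im ^ 2 / Complex.normSq ((x : ℂ) - z) := by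
  rw [Complex.inv_im]
  simp
  ring

/-- Uses `z / (x - z) = x / (x - z) - 1`; the sign is that of `x`, which is where support in `[0,
∞)` enters. -/
theorem im_mul_inv_ofReal_sub_mul (hz : z.im ≠ 0) (x : ℝ) :
    (z * ((x : ℂ) - z)⁻¹).im * z.im = x * (z.im ^ 2 / Complex.normSq ((x : ℂ) - z)) := by
  have h : z * ((x : ℂ) - z)⁻¹ = x * ((x : ℂ) - z)⁻¹ - 1 := by
    have := ofReal_sub_ne_zero hz x
    field_simp
    ring
  rw [h, Complex.sub_im, Complex.im_ofReal_mul, Complex.one_im, sub_zero, mul_assoc,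
    im_inv_ofReal_sub_mul]

theorem im_resolventTransform_mul_pos (hz : z.im ≠ 0) : 0 < (resolventTransform F z).im * z.im := by
  have hi := integrable_inv_ofReal_sub (F := F) hz
  have h2 := integral_im hi
  simp only [RCLike.im_to_complex] at h2
  have hpos : ∀ x : ℝ, 0 < (((x : ℂ) - z)⁻¹).im * z.im := fun x => by
    rw [im_inv_ofReal_sub_mul]
    exact div_pos (by positivity) (Complex.normSq_pos.2 (ofReal_sub_ne_zero hz x))
  have hI : Integrable (fun x : ℝ => (((x : ℂ) - z)⁻¹).im * z.im) F := hi.im.mul_const _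
  rw [resolventTransform_eq_integral, ← h2, ← integral_mul_const,
    integral_pos_iff_support_of_nonneg (fun x => (hpos x).le) hI]
  have : Function.support (fun x : ℝ => (((x : ℂ) - z)⁻¹).im * z.im) = Set.univ :=
    Set.eq_univ_of_forall fun x => (hpos x).ne'
  rw [this]
  simp

theorem im_mul_resolventTransform_nonneg (hF : F (Set.Iio 0) = 0) (hz : z.im ≠ 0) :
    0 ≤ (z * resolventTransform F z).im * z.im := by
  have h2 := integral_im ((integrable_inv_ofReal_sub (F := F) hz).const_mul z)
  simp only [RCLike.im_to_complex] at h2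
  rw [resolventTransform_eq_integral, ← integral_const_mul, ← h2, ← integral_mul_const]
  refine integral_nonneg_of_ae ?_
  have : ∀ᵐ x ∂F, x ∉ Set.Iio 0 := measure_eq_zero_iff_ae_notMem.1 hF
  filter_upwards [this] with x hx
  rw [im_mul_inv_ofReal_sub_mul hz]
  exact mul_nonneg (not_lt.1 hx) (div_nonneg (sq_nonneg _) (Complex.normSq_nonneg _))

theorem differentiableAt_resolventTransform (hz : z.im ≠ 0) :
    DifferentiableAt ℂ (resolventTransform F : ℂ → ℂ) z := by
  refine (hasDerivAt_resolventTransform z ?_).differentiableAt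
  rintro ⟨x, -, rfl⟩
  exact hz (by simp)

end StieltjesTransform

/-! ### The fixed-point map and compactness -/

section SelfMap

variable {ι : Type*} [Fintype ι]

/-- The right-hand side of the self-consistent equation. -/
noncomputable def selfMap (lam : ι → ℝ) (c : ℝ) (z s : ℂ) : ℂ :=
  (Fintype.card ι : ℂ)⁻¹ * ∑ k, ((lam k : ℂ) * (1 - c - c * z * s) - z)⁻¹

variable {lam : ι → ℝ} {c Λ : ℝ} {z : ℂ}

theorem abs_im_le_norm_selfMap_denom (hc : 0 ≤ c) {l : ℝ} (hl : 0 ≤ l) {s : ℂ}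
    (hs : 0 ≤ (z * s).im * z.im) : |z.im| ≤ ‖(l : ℂ) * (1 - c - c * z * s) - z‖ := by
  refine le_trans ?_ (Complex.abs_im_le_norm _)
  have : ((l : ℂ) * (1 - c - c * z * s) - z).im = -(l * c * (z * s).im) - z.im := by
    rw [Complex.sub_im, Complex.im_ofReal_mul, mul_assoc (c : ℂ), Complex.sub_im,
      Complex.im_ofReal_mul]
    simp
    ring
  rw [this]
  refine sq_le_sq.1 ?_
  nlinarith [mul_nonneg (mul_nonneg hl hc) hs, sq_nonneg (l * c * (z * s).im)]

/-- On the set where `Im (z s)` and `Im z` do not have opposite signs, all denominators are at least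
`|Im z|`, so the map is Lipschitz there. The constant exceeds `1` in general; the bound serves
continuity, not contraction. -/
theorem norm_selfMap_sub_le (hlam : ∀ k, 0 ≤ lam k ∧ lam k ≤ Λ) (hΛ : 0 ≤ Λ) (hc : 0 ≤ c)
    (hc1 : c ≤ 1) (hz : z.im ≠ 0) {s t : ℂ} (hs : 0 ≤ (z * s).im * z.im)
    (ht : 0 ≤ (z * t).im * z.im) :
    ‖selfMap lam c z s - selfMap lam c z t‖ ≤ Λ * ‖z‖ / |z.im| ^ 2 * ‖s - t‖ := by
  have hy : 0 < |z.im| := abs_pos.2 hz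
  have key : ∀ k, ‖((lam k : ℂ) * (1 - c - c * z * s) - z)⁻¹
      - ((lam k : ℂ) * (1 - c - c * z * t) - z)⁻¹‖ ≤ Λ * ‖z‖ / |z.im| ^ 2 * ‖s - t‖ := fun k => by
    have h1 := abs_im_le_norm_selfMap_denom hc (hlam k).1 hs
    have h2 := abs_im_le_norm_selfMap_denom hc (hlam k).1 ht
    have n1 : (lam k : ℂ) * (1 - c - c * z * s) - z ≠ 0 := norm_pos_iff.1 (hy.trans_le h1)
    have n2 : (lam k : ℂ) * (1 - c - c * z * t) - z ≠ 0 := norm_pos_iff.1 (hy.trans_le h2)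
    rw [inv_sub_inv n1 n2, norm_div, norm_mul]
    have e : (lam k : ℂ) * (1 - c - c * z * t) - z - ((lam k : ℂ) * (1 - c - c * z * s) - z)
        = lam k * c * z * (s - t) := by ring
    rw [e, norm_mul, norm_mul, norm_mul, Complex.norm_real, Complex.norm_real,
      Real.norm_of_nonneg (hlam k).1, Real.norm_of_nonneg hc, div_mul_eq_mul_div]
    have : lam k * c ≤ Λ := by nlinarith [(hlam k).1, (hlam k).2]
    rw [sq]
    gcongr
  rw [selfMap, selfMap, ← mul_sub, ← Finset.sum_sub_distrib, norm_mul, norm_inv]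
  have hB : 0 ≤ Λ * ‖z‖ / |z.im| ^ 2 * ‖s - t‖ := by positivity
  rcases isEmpty_or_nonempty ι with hι | hι
  · simpa using hB
  have hcard : (0 : ℝ) < Fintype.card ι := by exact_mod_cast Fintype.card_pos
  rw [Complex.norm_natCast, inv_mul_le_iff₀ hcard]
  refine (norm_sum_le _ _).trans ((Finset.sum_le_card_nsmul _ _ _ fun k _ => key k).trans_eq ?_)
  simp

/-- Subsequential limits: a tight family of approximate solutions yields an exact one. -/
theorem exists_measure_of_approx (hlam : ∀ k, 0 ≤ lam k ∧ lam k ≤ Λ) (hΛ : 0 ≤ Λ) (hc : 0 ≤ c)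
    (hc1 : c ≤ 1) {u : ℕ → ℝ≥0} (hu : Tendsto u atTop (𝓝 0))
    (happ : ∀ (T : Finset {z : ℂ // z.im ≠ 0}) (δ : ℝ), 0 < δ → ∃ F : ProbabilityMeasure ℝ,
      (∀ m : ℕ, F (Set.Icc 0 ((m : ℝ) + 1))ᶜ ≤ u m) ∧ ∀ z ∈ T,
        ‖resolventTransform (F : Measure ℝ) (z : ℂ)
          - selfMap lam c z (resolventTransform (F : Measure ℝ) (z : ℂ))‖ ≤ δ) :
    ∃ F : Measure ℝ, IsProbabilityMeasure F ∧ F (Set.Iio 0) = 0 ∧ ∀ z : ℂ, z.im ≠ 0 →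
      resolventTransform F z = selfMap lam c z (resolventTransform F z) := by
  -- The negative half-line lies in every complement, whose mass bound `u m` tends to zero.
  have hnull : ∀ F : ProbabilityMeasure ℝ, (∀ m : ℕ, F (Set.Icc 0 ((m : ℝ) + 1))ᶜ ≤ u m) →
      (F : Measure ℝ) (Set.Iio 0) = 0 := fun F hF => by
    have h1 : F (Set.Iio 0) = 0 := by
      refine le_antisymm (ge_of_tendsto' hu fun m => (F.apply_mono ?_).trans (hF m)) zero_le
      intro x hx h
      exact absurd h.1 (not_le.2 hx)
    rw [← ProbabilityMeasure.ennreal_coeFn_eq_coeFn_toMeasure, h1]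
    rfl
  -- Indexing by finite sets of points and precisions handles all non-real `z` at once: along an
  -- ultrafilter finer than `atTop`, each `z` is eventually included with error tending to zero.
  let I := Finset {z : ℂ // z.im ≠ 0} × ℕ
  choose! Fa hFa using happ
  let F : I → ProbabilityMeasure ℝ := fun i => Fa i.1 (1 / ((i.2 : ℝ) + 1))
  have hF : ∀ i : I, (∀ m : ℕ, F i (Set.Icc 0 ((m : ℝ) + 1))ᶜ ≤ u m) ∧ ∀ z ∈ i.1,
        ‖resolventTransform (F i : Measure ℝ) (z : ℂ)
          - selfMap lam c z (resolventTransform (F i : Measure ℝ) (z : ℂ))‖ ≤ 1 / ((i.2 : ℝ) + 1) :=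
    fun i => hFa i.1 _ (by positivity)
  let V : Ultrafilter I := Ultrafilter.of atTop
  have hV : (V : Filter I) ≤ atTop := Ultrafilter.of_le atTop
  -- Prokhorov: uniform tail bounds give a compact set of probability measures, so the ultrafilter
  -- converges.
  have hcpt := isCompact_setOfPred_probabilityMeasure_mass_eq_compl_isCompact_le (E := ℝ)
    (K := fun m : ℕ => Set.Icc 0 ((m : ℝ) + 1)) hu (fun m => isCompact_Icc) (Or.inl inferInstance)
  obtain ⟨F₀, hF₀, hlim⟩ := isCompact_iff_ultrafilter_le_nhds.1 hcpt (V.map F) (by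
    rw [le_principal_iff]
    exact Filter.mem_map.2 (Filter.univ_mem' fun i => (hF i).1))
  have hlim' : Tendsto F V (𝓝 F₀) := hlim
  refine ⟨F₀, inferInstance, hnull F₀ hF₀, fun z hz => ?_⟩
  rw [ProbabilityMeasure.tendsto_iff_forall_integral_rclike_tendsto ℂ] at hlim'
  have hs : Tendsto (fun i => resolventTransform (F i : Measure ℝ) z) V
      (𝓝 (resolventTransform (F₀ : Measure ℝ) z)) := by
    simp_rw [resolventTransform_eq_integral]
    exact hlim' (BoundedContinuousFunction.ofNormedAddCommGroup _ (continuous_inv_ofReal_sub hz)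
      _ (norm_inv_ofReal_sub_le hz))
  have hG : Tendsto (fun i => selfMap lam c z (resolventTransform (F i : Measure ℝ) z)) V
      (𝓝 (selfMap lam c z (resolventTransform (F₀ : Measure ℝ) z))) := by
    rw [tendsto_iff_norm_sub_tendsto_zero] at hs ⊢
    refine squeeze_zero (fun _ => norm_nonneg _) (fun i => norm_selfMap_sub_le hlam hΛ hc hc1 hz
      (im_mul_resolventTransform_nonneg (hnull _ (hF i).1) hz)
      (im_mul_resolventTransform_nonneg (hnull _ hF₀) hz)) ?_
    have h0 := hs.const_mul (Λ * ‖z‖ / |z.im| ^ 2)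
    rwa [mul_zero] at h0
  have hzero : Tendsto (fun i : I => 1 / ((i.2 : ℝ) + 1)) V (𝓝 0) := by
    refine Tendsto.mono_left ?_ hV
    rw [← prod_atTop_atTop_eq]
    exact tendsto_one_div_add_atTop_nhds_zero_nat.comp tendsto_snd
  have hev : ∀ᶠ i : I in V, ‖resolventTransform (F i : Measure ℝ) z
      - selfMap lam c z (resolventTransform (F i : Measure ℝ) z)‖ ≤ 1 / ((i.2 : ℝ) + 1) := by
    refine hV ?_
    filter_upwards [eventually_ge_atTop (({⟨z, hz⟩}, 0) : I)] with i hi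
    exact (hF i).2 ⟨z, hz⟩ (hi.1 (Finset.mem_singleton_self _))
  have h0 := squeeze_zero' (Eventually.of_forall fun _ => norm_nonneg _) hev hzero
  have h1 := (hs.sub hG).norm
  exact sub_eq_zero.1 (norm_eq_zero.1 (tendsto_nhds_unique h1 h0))

end SelfMap

/-! ### Empirical spectral distributions -/

section EmpiricalSpectralDistribution
open Matrix
open scoped Matrix.Norms.L2Operator ComplexOrder

variable {n : Type*} [Fintype n] [DecidableEq n]

/-- The empirical distribution of the eigenvalues of a Hermitian matrix. -/
noncomputable def spectralDistribution {G : Matrix n n ℂ} (hG : G.IsHermitian) : Measure ℝ :=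
  (Fintype.card n : ENNReal)⁻¹ • ∑ i, Measure.dirac (hG.eigenvalues i)

variable {G : Matrix n n ℂ}

theorem isProbabilityMeasure_spectralDistribution [Nonempty n] (hG : G.IsHermitian) :
    IsProbabilityMeasure (spectralDistribution hG) := by
  constructor
  simp only [spectralDistribution, Measure.smul_apply, Measure.finsetSum_apply, measure_univ,
    Finset.sum_const, Finset.card_univ, nsmul_eq_mul, mul_one, smul_eq_mul]
  exact ENNReal.inv_mul_cancel (by simp) (by simp)

theorem resolventTransform_spectralDistribution (hG : G.IsHermitian) {z : ℂ} (hz : z.im ≠ 0) :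
    resolventTransform (spectralDistribution hG) z
      = (Fintype.card n : ℂ)⁻¹ * (matResolvent G z).trace := by
  rw [resolventTransform_eq_integral, spectralDistribution, integral_smul_measure,
    integral_finsetSum_measure fun i _ => ?_, trace_matResolvent hG hz]
  · simp only [integral_dirac]
    rw [ENNReal.toReal_inv, ENNReal.toReal_natCast, Complex.real_smul]
    simp
  · exact integrable_inv_ofReal_sub hz

/-- Markov's inequality: the eigenvalues are nonnegative and their mean is at most `τ`. -/
theorem spectralDistribution_compl_Icc_le [Nonempty n] (hG : G.PosSemidef) {τ M : ℝ} (hM : 0 < M)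
    (hτ : (G.trace).re ≤ Fintype.card n * τ) :
    spectralDistribution hG.1 (Set.Icc 0 M)ᶜ ≤ ENNReal.ofReal (τ / M) := by
  have hcard : (0 : ℝ) < Fintype.card n := by exact_mod_cast Fintype.card_pos
  have htr : ∑ i, hG.1.eigenvalues i = G.trace.re := by
    rw [hG.1.trace_eq_sum_eigenvalues]
    simp
  have h1 : ∀ i, Measure.dirac (hG.1.eigenvalues i) (Set.Icc 0 M)ᶜ
      ≤ ENNReal.ofReal (hG.1.eigenvalues i / M) := fun i => by
    rw [Measure.dirac_apply' _ measurableSet_Icc.compl]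
    by_cases hi : hG.1.eigenvalues i ≤ M
    · rw [Set.indicator_of_notMem (by simpa using ⟨hG.eigenvalues_nonneg i, hi⟩)]
      exact zero_le
    · refine (Set.indicator_le_self' (fun _ _ => zero_le) _).trans ?_
      simp only [Pi.one_apply]
      rw [ENNReal.one_le_ofReal, one_le_div hM]
      exact (not_le.1 hi).le
  rw [spectralDistribution, Measure.smul_apply, Measure.finsetSum_apply, smul_eq_mul]
  calc (Fintype.card n : ENNReal)⁻¹ * ∑ i, Measure.dirac (hG.1.eigenvalues i) (Set.Icc 0 M)ᶜ
      ≤ (Fintype.card n : ENNReal)⁻¹ * ∑ i, ENNReal.ofReal (hG.1.eigenvalues i / M) := by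
        gcongr with i; exact h1 i
    _ = ENNReal.ofReal ((Fintype.card n : ℝ)⁻¹ * (∑ i, hG.1.eigenvalues i / M)) := by
        rw [← ENNReal.ofReal_sum_of_nonneg
          fun i _ => div_nonneg (hG.eigenvalues_nonneg i) hM.le,
          ENNReal.ofReal_mul (by positivity), ENNReal.ofReal_inv_of_pos hcard,
          ENNReal.ofReal_natCast]
    _ ≤ ENNReal.ofReal (τ / M) := by
        refine ENNReal.ofReal_le_ofReal ?_
        rw [← Finset.sum_div, htr, inv_mul_le_iff₀ hcard, ← mul_div_assoc]
        gcongr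

/-- The eigenvalues and the diagonal entries are the same multiset of roots of the characteristic
polynomial; their orderings may differ. -/
theorem sum_eigenvalues_of_eq_diagonal {d : n → ℝ} (hG : G.IsHermitian)
    (h : G = diagonal fun i => (d i : ℂ)) (f : ℝ → ℂ) :
    ∑ i, f (hG.eigenvalues i) = ∑ i, f (d i) := by
  have h1 := hG.roots_charpoly_eq_eigenvalues
  have h2 : G.charpoly.roots = Multiset.map (fun i => (d i : ℂ)) Finset.univ.val := by
    rw [h, charpoly_diagonal, Polynomial.roots_prod]
    · simp
    · simp [Finset.prod_ne_zero_iff, Polynomial.X_sub_C_ne_zero]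
  rw [h2] at h1
  have h3 := congrArg (fun s => (s.map fun w : ℂ => f w.re).sum) h1
  rw [Multiset.map_map, Multiset.map_map] at h3
  exact h3.symm

end EmpiricalSpectralDistribution

/-! ### A realisation close to the mean -/

section Approximants
open Matrix
open scoped Matrix.Norms.L2Operator ComplexOrder

variable {n k : Type*} [Fintype n] [DecidableEq n] [Fintype k] [DecidableEq k]

omit [DecidableEq n] [DecidableEq k] in
theorem trace_colGram (x : k → n → ℂ) :
    (colGram x).trace = ((∑ j, ∑ i, ‖x j i‖ ^ 2 : ℝ) : ℂ) := by
  rw [colGram, trace_sum]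
  push_cast
  refine Finset.sum_congr rfl fun j _ => ?_
  rw [trace_vecMulVec, dotProduct]
  refine Finset.sum_congr rfl fun i _ => ?_
  rw [Pi.star_apply, RCLike.star_def, Complex.mul_conj, Complex.normSq_eq_norm_sq]
  push_cast
  rfl

variable {S : Matrix n n ℂ} {Λ : ℝ}

omit [DecidableEq k] in
theorem integrable_trace_colGram [Nonempty k] (hS : ‖S * Sᴴ‖ ≤ Λ)
    (hcard : Fintype.card n ≤ Fintype.card k) :
    Integrable (fun x : k → n → ℂ => (colGram x).trace.re) (columnsLaw k S) := by
  simp_rw [trace_colGram, Complex.ofReal_re]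
  exact integrable_finsetSum _ fun j _ =>
    integrable_comp_eval (μ := fun _ : k => columnLaw S (Fintype.card k))
      (f := fun v : n → ℂ => ∑ i, ‖v i‖ ^ 2)
      (isColumnLaw_columnLaw_card hS hcard).integrable_normSq

omit [DecidableEq k] in
theorem integral_trace_colGram [Nonempty k] (hS : ‖S * Sᴴ‖ ≤ Λ)
    (hcard : Fintype.card n ≤ Fintype.card k) :
    ∫ x : k → n → ℂ, (colGram x).trace.re ∂(columnsLaw k S) ≤ Fintype.card n * Λ := by
  have h := isColumnLaw_columnLaw_card hS hcard
  have hk : (Fintype.card k : ℝ) ≠ 0 := by exact_mod_cast Fintype.card_ne_zero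
  have h1 := congrArg Complex.re h.integral_normSq
  rw [Complex.ofReal_re, ← Complex.ofReal_inv, Complex.re_ofReal_mul] at h1
  simp_rw [trace_colGram, Complex.ofReal_re]
  rw [integral_finsetSum _ fun j _ => integrable_comp_eval
    (μ := fun _ : k => columnLaw S (Fintype.card k))
    (f := fun v : n → ℂ => ∑ i, ‖v i‖ ^ 2) h.integrable_normSq]
  have h2 : ∀ j : k, ∫ x : k → n → ℂ, ∑ i, ‖x j i‖ ^ 2 ∂(columnsLaw k S)
      = (Fintype.card k : ℝ)⁻¹ * (S * Sᴴ).trace.re := fun j => by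
    rw [← h1]
    exact integral_comp_eval (μ := fun _ : k => columnLaw S (Fintype.card k))
      (f := fun v : n → ℂ => ∑ i, ‖v i‖ ^ 2) h.integrable_normSq.aestronglyMeasurable
  simp_rw [h2]
  rw [Finset.sum_const, Finset.card_univ, nsmul_eq_mul, mul_inv_cancel_left₀ hk]
  refine (Complex.re_le_norm _).trans ((norm_trace_le _).trans ?_)
  gcongr

/-- A realisation of the sample covariance matrix with bounded normalised trace, whose resolvent
is close to the mean at finitely many points. -/
theorem exists_gram_close [Nonempty n] [Nonempty k] (hS : ‖S * Sᴴ‖ ≤ Λ) (hΛ : 0 < Λ)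
    (hcard : Fintype.card n ≤ Fintype.card k) (T : Finset {z : ℂ // z.im ≠ 0}) {δ : ℝ} (hδ : 0 < δ)
    (hT : ∑ z ∈ T, sdBound Λ z ^ 2 ≤ (Fintype.card n * δ) ^ 2 / 2) :
    ∃ x : k → n → ℂ, (colGram x).trace.re ≤ Fintype.card n * (2 * Λ) ∧
      ∀ z ∈ T, ‖(matResolvent (colGram x) z).trace - meanTrace k S z‖ ≤ Fintype.card n * δ := by
  have hn : (0 : ℝ) < Fintype.card n := by exact_mod_cast Fintype.card_pos
  have hI1 : ∀ z ∈ T, Integrable (fun x : k → n → ℂ => ((Fintype.card n * δ) ^ 2)⁻¹ *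
      ‖(matResolvent (colGram x) z).trace - meanTrace k S z‖ ^ 2) (columnsLaw k S) := fun z _ =>
    (((isBddMeas_trace_matResolvent_gram z.2).sub
      (IsBddMeas.const _)).integrable_norm_sq).const_mul _
  have hI2 := (integrable_trace_colGram (k := k) hS hcard).const_mul (Fintype.card n * (2 * Λ))⁻¹
  -- First-moment method: some point does not exceed the mean of a sum of nonnegative normalised
  -- quantities. That mean is at most `1 / 2 + 1 / 2`, so each of them is at most `1` there.
  obtain ⟨x, hx⟩ := exists_le_integral ((integrable_finsetSum T hI1).add hI2)
  have hle : ∫ x : k → n → ℂ, (∑ z ∈ T, ((Fintype.card n * δ) ^ 2)⁻¹ *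
      ‖(matResolvent (colGram x) z).trace - meanTrace k S z‖ ^ 2) + (Fintype.card n * (2 * Λ))⁻¹ *
        (colGram x).trace.re ∂(columnsLaw k S) ≤ 1 := by
    rw [integral_add (integrable_finsetSum T hI1) hI2, integral_finsetSum T hI1,
      integral_const_mul]
    have a1 : ∑ z ∈ T, ∫ x : k → n → ℂ, ((Fintype.card n * δ) ^ 2)⁻¹ *
        ‖(matResolvent (colGram x) z).trace - meanTrace k S z‖ ^ 2 ∂(columnsLaw k S) ≤ 1 / 2 := by
      calc _ ≤ ∑ z ∈ T, ((Fintype.card n * δ) ^ 2)⁻¹ * sdBound Λ z ^ 2 := by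
            refine Finset.sum_le_sum fun z _ => ?_
            rw [integral_const_mul]
            exact mul_le_mul_of_nonneg_left (variance_trace_columnsLaw_le hS hcard z.2)
              (by positivity)
        _ ≤ ((Fintype.card n * δ) ^ 2)⁻¹ * ((Fintype.card n * δ) ^ 2 / 2) := by
            rw [← Finset.mul_sum]
            gcongr
        _ = 1 / 2 := by field_simp
    have a2 : (Fintype.card n * (2 * Λ))⁻¹ *
        ∫ x : k → n → ℂ, (colGram x).trace.re ∂(columnsLaw k S) ≤ 1 / 2 := by
      calc _ ≤ (Fintype.card n * (2 * Λ))⁻¹ * (Fintype.card n * Λ) := by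
            gcongr; exact integral_trace_colGram hS hcard
        _ = 1 / 2 := by field_simp
    linarith
  have hx1 := hx.trans hle
  simp only [Pi.add_apply] at hx1
  have htr : 0 ≤ (colGram x).trace.re := by
    rw [trace_colGram, Complex.ofReal_re]
    positivity
  have b1 : ∀ z ∈ T, 0 ≤ ((Fintype.card n * δ) ^ 2)⁻¹ *
      ‖(matResolvent (colGram x) z).trace - meanTrace k S z‖ ^ 2 := fun z _ => by positivity
  refine ⟨x, ?_, fun z hz => ?_⟩
  · have := Finset.sum_nonneg b1
    have h2 : (Fintype.card n * (2 * Λ))⁻¹ * (colGram x).trace.re ≤ 1 := by linarith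
    rwa [inv_mul_le_iff₀ (by positivity), mul_one] at h2
  · have h1 := Finset.single_le_sum b1 hz
    have h3 : 0 ≤ (Fintype.card n * (2 * Λ))⁻¹ * (colGram x).trace.re := by positivity
    have h2 : ((Fintype.card n * δ) ^ 2)⁻¹ *
      ‖(matResolvent (colGram x) z).trace - meanTrace k S z‖ ^ 2 ≤ 1 := by linarith
    rw [inv_mul_le_iff₀ (by positivity), mul_one] at h2
    exact (pow_le_pow_iff_left₀ (norm_nonneg _) (by positivity) two_ne_zero).1 h2

end Approximants

/-! ### Existence of the deterministic spectral measure -/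

section Existence
open Matrix
open scoped Matrix.Norms.L2Operator ComplexOrder

section
variable {n k : Type*} [Fintype n] [DecidableEq n] [Fintype k] [DecidableEq k] [Nonempty n]
  [Nonempty k] {S : Matrix n n ℂ} {Λ : ℝ} {z : ℂ}

/-- The normalised mean of `tr Q` solves the self-consistent equation approximately. -/
theorem norm_normalized_meanTrace_sub_selfMap_le (hS : ‖S * Sᴴ‖ ≤ Λ)
    (hcard : Fintype.card n ≤ Fintype.card k) (hz : z.im ≠ 0) (hR : (S * Sᴴ).IsHermitian) :
    ‖(Fintype.card n : ℂ)⁻¹ * meanTrace k S z - selfMap hR.eigenvalues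
      (Fintype.card n / Fintype.card k) z ((Fintype.card n : ℂ)⁻¹ * meanTrace k S z)‖
      ≤ biasBound Λ z / Fintype.card n := by
  have h := norm_meanTrace_sub_le hS hcard hz hR
  have hn : (0 : ℝ) < Fintype.card n := by exact_mod_cast Fintype.card_pos
  have hnC : (Fintype.card n : ℂ) ≠ 0 := by exact_mod_cast hn.ne'
  have hkC : (Fintype.card k : ℂ) ≠ 0 := by exact_mod_cast Fintype.card_ne_zero
  have e : (((Fintype.card n / Fintype.card k : ℝ)) : ℂ) * z *
      ((Fintype.card n : ℂ)⁻¹ * meanTrace k S z)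
      = ((Fintype.card k : ℝ) : ℂ)⁻¹ * z * meanTrace k S z := by
    push_cast
    field_simp
  rw [selfMap, ← mul_sub, norm_mul, norm_inv, Complex.norm_natCast, e, le_div_iff₀ hn, mul_comm,
    mul_inv_cancel_left₀ hn.ne']
  exact h

omit [DecidableEq k] in
theorem im_normalized_meanTrace_mul_pos (hz : z.im ≠ 0) :
    0 < ((Fintype.card n : ℂ)⁻¹ * meanTrace k S z).im * z.im := by
  have hn : (0 : ℝ) < Fintype.card n := by exact_mod_cast Fintype.card_pos
  rw [← Complex.ofReal_natCast, ← Complex.ofReal_inv, Complex.im_ofReal_mul, mul_assoc]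
  exact mul_pos (inv_pos.2 hn) (im_meanTrace_mul_pos hz)

omit [DecidableEq k] in
theorem im_mul_normalized_meanTrace_nonneg (hz : z.im ≠ 0) :
    0 ≤ (z * ((Fintype.card n : ℂ)⁻¹ * meanTrace k S z)).im * z.im := by
  have hn : (0 : ℝ) < Fintype.card n := by exact_mod_cast Fintype.card_pos
  rw [mul_left_comm, ← Complex.ofReal_natCast, ← Complex.ofReal_inv, Complex.im_ofReal_mul,
    mul_assoc]
  exact mul_nonneg (inv_pos.2 hn).le (im_mul_meanTrace_nonneg hz)

omit [DecidableEq k] in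
theorem norm_normalized_meanTrace_le (hz : z.im ≠ 0) :
    ‖(Fintype.card n : ℂ)⁻¹ * meanTrace k S z‖ ≤ |z.im|⁻¹ := by
  have hn : (0 : ℝ) < Fintype.card n := by exact_mod_cast Fintype.card_pos
  rw [norm_mul, norm_inv, Complex.norm_natCast, inv_mul_le_iff₀ hn]
  exact norm_meanTrace_le hz

end

theorem selfMap_congr_sum {ι κ : Type*} [Fintype ι] [Fintype κ] {lam : ι → ℝ} {lam' : κ → ℝ}
    (hcard : Fintype.card ι = Fintype.card κ)
    (h : ∀ f : ℝ → ℂ, ∑ i, f (lam i) = ∑ j, f (lam' j)) (c : ℝ) (z s : ℂ) :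
    selfMap lam c z s = selfMap lam' c z s := by
  rw [selfMap, selfMap, hcard, h fun x => ((x : ℂ) * (1 - c - c * z * s) - z)⁻¹]

/-- The map depends only on the distribution of the eigenvalues, so repeating each of them equally
often changes nothing. This lets the dimension grow at a fixed ratio `c`. -/
theorem selfMap_prod_fst {ι κ : Type*} [Fintype ι] [Fintype κ] [Nonempty κ] (lam : ι → ℝ) (c : ℝ)
    (z s : ℂ) : selfMap (fun a : ι × κ => lam a.1) c z s = selfMap lam c z s := by
  have hκ : (Fintype.card κ : ℂ) ≠ 0 := by exact_mod_cast Fintype.card_ne_zero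
  rw [selfMap, selfMap, Fintype.sum_prod_type]
  simp only [Finset.sum_const, Finset.card_univ, nsmul_eq_mul, Fintype.card_prod, Nat.cast_mul,
    mul_inv]
  rw [← Finset.mul_sum, mul_assoc, inv_mul_cancel_left₀ hκ]

variable {ι : Type*} [Fintype ι] [DecidableEq ι] [Nonempty ι] {lam : ι → ℝ} {Λ : ℝ}

theorem biasBound_nonneg (hΛ : 0 ≤ Λ) (z : ℂ) : 0 ≤ biasBound Λ z := by
  have := quadVarConst_pos.le
  unfold biasBound sdBound
  positivity

/-- Approximate solutions given by spectral distributions of large Gaussian sample covariance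
matrices, in which every population eigenvalue is repeated. -/
theorem exists_approx_selfMap (hlam : ∀ i, 0 ≤ lam i ∧ lam i ≤ Λ) (hΛ : 0 < Λ) {K : ℕ}
    (hK : Fintype.card ι ≤ K) (T : Finset {z : ℂ // z.im ≠ 0}) {δ : ℝ} (hδ : 0 < δ) :
    ∃ F : ProbabilityMeasure ℝ,
      (∀ m : ℕ, F (Set.Icc 0 ((m : ℝ) + 1))ᶜ ≤ Real.toNNReal (2 * Λ / ((m : ℝ) + 1))) ∧ ∀ z ∈ T,
        ‖resolventTransform (F : Measure ℝ) (z : ℂ) - selfMap lam (Fintype.card ι / K) z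
          (resolventTransform (F : Measure ℝ) (z : ℂ))‖ ≤ δ := by
  classical
  have hι : 0 < Fintype.card ι := Fintype.card_pos
  have hK0 : 0 < K := hι.trans_le hK
  have hK0' : (0 : ℝ) < K := by exact_mod_cast hK0
  have : Nonempty (Fin K) := ⟨⟨0, hK0⟩⟩
  -- `W` dominates `1` plus the Lipschitz constant at every point of `T`, so closeness `δ / (2 W)`
  -- to the mean costs at most `δ / 2`.
  set W : ℝ := 1 + ∑ z ∈ T, Λ * ‖(z : ℂ)‖ / |(z : ℂ).im| ^ 2 with hW
  have hLip0 : ∀ z ∈ T, 0 ≤ Λ * ‖(z : ℂ)‖ / |(z : ℂ).im| ^ 2 := fun z _ => by positivity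
  have hW1 : 0 < W := by have := Finset.sum_nonneg hLip0; linarith
  have hLip : ∀ z ∈ T, 1 + Λ * ‖(z : ℂ)‖ / |(z : ℂ).im| ^ 2 ≤ W := fun z hz => by
    have := Finset.single_le_sum hLip0 hz
    linarith
  set δ' : ℝ := δ / (2 * W) with hδ'
  have hδ'0 : 0 < δ' := by positivity
  have hB0 : ∀ z ∈ T, 0 ≤ biasBound Λ z := fun z _ => biasBound_nonneg hΛ.le z
  -- The repetition number is chosen to push the bias below `δ / 2` and the standard deviations
  -- below the tolerance `δ'`, for all points of `T` together.
  obtain ⟨q, hq⟩ := exists_nat_ge (2 * (∑ z ∈ T, biasBound Λ z) / δ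
    + (1 + 2 * ∑ z ∈ T, sdBound Λ z ^ 2) / δ')
  have hsd : 0 ≤ ∑ z ∈ T, sdBound Λ z ^ 2 := Finset.sum_nonneg fun z _ => sq_nonneg _
  have hbb : 0 ≤ ∑ z ∈ T, biasBound Λ z := Finset.sum_nonneg hB0
  have hq1 : 2 * (∑ z ∈ T, biasBound Λ z) / δ ≤ q := by
    have : 0 ≤ (1 + 2 * ∑ z ∈ T, sdBound Λ z ^ 2) / δ' := by positivity
    linarith
  have hq2 : (1 + 2 * ∑ z ∈ T, sdBound Λ z ^ 2) / δ' ≤ q := by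
    have : 0 ≤ 2 * (∑ z ∈ T, biasBound Λ z) / δ := by positivity
    linarith
  rw [div_le_iff₀ hδ] at hq1
  rw [div_le_iff₀ hδ'0] at hq2
  let d : ι × Fin (q + 1) → ℝ := fun a => lam a.1
  let S : Matrix (ι × Fin (q + 1)) (ι × Fin (q + 1)) ℂ := diagonal fun a => (√(d a) : ℂ)
  have hSS : S * Sᴴ = diagonal fun a => (d a : ℂ) := by
    rw [diagonal_conjTranspose, diagonal_mul_diagonal]
    congr 1
    funext a
    rw [Pi.star_apply, RCLike.star_def, Complex.conj_ofReal, ← Complex.ofReal_mul,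
      Real.mul_self_sqrt (hlam a.1).1]
  have hS : ‖S * Sᴴ‖ ≤ Λ := by
    rw [hSS, l2_opNorm_diagonal]
    refine (pi_norm_le_iff_of_nonneg hΛ.le).2 fun a => ?_
    rw [Complex.norm_real, Real.norm_of_nonneg (hlam a.1).1]
    exact (hlam a.1).2
  have hcn : Fintype.card (ι × Fin (q + 1)) = Fintype.card ι * (q + 1) := by simp
  have hck : Fintype.card (Fin K × Fin (q + 1)) = K * (q + 1) := by simp
  have hcard : Fintype.card (ι × Fin (q + 1)) ≤ Fintype.card (Fin K × Fin (q + 1)) := by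
    rw [hcn, hck]
    gcongr
  have hratio : (Fintype.card (ι × Fin (q + 1)) : ℝ) / Fintype.card (Fin K × Fin (q + 1))
      = Fintype.card ι / K := by
    rw [hcn, hck]
    push_cast
    field_simp
  have hn0 : (0 : ℝ) < Fintype.card (ι × Fin (q + 1)) := by exact_mod_cast Fintype.card_pos
  have hnq : (q : ℝ) ≤ Fintype.card (ι × Fin (q + 1)) := by
    rw [hcn]
    have : q ≤ Fintype.card ι * (q + 1) := by nlinarith
    exact_mod_cast this
  have hR : (S * Sᴴ).IsHermitian := isHermitian_mul_conjTranspose_self S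
  have hself : ∀ z s, selfMap hR.eigenvalues ((Fintype.card (ι × Fin (q + 1)) : ℝ) /
      Fintype.card (Fin K × Fin (q + 1))) z s = selfMap lam (Fintype.card ι / K) z s :=
    fun z s => by
      rw [hratio, selfMap_congr_sum rfl (sum_eigenvalues_of_eq_diagonal hR hSS)]
      exact selfMap_prod_fst lam _ z s
  -- The summand `1` in the choice of `q` makes the dimension times `δ'` at least `1`, so its square
  -- is at least itself and dominates twice the sum of the variance bounds.
  obtain ⟨x, hx1, hx2⟩ := exists_gram_close (k := Fin K × Fin (q + 1)) hS hΛ hcard T hδ'0 (by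
    have h1 : 1 + 2 * ∑ z ∈ T, sdBound Λ z ^ 2 ≤ Fintype.card (ι × Fin (q + 1)) * δ' :=
      hq2.trans (by gcongr)
    nlinarith)
  have hG := posSemidef_colGram x
  have hprob := isProbabilityMeasure_spectralDistribution hG.1
  refine ⟨⟨spectralDistribution hG.1, hprob⟩, fun m => ?_, fun z hz => ?_⟩
  · refine ENNReal.coe_le_coe.1
      ((ProbabilityMeasure.ennreal_coeFn_eq_coeFn_toMeasure _ _).trans_le ?_)
    exact spectralDistribution_compl_Icc_le hG (by positivity) hx1
  · have hzi := z.2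
    change ‖resolventTransform (spectralDistribution hG.1) (z : ℂ) - selfMap lam _ z
      (resolventTransform (spectralDistribution hG.1) (z : ℂ))‖ ≤ δ
    have hnn := im_mul_resolventTransform_nonneg (F := spectralDistribution hG.1) (by
      refine measure_mono_null (t := (Set.Ici 0)ᶜ) (by simp) ?_
      rw [spectralDistribution, Measure.smul_apply, Measure.finsetSum_apply]
      simp [Measure.dirac_apply' _ measurableSet_Iio, hG.eigenvalues_nonneg]) hzi
    set s := resolventTransform (spectralDistribution hG.1) (z : ℂ) with hs
    set α := (Fintype.card (ι × Fin (q + 1)) : ℂ)⁻¹ * meanTrace (Fin K × Fin (q + 1)) S z with hα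
    have h1 : ‖α - selfMap lam (Fintype.card ι / K) z α‖
        ≤ biasBound Λ z / Fintype.card (ι × Fin (q + 1)) := by
      rw [← hself]
      exact norm_normalized_meanTrace_sub_selfMap_le hS hcard hzi hR
    have h2 : ‖s - α‖ ≤ δ' := by
      rw [hs, resolventTransform_spectralDistribution hG.1 hzi, hα, ← mul_sub, norm_mul, norm_inv,
        Complex.norm_natCast, inv_mul_le_iff₀ hn0]
      exact hx2 z hz
    have h3 : ‖selfMap lam (Fintype.card ι / K) z α - selfMap lam (Fintype.card ι / K) z s‖
        ≤ Λ * ‖(z : ℂ)‖ / |(z : ℂ).im| ^ 2 * ‖α - s‖ :=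
      norm_selfMap_sub_le hlam hΛ.le (by positivity)
        ((div_le_one hK0').2 (by exact_mod_cast hK)) hzi
        (im_mul_normalized_meanTrace_nonneg hzi) hnn
    have h4 : biasBound Λ z / Fintype.card (ι × Fin (q + 1)) ≤ δ / 2 := by
      rw [div_le_iff₀ hn0]
      have := Finset.single_le_sum hB0 hz
      nlinarith
    have h5 : (1 + Λ * ‖(z : ℂ)‖ / |(z : ℂ).im| ^ 2) * δ' ≤ δ / 2 := by
      calc _ ≤ W * δ' := by gcongr; exact hLip z hz
        _ = δ / 2 := by rw [hδ']; field_simp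
    have h6 : Λ * ‖(z : ℂ)‖ / |(z : ℂ).im| ^ 2 * ‖α - s‖
        ≤ Λ * ‖(z : ℂ)‖ / |(z : ℂ).im| ^ 2 * δ' := by
      rw [norm_sub_rev]
      gcongr
    calc ‖s - selfMap lam (Fintype.card ι / K) z s‖
        = ‖(s - α) + (α - selfMap lam (Fintype.card ι / K) z α)
          + (selfMap lam (Fintype.card ι / K) z α - selfMap lam (Fintype.card ι / K) z s)‖ := by
          congr 1; ring
      _ ≤ _ := norm_add₃_le
      _ ≤ δ := by linarith

/-- Solvability of the self-consistent equation. -/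
theorem exists_measure_selfMap (hlam : ∀ i, 0 ≤ lam i ∧ lam i ≤ Λ) (hΛ : 0 < Λ) {K : ℕ}
    (hK : Fintype.card ι ≤ K) :
    ∃ F : Measure ℝ, IsProbabilityMeasure F ∧ F (Set.Iio 0) = 0 ∧ ∀ z : ℂ, z.im ≠ 0 →
      resolventTransform F z = selfMap lam (Fintype.card ι / K) z (resolventTransform F z) := by
  have hK0 : (0 : ℝ) < K := by exact_mod_cast (Fintype.card_pos (α := ι)).trans_le hK
  refine exists_measure_of_approx hlam hΛ.le (by positivity)
    ((div_le_one hK0).2 (by exact_mod_cast hK)) (u := fun m => Real.toNNReal (2 * Λ / ((m : ℝ) + 1)))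
    ?_ fun T δ hδ => exists_approx_selfMap hlam hΛ hK T hδ
  have h := (tendsto_one_div_add_atTop_nhds_zero_nat (𝕜 := ℝ)).const_mul (2 * Λ)
  rw [mul_zero] at h
  have h2 := (continuous_real_toNNReal.tendsto 0).comp h
  rw [Real.toNNReal_zero] at h2
  refine h2.congr fun m => ?_
  simp only [Function.comp_apply]
  rw [mul_one_div]

/-- The sigma type lists the eigenvalues with multiplicity, turning the weighted sum of the equation
into an unweighted one. -/
theorem selfMap_sigma {L : ℕ} (lam : Fin L → ℝ) (mult : Fin L → ℕ) (c : ℝ) (z s : ℂ) :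
    selfMap (fun a : (Σ i, Fin (mult i)) => lam a.1) c z s = ((∑ i, mult i : ℕ) : ℂ)⁻¹ *
      ∑ i, (mult i : ℂ) / ((lam i : ℂ) * (1 - c - c * z * s) - z) := by
  rw [selfMap, Fintype.sum_sigma]
  simp only [Finset.sum_const, Finset.card_univ, nsmul_eq_mul, Fintype.card_sigma,
    Fintype.card_fin, div_eq_mul_inv]

/-- The deterministic spectral measure exists. -/
theorem isLimitSpectralMeasure_limitSpectralMeasure {L N K : ℕ} {lam : Fin L → ℝ}
    {mult : Fin L → ℕ} (hN : 0 < N) (hNK : N ≤ K) (hmult : ∑ i, mult i = N)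
    (hlam : ∀ i, 0 ≤ lam i ∧ lam i ≤ Λ) (hΛ : 0 < Λ) :
    IsLimitSpectralMeasure N lam mult ((N : ℝ) / K)
      (limitSpectralMeasure N lam mult ((N : ℝ) / K)) := by
  have hcard : Fintype.card (Σ i, Fin (mult i)) = N := by simpa using hmult
  have : Nonempty (Σ i, Fin (mult i)) := Fintype.card_pos_iff.1 (hcard ▸ hN)
  have hex : ∃ F : Measure ℝ, IsLimitSpectralMeasure N lam mult ((N : ℝ) / K) F := by
    obtain ⟨F, hF, h0, heq⟩ := exists_measure_selfMap
      (lam := fun a : (Σ i, Fin (mult i)) => lam a.1) (fun a => hlam a.1) hΛ (hcard.trans_le hNK)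
    refine ⟨F, hF, h0, fun z hz => (heq z hz).trans ?_⟩
    rw [selfMap_sigma, hmult, hcard]
  rw [limitSpectralMeasure, dif_pos hex]
  exact hex.choose_spec

end Existence

/-! ### Second moments of derivatives -/

section CauchyEstimate

/-- The uniform distribution on the angles. -/
noncomputable def angleMeasure : Measure ℝ :=
  (ENNReal.ofReal (2 * Real.pi))⁻¹ • volume.restrict (Set.Ioc 0 (2 * Real.pi))

instance : IsProbabilityMeasure angleMeasure := by
  constructor
  rw [angleMeasure, Measure.smul_apply, Measure.restrict_apply_univ, Real.volume_Ioc, sub_zero,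
    smul_eq_mul]
  exact ENNReal.inv_mul_cancel (by simpa using Real.pi_pos) ENNReal.ofReal_ne_top

/-- Cauchy's formula for `f'`, written as an average over a probability measure so that Jensen and
Fubini apply directly. -/
theorem deriv_eq_integral_angleMeasure {U : Set ℂ} (hU : IsOpen U) {z : ℂ} {r : ℝ} (hr : 0 < r)
    (hzr : Metric.closedBall z r ⊆ U) {f : ℂ → ℂ} (hf : DifferentiableOn ℂ f U) :
    deriv f z = ∫ θ, (circleMap 0 r θ)⁻¹ * f (circleMap z r θ) ∂angleMeasure := by
  have hpi : (0 : ℝ) < 2 * Real.pi := by positivity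
  rw [← Complex.two_pi_I_inv_smul_circleIntegral_sub_sq_inv_smul_of_differentiable hU hzr hf
    (Metric.mem_ball_self hr), circleIntegral, intervalIntegral.integral_of_le hpi.le, angleMeasure,
    integral_smul_measure, ENNReal.toReal_inv, ENNReal.toReal_ofReal hpi.le, Complex.real_smul,
    smul_eq_mul]
  have e : ∀ θ : ℝ, deriv (circleMap z r) θ • ((circleMap z r θ - z) ^ 2)⁻¹ • f (circleMap z r θ)
      = Complex.I * ((circleMap 0 r θ)⁻¹ * f (circleMap z r θ)) := fun θ => by
    have h0 : circleMap 0 r θ ≠ 0 := circleMap_ne_center hr.ne'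
    rw [deriv_circleMap, circleMap_sub_center, smul_eq_mul, smul_eq_mul]
    field_simp
  simp_rw [e]
  rw [integral_const_mul, ← mul_assoc]
  congr 1
  have : (Real.pi : ℂ) ≠ 0 := by exact_mod_cast Real.pi_ne_zero
  push_cast
  field_simp

variable {X : Type*} [MeasurableSpace X] {P : Measure X} [IsProbabilityMeasure P]

/-- Second moments of derivatives are controlled by second moments on a circle. -/
theorem integral_norm_deriv_sq_le {U : Set ℂ} (hU : IsOpen U) {z : ℂ} {r M B : ℝ} (hr : 0 < r)
    (hzr : Metric.closedBall z r ⊆ U) {f : X → ℂ → ℂ} (hf : ∀ x, DifferentiableOn ℂ (f x) U)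
    (hmeas : StronglyMeasurable fun p : X × ℝ => f p.1 (circleMap z r p.2))
    (hM : ∀ x θ, ‖f x (circleMap z r θ)‖ ≤ M)
    (hB : ∀ θ, ∫ x, ‖f x (circleMap z r θ)‖ ^ 2 ∂P ≤ B) :
    IsBddMeas (fun x => deriv (f x) z) ∧ ∫ x, ‖deriv (f x) z‖ ^ 2 ∂P ≤ B / r ^ 2 := by
  obtain ⟨G, hG⟩ : ∃ G : X → ℝ → ℂ, ∀ x θ, G x θ = (circleMap 0 r θ)⁻¹ * f x (circleMap z r θ) :=
    ⟨_, fun _ _ => rfl⟩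
  have hg : ∀ x, deriv (f x) z = ∫ θ, G x θ ∂angleMeasure := fun x => by
    simp_rw [hG]
    exact deriv_eq_integral_angleMeasure hU hr hzr (hf x)
  have hcm : StronglyMeasurable fun p : X × ℝ => (circleMap 0 r p.2)⁻¹ :=
    (((continuous_circleMap 0 r).measurable.comp measurable_snd).inv).stronglyMeasurable
  have hGm : StronglyMeasurable fun p : X × ℝ => G p.1 p.2 := by
    simp_rw [hG]
    exact hcm.mul hmeas
  have hn : ∀ x θ, ‖G x θ‖ = r⁻¹ * ‖f x (circleMap z r θ)‖ :=
    fun x θ => by rw [hG, norm_mul, norm_inv, norm_circleMap_zero, abs_of_pos hr]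
  have hbd : ∀ x θ, ‖G x θ‖ ≤ r⁻¹ * M := fun x θ => by
    rw [hn]
    gcongr
    exact hM x θ
  have hx : ∀ x, IsBddMeas fun θ => G x θ := fun x =>
    ⟨hGm.comp_measurable measurable_prodMk_left, _, hbd x⟩
  have hD : IsBddMeas fun x => deriv (f x) z := by
    refine ⟨?_, r⁻¹ * M, fun x => ?_⟩
    · simp_rw [hg]
      exact hGm.integral_prod_right'
    · rw [hg]
      refine (norm_integral_le_of_norm_le_const (ae_of_all _ (hbd x))).trans_eq ?_
      simp
  refine ⟨hD, ?_⟩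
  have hGB : IsBddMeas fun p : X × ℝ => G p.1 p.2 := ⟨hGm, r⁻¹ * M, fun p => hbd p.1 p.2⟩
  have hI : Integrable (fun p : X × ℝ => ‖G p.1 p.2‖ ^ 2) (P.prod angleMeasure) :=
    hGB.integrable_norm_sq
  have h1 : ∀ x, ‖deriv (f x) z‖ ^ 2 ≤ ∫ θ, ‖G x θ‖ ^ 2 ∂angleMeasure := fun x => by
    rw [hg]
    exact norm_integral_sq_le angleMeasure (hx x)
  have h2 : ∀ θ, ∫ x, ‖G x θ‖ ^ 2 ∂P ≤ B / r ^ 2 := fun θ => by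
    simp only [hn, mul_pow]
    rw [integral_const_mul, inv_pow, inv_mul_eq_div]
    gcongr
    exact hB θ
  calc ∫ x, ‖deriv (f x) z‖ ^ 2 ∂P
      ≤ ∫ x, ∫ θ, ‖G x θ‖ ^ 2 ∂angleMeasure ∂P :=
        integral_mono hD.integrable_norm_sq hI.integral_prod_left h1
    _ = ∫ θ, ∫ x, ‖G x θ‖ ^ 2 ∂P ∂angleMeasure := integral_integral_swap hI
    _ ≤ ∫ _θ, B / r ^ 2 ∂angleMeasure :=
        integral_mono hI.integral_prod_right (integrable_const _) h2
    _ = B / r ^ 2 := by simp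

end CauchyEstimate

/-! ### Second moment bounds with polynomial growth -/

section SecondMoments
open Matrix
open scoped Matrix.Norms.L2Operator ComplexOrder

variable {n k : Type*} [Fintype n] [DecidableEq n] [Fintype k] [DecidableEq k] [Nonempty n]
  [Nonempty k] {S : Matrix n n ℂ} {Λ : ℝ} {z : ℂ} {F : Measure ℝ} [IsProbabilityMeasure F]

/-- The deviation of the normalised trace of the resolvent from the Stieltjes transform of `F`. -/
noncomputable def stieltjesDev (F : Measure ℝ) (x : k → n → ℂ) (z : ℂ) : ℂ :=
  (Fintype.card n : ℂ)⁻¹ * (matResolvent (colGram x) z).trace - resolventTransform F z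

omit [DecidableEq k] [Nonempty k] in
theorem norm_stieltjesDev_le (hz : z.im ≠ 0) (x : k → n → ℂ) :
    ‖stieltjesDev F x z‖ ≤ 2 * |z.im|⁻¹ := by
  have hn : (0 : ℝ) < Fintype.card n := by exact_mod_cast Fintype.card_pos
  refine (norm_sub_le _ _).trans ?_
  have h1 : ‖(Fintype.card n : ℂ)⁻¹ * (matResolvent (colGram x) z).trace‖ ≤ |z.im|⁻¹ := by
    rw [norm_mul, norm_inv, Complex.norm_natCast, inv_mul_le_iff₀ hn]
    exact norm_trace_matResolvent_gram_le hz x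
  linarith [norm_resolventTransform_le (F := F) hz]

omit [DecidableEq k] [Nonempty n] [Nonempty k] [IsProbabilityMeasure F] in
theorem isBddMeas_stieltjesDev (hz : z.im ≠ 0) :
    IsBddMeas fun x : k → n → ℂ => stieltjesDev F x z := by
  have h := isBddMeas_trace_matResolvent_gram (n := n) (k := k) hz
  obtain ⟨M, hM⟩ := h.bdd
  refine IsBddMeas.sub ⟨h.1.const_mul _, ‖(Fintype.card n : ℂ)⁻¹‖ * M, fun x => ?_⟩
    (IsBddMeas.const _)
  rw [norm_mul]
  gcongr
  exact hM x

omit [DecidableEq k] [Nonempty n] [Nonempty k] in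
theorem differentiableOn_stieltjesDev (x : k → n → ℂ) :
    DifferentiableOn ℂ (stieltjesDev F x) {w | w.im ≠ 0} := by
  have hG := (posSemidef_colGram x).1
  have h : DifferentiableOn ℂ (fun w => (Fintype.card n : ℂ)⁻¹ *
      ∑ i, ((hG.eigenvalues i : ℂ) - w)⁻¹ - resolventTransform F w) {w | w.im ≠ 0} := by
    intro w hw
    refine DifferentiableAt.differentiableWithinAt ?_
    refine DifferentiableAt.sub (DifferentiableAt.const_mul (DifferentiableAt.fun_sum fun i _ => ?_) _)
      (differentiableAt_resolventTransform hw)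
    exact ((differentiableAt_const _).sub differentiableAt_id).inv (ofReal_sub_ne_zero hw _)
  refine h.congr fun w hw => ?_
  rw [stieltjesDev, trace_matResolvent hG hw]

omit [DecidableEq k] [Nonempty n] [Nonempty k] in
theorem stronglyMeasurable_stieltjesDev_circleMap {r : ℝ} (hr : ∀ θ, (circleMap z r θ).im ≠ 0) :
    StronglyMeasurable fun p : (k → n → ℂ) × ℝ => stieltjesDev F p.1 (circleMap z r p.2) := by
  have h1 : Continuous fun p : (k → n → ℂ) × ℝ =>
      matResolvent (colGram p.1) (circleMap z r p.2) :=
    Continuous.matResolvent ((continuous_sum_vecMulVec Finset.univ).comp continuous_fst)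
      ((continuous_circleMap z r).comp continuous_snd) (fun p => (posSemidef_colGram p.1).1)
      fun p => hr p.2
  have h2 : Continuous fun θ : ℝ => resolventTransform F (circleMap z r θ) :=
    continuous_iff_continuousAt.2 fun θ => ContinuousAt.comp (f := circleMap z r)
      (differentiableAt_resolventTransform (F := F) (hr θ)).continuousAt
      (continuous_circleMap z r).continuousAt
  exact ((continuous_const.mul h1.matrix_trace).sub (h2.comp continuous_snd)).stronglyMeasurable

/-- The stability factor of the self-consistent equation. -/
noncomputable def stabBound (Λ : ℝ) (z : ℂ) : ℝ :=
  2 * ‖z‖ / |z.im| + 4 * ‖z‖ ^ 2 / |z.im| ^ 2 + 4 * Λ * ‖z‖ ^ 2 / |z.im| ^ 3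

/-- Bias–variance around `E tr Q`: the variance is bounded by `sdBound`, and the bias is the
residual of the self-consistent equation multiplied by the stability factor. -/
theorem integral_norm_stieltjesDev_sq_le (hS : ‖S * Sᴴ‖ ≤ Λ)
    (hcard : Fintype.card n ≤ Fintype.card k) (hz : z.im ≠ 0) (hR : (S * Sᴴ).IsHermitian)
    (hF : resolventTransform F z = selfMap hR.eigenvalues (Fintype.card n / Fintype.card k) z
      (resolventTransform F z)) :
    ∫ x : k → n → ℂ, ‖stieltjesDev F x z‖ ^ 2 ∂(columnsLaw k S) ≤
      (sdBound Λ z ^ 2 + (biasBound Λ z * stabBound Λ z) ^ 2) / Fintype.card n ^ 2 := by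
  have hn : (0 : ℝ) < Fintype.card n := by exact_mod_cast Fintype.card_pos
  have hnC : (Fintype.card n : ℂ) ≠ 0 := by exact_mod_cast hn.ne'
  have hk : (0 : ℝ) < Fintype.card k := by exact_mod_cast Fintype.card_pos
  have hΛ : 0 ≤ Λ := (norm_nonneg _).trans hS
  set m := resolventTransform F z with hm
  set α := (Fintype.card n : ℂ)⁻¹ * meanTrace k S z with hα
  have hlam : ∀ i, 0 ≤ hR.eigenvalues i ∧ hR.eigenvalues i ≤ Λ := fun i =>
    ⟨(posSemidef_self_mul_conjTranspose S).eigenvalues_nonneg i,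
      ((le_abs_self _).trans (by
        have h1 := spectrum.norm_le_norm_of_mem
          (spectrum.algebraMap_mem ℂ (hR.eigenvalues_mem_spectrum_real i))
        simpa using h1)).trans hS⟩
  have hbias := norm_normalized_meanTrace_sub_selfMap_le hS hcard hz hR
  have hstab := norm_sub_le_of_approx_fixedPoint (m := m) (α := α) hlam hk rfl
    ((div_le_one hk).2 (by exact_mod_cast hcard)) hz hF (add_sub_cancel _ _).symm
    (im_resolventTransform_mul_pos hz) (im_normalized_meanTrace_mul_pos hz)
    (im_mul_normalized_meanTrace_nonneg hz) (norm_resolventTransform_le hz)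
    (norm_normalized_meanTrace_le hz)
  have hst0 : 0 ≤ stabBound Λ z := by unfold stabBound; positivity
  have h1 : ‖α - m‖ ≤ biasBound Λ z / Fintype.card n * stabBound Λ z :=
    hstab.trans (mul_le_mul_of_nonneg_right hbias hst0)
  have hdev : ∀ x : k → n → ℂ, ‖stieltjesDev F x z‖ ^ 2 = ((Fintype.card n : ℝ) ^ 2)⁻¹ *
      ‖(matResolvent (colGram x) z).trace - Fintype.card n * m‖ ^ 2 := fun x => by
    rw [stieltjesDev, ← inv_pow, ← mul_pow, ← Complex.norm_natCast (Fintype.card n), ← norm_inv,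
      ← norm_mul, mul_sub, inv_mul_cancel_left₀ hnC]
  simp_rw [hdev]
  rw [integral_const_mul, integral_norm_sub_sq_eq _ (isBddMeas_trace_matResolvent_gram hz),
    inv_mul_eq_div]
  gcongr
  · exact variance_trace_columnsLaw_le hS hcard hz
  · have e : (∫ x : k → n → ℂ, (matResolvent (colGram x) z).trace ∂(columnsLaw k S))
        - Fintype.card n * m = Fintype.card n * (α - m) := by
      rw [hα, meanTrace, mul_sub, mul_inv_cancel_left₀ hnC]
    rw [e, norm_mul, Complex.norm_natCast]
    calc _ ≤ Fintype.card n * (biasBound Λ z / Fintype.card n * stabBound Λ z) := by gcongr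
      _ = _ := by field_simp

/-- The constant in the second moment bounds. -/
noncomputable def momentConst (Λ : ℝ) : ℝ :=
  (Real.sqrt (2 * quadVarConst) * Λ * (1 + Λ)) ^ 2 +
    ((Λ * (Real.sqrt (2 * quadVarConst) * Λ * (1 + Λ)) + (Λ ^ 2 + quadVarConst * Λ ^ 2)) *
      (6 + 4 * Λ)) ^ 2

/-- Powers of `1 + ‖z‖` and `1 + |z.im|⁻¹` absorb all lower-order monomials, so each bound becomes a
single product. -/
theorem sdBound_le (hΛ : 0 ≤ Λ) (z : ℂ) : sdBound Λ z ≤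
    Real.sqrt (2 * quadVarConst) * Λ * (1 + Λ) * ((1 + ‖z‖) ^ 2 * (1 + |z.im|⁻¹) ^ 5) := by
  have hr : 0 ≤ ‖z‖ := norm_nonneg z
  have hv : 0 ≤ |z.im|⁻¹ := by positivity
  rw [sdBound, div_eq_mul_inv, div_eq_mul_inv, ← inv_pow, ← inv_pow]
  generalize ‖z‖ = r at *
  generalize |z.im|⁻¹ = v at *
  have hs : 0 ≤ Real.sqrt (2 * quadVarConst) * Λ := by positivity
  have h1 : v ^ 3 ≤ (1 + v) ^ 5 :=
    (pow_le_pow_left₀ hv (by linarith) 3).trans (pow_le_pow_right₀ (by linarith) (by norm_num))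
  have h2 : v ^ 5 ≤ (1 + v) ^ 5 := pow_le_pow_left₀ hv (by linarith) 5
  calc Real.sqrt (2 * quadVarConst) * Λ * r * (1 * v ^ 3 + Λ * r * v ^ 5)
      ≤ Real.sqrt (2 * quadVarConst) * Λ * (1 + r) *
        ((1 + r) * (1 + v) ^ 5 + Λ * (1 + r) * (1 + v) ^ 5) := by
        gcongr
        · linarith
        · linarith
        · linarith
    _ = _ := by ring

theorem biasBound_le (hΛ : 0 ≤ Λ) (z : ℂ) : biasBound Λ z ≤
    (Λ * (Real.sqrt (2 * quadVarConst) * Λ * (1 + Λ)) + (Λ ^ 2 + quadVarConst * Λ ^ 2)) *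
      ((1 + ‖z‖) ^ 3 * (1 + |z.im|⁻¹) ^ 7) := by
  have hsd := sdBound_le hΛ z
  have hq := quadVarConst_pos.le
  have hr : 0 ≤ ‖z‖ := norm_nonneg z
  have hv : 0 ≤ |z.im|⁻¹ := by positivity
  rw [biasBound, div_eq_mul_inv, div_eq_mul_inv, ← inv_pow, ← inv_pow]
  have hsd0 : 0 ≤ sdBound Λ z := by unfold sdBound; positivity
  generalize sdBound Λ z = s at *
  generalize Real.sqrt (2 * quadVarConst) * Λ * (1 + Λ) = a at *
  generalize ‖z‖ = r at *
  generalize |z.im|⁻¹ = v at *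
  have h1 : r ^ 2 ≤ (1 + r) ^ 3 :=
    (pow_le_pow_left₀ hr (by linarith) 2).trans (pow_le_pow_right₀ (by linarith) (by norm_num))
  have h2 : v ^ 5 ≤ (1 + v) ^ 7 :=
    (pow_le_pow_left₀ hv (by linarith) 5).trans (pow_le_pow_right₀ (by linarith) (by norm_num))
  calc r * Λ * v ^ 2 * s + r ^ 2 * v ^ 5 * (Λ ^ 2 + quadVarConst * Λ ^ 2)
      ≤ (1 + r) * Λ * (1 + v) ^ 2 * (a * ((1 + r) ^ 2 * (1 + v) ^ 5))
        + (1 + r) ^ 3 * (1 + v) ^ 7 * (Λ ^ 2 + quadVarConst * Λ ^ 2) := by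
        gcongr
        · linarith
        · linarith
    _ = _ := by ring

theorem stabBound_le (hΛ : 0 ≤ Λ) (z : ℂ) :
    stabBound Λ z ≤ (6 + 4 * Λ) * ((1 + ‖z‖) ^ 2 * (1 + |z.im|⁻¹) ^ 3) := by
  have hr : 0 ≤ ‖z‖ := norm_nonneg z
  have hv : 0 ≤ |z.im|⁻¹ := by positivity
  rw [stabBound, div_eq_mul_inv, div_eq_mul_inv, div_eq_mul_inv, ← inv_pow, ← inv_pow]
  generalize ‖z‖ = r at *
  generalize |z.im|⁻¹ = v at *
  have h1 : r ≤ (1 + r) ^ 2 := by nlinarith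
  have h2 : r ^ 2 ≤ (1 + r) ^ 2 := pow_le_pow_left₀ hr (by linarith) 2
  have h3 : v ≤ (1 + v) ^ 3 := by
    calc v ≤ (1 + v) ^ 1 := by linarith
      _ ≤ _ := pow_le_pow_right₀ (by linarith) (by norm_num)
  have h4 : v ^ 2 ≤ (1 + v) ^ 3 :=
    (pow_le_pow_left₀ hv (by linarith) 2).trans (pow_le_pow_right₀ (by linarith) (by norm_num))
  have h5 : v ^ 3 ≤ (1 + v) ^ 3 := pow_le_pow_left₀ hv (by linarith) 3
  calc 2 * r * v + 4 * r ^ 2 * v ^ 2 + 4 * Λ * r ^ 2 * v ^ 3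
      ≤ 2 * (1 + r) ^ 2 * (1 + v) ^ 3 + 4 * (1 + r) ^ 2 * (1 + v) ^ 3
        + 4 * Λ * (1 + r) ^ 2 * (1 + v) ^ 3 := by gcongr
    _ = _ := by ring

/-- Bias times stability has exponents `3 + 2 = 5` and `7 + 3 = 10`; squaring gives `10` and `20`,
which dominate the variance exponents `4` and `10`. -/
theorem sdBound_sq_add_le (hΛ : 0 ≤ Λ) (z : ℂ) :
    sdBound Λ z ^ 2 + (biasBound Λ z * stabBound Λ z) ^ 2
      ≤ momentConst Λ * ((1 + ‖z‖) ^ 10 * (1 + |z.im|⁻¹) ^ 20) := by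
  have h1 := sdBound_le hΛ z
  have h2 := biasBound_le hΛ z
  have h3 := stabBound_le hΛ z
  have hq := quadVarConst_pos.le
  have n1 : 0 ≤ sdBound Λ z := by unfold sdBound; positivity
  have n2 := biasBound_nonneg hΛ z
  have n3 : 0 ≤ stabBound Λ z := by unfold stabBound; positivity
  have hr : 0 ≤ ‖z‖ := norm_nonneg z
  have hv : 0 ≤ |z.im|⁻¹ := by positivity
  rw [momentConst]
  have hA : 0 ≤ Real.sqrt (2 * quadVarConst) * Λ * (1 + Λ) := by positivity
  have hB : 0 ≤ Λ * (Real.sqrt (2 * quadVarConst) * Λ * (1 + Λ)) + (Λ ^ 2 + quadVarConst * Λ ^ 2) := by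
    positivity
  generalize Real.sqrt (2 * quadVarConst) * Λ * (1 + Λ) = A at *
  generalize Λ * A + (Λ ^ 2 + quadVarConst * Λ ^ 2) = B at *
  generalize ‖z‖ = r at *
  generalize |z.im|⁻¹ = v at *
  have e1 : (A * ((1 + r) ^ 2 * (1 + v) ^ 5)) ^ 2 ≤ A ^ 2 * ((1 + r) ^ 10 * (1 + v) ^ 20) := by
    have a1 : (1 + r) ^ 4 ≤ (1 + r) ^ 10 := pow_le_pow_right₀ (by linarith) (by norm_num)
    have a2 : (1 + v) ^ 10 ≤ (1 + v) ^ 20 := pow_le_pow_right₀ (by linarith) (by norm_num)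
    calc _ = A ^ 2 * ((1 + r) ^ 4 * (1 + v) ^ 10) := by
          generalize 1 + r = a; generalize 1 + v = b; ring
      _ ≤ _ := by gcongr
  calc _ ≤ (A * ((1 + r) ^ 2 * (1 + v) ^ 5)) ^ 2 + (B * ((1 + r) ^ 3 * (1 + v) ^ 7) *
        ((6 + 4 * Λ) * ((1 + r) ^ 2 * (1 + v) ^ 3))) ^ 2 := by gcongr
    _ = (A * ((1 + r) ^ 2 * (1 + v) ^ 5)) ^ 2
        + (B * (6 + 4 * Λ)) ^ 2 * ((1 + r) ^ 10 * (1 + v) ^ 20) := by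
        generalize 1 + r = a; generalize 1 + v = b; ring
    _ ≤ _ := by linarith

theorem momentConst_nonneg (Λ : ℝ) : 0 ≤ momentConst Λ := by unfold momentConst; positivity

variable (hS : ‖S * Sᴴ‖ ≤ Λ) (hcard : Fintype.card n ≤ Fintype.card k)
  (hR : (S * Sᴴ).IsHermitian)
  (hF : ∀ z : ℂ, z.im ≠ 0 → resolventTransform F z =
    selfMap hR.eigenvalues (Fintype.card n / Fintype.card k) z (resolventTransform F z))
include hS hcard hF

theorem integral_norm_stieltjesDev_sq_le_poly (hz : z.im ≠ 0) :
    ∫ x : k → n → ℂ, ‖stieltjesDev F x z‖ ^ 2 ∂(columnsLaw k S) ≤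
      momentConst Λ * ((1 + ‖z‖) ^ 10 * (1 + |z.im|⁻¹) ^ 20) / Fintype.card n ^ 2 := by
  refine (integral_norm_stieltjesDev_sq_le hS hcard hz hR (hF z hz)).trans ?_
  gcongr
  exact sdBound_sq_add_le ((norm_nonneg _).trans hS) z

/-- On the circle of radius `|Im z| / 2`, both `1 + |w|` and `1 + |Im w|⁻¹` at most double, which
gives `2^30`. The factor `r⁻² = 4 |Im z|⁻²` accounts for the remaining `2^2` and raises the exponent
from `20` to `22`. -/
theorem integral_norm_deriv_stieltjesDev_sq_le_poly (hz : z.im ≠ 0) :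
    IsBddMeas (fun x : k → n → ℂ => deriv (stieltjesDev F x) z) ∧
      ∫ x : k → n → ℂ, ‖deriv (stieltjesDev F x) z‖ ^ 2 ∂(columnsLaw k S) ≤
        2 ^ 32 * momentConst Λ * ((1 + ‖z‖) ^ 10 * (1 + |z.im|⁻¹) ^ 22) / Fintype.card n ^ 2 := by
  have hy : 0 < |z.im| := abs_pos.2 hz
  have hball : ∀ w ∈ Metric.closedBall z (|z.im| / 2), |z.im| / 2 ≤ |w.im| := fun w hw => by
    have h1 : |(w - z).im| ≤ |z.im| / 2 :=
      (Complex.abs_im_le_norm _).trans (by simpa [dist_eq_norm] using hw)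
    have h2 : |z.im| - |w.im| ≤ |(w - z).im| := by
      rw [Complex.sub_im, abs_sub_comm]
      exact abs_sub_abs_le_abs_sub _ _
    linarith
  have hcirc : ∀ θ, circleMap z (|z.im| / 2) θ ∈ Metric.closedBall z (|z.im| / 2) := fun θ =>
    circleMap_mem_closedBall z (by positivity) θ
  have hne : ∀ w ∈ Metric.closedBall z (|z.im| / 2), w.im ≠ 0 := fun w hw =>
    abs_pos.1 ((by positivity : 0 < |z.im| / 2).trans_le (hball w hw))
  have hU : IsOpen {w : ℂ | w.im ≠ 0} := isOpen_ne_fun Complex.continuous_im continuous_const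
  have hmc := momentConst_nonneg Λ
  obtain ⟨h1, h2⟩ := integral_norm_deriv_sq_le (P := columnsLaw k S)
    (f := fun x : k → n → ℂ => stieltjesDev F x) (M := 2 * (|z.im| / 2)⁻¹)
    (B := momentConst Λ * ((2 * (1 + ‖z‖)) ^ 10 * (2 * (1 + |z.im|⁻¹)) ^ 20) / Fintype.card n ^ 2)
    hU (r := |z.im| / 2) (by positivity) hne (fun x => differentiableOn_stieltjesDev x)
    (stronglyMeasurable_stieltjesDev_circleMap fun θ => hne _ (hcirc θ))
    (fun x θ => (norm_stieltjesDev_le (hne _ (hcirc θ)) x).trans (by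
      gcongr
      exact hball _ (hcirc θ)))
    (fun θ => (integral_norm_stieltjesDev_sq_le_poly hS hcard hR hF
      (hne _ (hcirc θ))).trans (by
        have a1 : ‖circleMap z (|z.im| / 2) θ‖ ≤ ‖z‖ + |z.im| / 2 := by
          have : ‖circleMap z (|z.im| / 2) θ - z‖ ≤ |z.im| / 2 := by
            rw [← dist_eq_norm]; exact hcirc θ
          have h3 := norm_add_le (circleMap z (|z.im| / 2) θ - z) z
          rw [sub_add_cancel] at h3
          linarith
        have a2 : 1 + ‖circleMap z (|z.im| / 2) θ‖ ≤ 2 * (1 + ‖z‖) := by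
          have := Complex.abs_im_le_norm z
          linarith [norm_nonneg z]
        have a3 : 1 + |(circleMap z (|z.im| / 2) θ).im|⁻¹ ≤ 2 * (1 + |z.im|⁻¹) := by
          have h4 : |(circleMap z (|z.im| / 2) θ).im|⁻¹ ≤ 2 * |z.im|⁻¹ :=
            (inv_anti₀ (by positivity) (hball _ (hcirc θ))).trans_eq (by
              rw [inv_div, div_eq_mul_inv])
          linarith
        gcongr))
  refine ⟨h1, h2.trans ?_⟩
  have a4 : |z.im|⁻¹ ^ 2 ≤ (1 + |z.im|⁻¹) ^ 2 := by gcongr; linarith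
  calc _ = 2 ^ 32 * momentConst Λ * ((1 + ‖z‖) ^ 10 * ((1 + |z.im|⁻¹) ^ 20 * |z.im|⁻¹ ^ 2)) /
        Fintype.card n ^ 2 := by
        rw [div_eq_mul_inv _ ((|z.im| / 2) ^ 2), ← inv_pow, inv_div, div_eq_mul_inv (2 : ℝ) |z.im|]
        generalize 1 + |z.im|⁻¹ = b
        generalize 1 + ‖z‖ = a
        ring
    _ ≤ 2 ^ 32 * momentConst Λ * ((1 + ‖z‖) ^ 10 * ((1 + |z.im|⁻¹) ^ 20 * (1 + |z.im|⁻¹) ^ 2)) /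
        Fintype.card n ^ 2 := by gcongr
    _ = _ := by rw [← pow_add]

end SecondMoments

/-! ### Eigenvalues with prescribed multiplicities -/

section Spectrum
open Matrix
open scoped Matrix.Norms.L2Operator ComplexOrder MatrixOrder

variable {L N : ℕ} {R : Matrix (Fin N) (Fin N) ℂ} {lam : Fin L → ℝ} {mult : Fin L → ℕ}

/-- Geometric multiplicity is at most algebraic multiplicity, so the prescribed multiset is
contained in the roots; both have cardinality `N`, so they agree. -/
theorem HasSpectrum.roots_charpoly (h : HasSpectrum R lam mult) :
    R.charpoly.roots = ∑ i, Multiset.replicate (mult i) (lam i : ℂ) := by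
  classical
  have hinj : Function.Injective fun i => (lam i : ℂ) :=
    Complex.ofReal_injective.comp h.strictMono.injective
  symm
  refine Multiset.eq_of_le_of_card_le (Multiset.le_iff_count.2 fun w => ?_) ?_
  · rw [Multiset.count_sum']
    simp only [Multiset.count_replicate]
    by_cases hw : ∃ i, (lam i : ℂ) = w
    · obtain ⟨i, rfl⟩ := hw
      rw [Finset.sum_eq_single i (fun j _ hj => if_neg fun e => hj (hinj e)) (by simp), if_pos rfl,
        Polynomial.count_roots, ← h.finrank_eigenspace i, ← Matrix.charpoly_toLin']
      exact LinearMap.finrank_genEigenspace_le _ _ _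
    · rw [Finset.sum_eq_zero fun j _ => if_neg fun e => hw ⟨j, e⟩]
      exact Nat.zero_le _
  · rw [h.isHermitian.roots_charpoly_eq_eigenvalues]
    simp [h.sum_mult]

theorem HasSpectrum.sum_eigenvalues (h : HasSpectrum R lam mult) (f : ℝ → ℂ) :
    ∑ k, f (h.isHermitian.eigenvalues k) = ∑ i, (mult i : ℂ) * f (lam i) := by
  have h1 := h.roots_charpoly
  rw [h.isHermitian.roots_charpoly_eq_eigenvalues] at h1
  have h2 := congrArg (fun s => (s.map fun w : ℂ => f w.re).sum) h1
  rw [Multiset.map_map] at h2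
  refine Eq.trans ?_ (h2.trans ?_)
  · rfl
  · rw [← Multiset.coe_mapAddMonoidHom, map_sum, ← Multiset.coe_sumAddMonoidHom, map_sum]
    simp [Multiset.map_replicate]

theorem HasSpectrum.exists_eigenvalue_eq (h : HasSpectrum R lam mult) (k : Fin N) :
    ∃ i, h.isHermitian.eigenvalues k = lam i := by
  have h1 : (h.isHermitian.eigenvalues k : ℂ) ∈ R.charpoly.roots := by
    rw [h.isHermitian.roots_charpoly_eq_eigenvalues]
    exact Multiset.mem_map.2 ⟨k, Finset.mem_univ_val k, rfl⟩
  rw [h.roots_charpoly, Multiset.mem_sum] at h1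
  obtain ⟨i, -, hi⟩ := h1
  exact ⟨i, by exact_mod_cast Multiset.eq_of_mem_replicate hi⟩

theorem HasSpectrum.posSemidef (h : HasSpectrum R lam mult) (hlam : ∀ i, 0 ≤ lam i) :
    R.PosSemidef :=
  h.isHermitian.posSemidef_iff_eigenvalues_nonneg.2 fun k => by
    obtain ⟨i, hi⟩ := h.exists_eigenvalue_eq k
    rw [hi]
    exact hlam i

theorem sqrt_mul_conjTranspose_sqrt (hR : R.PosSemidef) : CFC.sqrt R * (CFC.sqrt R)ᴴ = R := by
  have h0 : 0 ≤ R := nonneg_iff_posSemidef.2 hR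
  have h1 : (CFC.sqrt R)ᴴ = CFC.sqrt R := (nonneg_iff_posSemidef.1 (CFC.sqrt_nonneg R)).1
  rw [h1, CFC.sqrt_mul_sqrt_self R]

theorem Matrix.IsHermitian.norm_le_of_eigenvalues {n : Type*} [Fintype n] [DecidableEq n]
    {A : Matrix n n ℂ} (hA : A.IsHermitian) {Λ : ℝ} (hΛ : 0 ≤ Λ)
    (h : ∀ i, |hA.eigenvalues i| ≤ Λ) : ‖A‖ ≤ Λ := by
  rw [hA.spectral_theorem]
  simp only [Unitary.conjStarAlgAut_apply]
  rw [← Unitary.coe_star, CStarRing.norm_mul_coe_unitary, CStarRing.norm_coe_unitary_mul, l2_opNorm_diagonal]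
  refine (pi_norm_le_iff_of_nonneg hΛ).2 fun i => ?_
  simpa using h i

end Spectrum

/-! ### From the observation matrix to the law of its columns -/

section Transport
open Matrix
open scoped Matrix.Norms.L2Operator ComplexOrder MatrixOrder

theorem colGram_transpose {n k : Type*} [Fintype k] (Y : Matrix n k ℂ) :
    colGram (fun j i => Y i j) = Y * Yᴴ := by
  ext a b
  simp [colGram, Matrix.sum_apply, Matrix.mul_apply, vecMulVec_apply]

theorem sampleStieltjes_eq_trace {N K : ℕ} (Y : Matrix (Fin N) (Fin K) ℂ) {z : ℂ} (hz : z.im ≠ 0) :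
    sampleStieltjes Y z = (Fintype.card (Fin N) : ℂ)⁻¹ *
      (matResolvent (colGram fun j i => Y i j) z).trace := by
  rw [sampleStieltjes, colGram_transpose,
    trace_matResolvent (isHermitian_mul_conjTranspose_self Y) hz, Fintype.card_fin]

theorem sampleStieltjes_sub_eq {N K : ℕ} (Y : Matrix (Fin N) (Fin K) ℂ) {z : ℂ} (hz : z.im ≠ 0)
    (F : Measure ℝ) : sampleStieltjes Y z - resolventTransform F z
      = stieltjesDev F (fun j i => Y i j) z := by
  rw [sampleStieltjes_eq_trace Y hz, stieltjesDev]

theorem deriv_sampleStieltjes_sub_eq {N K : ℕ} (Y : Matrix (Fin N) (Fin K) ℂ) {z : ℂ}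
    (hz : z.im ≠ 0) (F : Measure ℝ) [IsProbabilityMeasure F] :
    deriv (sampleStieltjes Y) z - deriv (resolventTransform F) z
      = deriv (stieltjesDev F fun j i => Y i j) z := by
  have hU : IsOpen {w : ℂ | w.im ≠ 0} := isOpen_ne_fun Complex.continuous_im continuous_const
  have hd : DifferentiableAt ℂ (sampleStieltjes Y) z := by
    refine DifferentiableAt.const_mul (DifferentiableAt.fun_sum fun i _ => ?_) _
    exact ((differentiableAt_const _).sub differentiableAt_id).inv (ofReal_sub_ne_zero hz _)
  rw [← deriv_sub hd (differentiableAt_resolventTransform hz)]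
  -- The identity of functions is available only off the real axis, which is an open set containing
  -- `z`.
  refine Filter.EventuallyEq.deriv_eq ?_
  filter_upwards [hU.mem_nhds hz] with w hw
  exact sampleStieltjes_sub_eq Y hw F

theorem observation_col {N K : ℕ} (R : Matrix (Fin N) (Fin N) ℂ) (X : Matrix (Fin N) (Fin K) ℂ)
    (j : Fin K) : (fun i => observation R X i j)
      = (((Real.sqrt K)⁻¹ : ℝ) : ℂ) • CFC.sqrt R *ᵥ fun i => X i j := by
  ext i
  simp [observation, Matrix.mul_apply, mulVec, dotProduct]

/-- Links the entrywise product measure, given by joint independence of the entries, with the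
product over columns used in the estimates. -/
theorem pi_map_uncurry_swap {n k V : Type*} [Fintype n] [Fintype k] [MeasurableSpace V]
    (ρ : Measure V) [IsProbabilityMeasure ρ] :
    (Measure.pi fun _ : k => Measure.pi fun _ : n => ρ).map
      (fun (x : k → n → V) (p : n × k) => x p.2 p.1) = Measure.pi fun _ : n × k => ρ := by
  have hm : Measurable fun (x : k → n → V) (p : n × k) => x p.2 p.1 := by fun_prop
  symm
  refine Measure.pi_eq fun s hs => ?_
  rw [Measure.map_apply hm (MeasurableSet.univ_pi hs)]
  have : (fun (x : k → n → V) (p : n × k) => x p.2 p.1) ⁻¹' Set.univ.pi s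
      = Set.univ.pi fun j => Set.univ.pi fun i => s (i, j) := by
    ext x
    simp only [Set.mem_preimage, Set.mem_univ_pi, Prod.forall]
    exact forall_comm
  rw [this, Measure.pi_pi]
  simp_rw [Measure.pi_pi]
  rw [Fintype.prod_prod_type_right]

variable {Ω : Type*} [MeasurableSpace Ω] {μ : Measure Ω} [IsProbabilityMeasure μ] {N K : ℕ}
  {X : Ω → Matrix (Fin N) (Fin K) ℂ}

omit [IsProbabilityMeasure μ] in
/-- The columns of a Gaussian matrix are independent Gaussian vectors. -/
theorem map_columns_eq (hlaw : ∀ i j, HasLaw (fun ω => X ω i j) stdComplexGaussian μ)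
    (hindep : iIndepFun (fun (p : Fin N × Fin K) (ω : Ω) => X ω p.1 p.2) μ) :
    μ.map (fun ω j i => X ω i j) = Measure.pi fun _ : Fin K => gaussVec (Fin N) := by
  have ham : ∀ p : Fin N × Fin K, AEMeasurable (fun ω => X ω p.1 p.2) μ := fun p =>
    (hlaw p.1 p.2).aemeasurable
  have h1 := hindep.map_fun_eq_pi_map ham
  simp_rw [fun p : Fin N × Fin K => (hlaw p.1 p.2).map_eq] at h1
  rw [← pi_map_uncurry_swap (n := Fin N) (k := Fin K) stdComplexGaussian] at h1
  have hc : Measurable fun (y : Fin N × Fin K → ℂ) (j : Fin K) (i : Fin N) => y (i, j) := by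
    fun_prop
  have h2 := congrArg (Measure.map fun (y : Fin N × Fin K → ℂ) (j : Fin K) (i : Fin N) => y (i, j)) h1
  rw [AEMeasurable.map_map_of_aemeasurable hc.aemeasurable (aemeasurable_pi_lambda _ ham),
    Measure.map_map hc (by fun_prop)] at h2
  refine h2.trans ?_
  exact Measure.map_id

omit [IsProbabilityMeasure μ] in
theorem aemeasurable_columns (hlaw : ∀ i j, HasLaw (fun ω => X ω i j) stdComplexGaussian μ) :
    AEMeasurable (fun ω (j : Fin K) (i : Fin N) => X ω i j) μ :=
  aemeasurable_pi_lambda _ fun j => aemeasurable_pi_lambda _ fun i => (hlaw i j).aemeasurable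

omit [IsProbabilityMeasure μ] in
theorem aemeasurable_observation_columns (R : Matrix (Fin N) (Fin N) ℂ)
    (hlaw : ∀ i j, HasLaw (fun ω => X ω i j) stdComplexGaussian μ) :
    AEMeasurable (fun ω (j : Fin K) (i : Fin N) => observation R (X ω) i j) μ := by
  have he : (fun ω (j : Fin K) (i : Fin N) => observation R (X ω) i j) = fun ω j =>
      (((Real.sqrt K)⁻¹ : ℝ) : ℂ) • CFC.sqrt R *ᵥ fun i => X ω i j :=
    funext fun ω => funext fun j => observation_col R (X ω) j
  rw [he]
  exact aemeasurable_pi_lambda _ fun j => (continuous_smul_mulVec _ _).measurable.comp_aemeasurable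
    ((measurable_pi_apply j).comp_aemeasurable (aemeasurable_columns hlaw))

omit [IsProbabilityMeasure μ] in
/-- The law of the columns of the observation matrix. -/
theorem map_observation_columns [Nonempty (Fin K)] (R : Matrix (Fin N) (Fin N) ℂ)
    (hlaw : ∀ i j, HasLaw (fun ω => X ω i j) stdComplexGaussian μ)
    (hindep : iIndepFun (fun (p : Fin N × Fin K) (ω : Ω) => X ω p.1 p.2) μ) :
    μ.map (fun ω j i => observation R (X ω) i j) = columnsLaw (Fin K) (CFC.sqrt R) := by
  have hg : Measurable fun x : Fin N → ℂ => (((Real.sqrt K)⁻¹ : ℝ) : ℂ) • CFC.sqrt R *ᵥ x :=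
    (continuous_smul_mulVec _ _).measurable
  have hgg : Measurable fun (x : Fin K → Fin N → ℂ) (j : Fin K) =>
      (((Real.sqrt K)⁻¹ : ℝ) : ℂ) • CFC.sqrt R *ᵥ x j :=
    measurable_pi_lambda _ fun j => hg.comp (measurable_pi_apply j)
  have he : (fun ω (j : Fin K) (i : Fin N) => observation R (X ω) i j) = fun ω j =>
      (((Real.sqrt K)⁻¹ : ℝ) : ℂ) • CFC.sqrt R *ᵥ fun i => X ω i j :=
    funext fun ω => funext fun j => observation_col R (X ω) j
  rw [he]
  have h1 := AEMeasurable.map_map_of_aemeasurable hgg.aemeasurable (aemeasurable_columns hlaw)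
  refine Eq.trans h1.symm ?_
  rw [map_columns_eq hlaw hindep, columnsLaw]
  unfold columnLaw
  rw [Fintype.card_fin]
  have : ∀ _ : Fin K, SigmaFinite ((gaussVec (Fin N)).map fun x : Fin N → ℂ =>
      (((Real.sqrt K)⁻¹ : ℝ) : ℂ) • CFC.sqrt R *ᵥ x) := fun _ =>
    have := Measure.isProbabilityMeasure_map (μ := gaussVec (Fin N)) hg.aemeasurable
    inferInstance
  exact Measure.pi_map_pi (fun _ => hg.aemeasurable)

end Transport

/-! ### Bounds at fixed dimension and sample size -/

section FixedDimension
open Matrix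
open scoped Matrix.Norms.L2Operator ComplexOrder MatrixOrder

variable {Ω : Type*} [MeasurableSpace Ω] {μ : Measure Ω} {L N K : ℕ}
  {R : Matrix (Fin N) (Fin N) ℂ} {lam : Fin L → ℝ} {mult : Fin L → ℕ} {Λ : ℝ}
  {X : Ω → Matrix (Fin N) (Fin K) ℂ}

theorem IsBddMeas.integrable_comp_and_integral_comp_le {E : Type*} [MeasurableSpace E]
    {P : Measure E} [IsProbabilityMeasure P] {φ : E → ℂ} (hφ : IsBddMeas φ) {Y : Ω → E}
    (hY : AEMeasurable Y μ) (hYP : μ.map Y = P) {B : ℝ} (hB : ∫ x, ‖φ x‖ ^ 2 ∂P ≤ B) :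
    Integrable (fun ω => ‖φ (Y ω)‖ ^ 2) μ ∧ ∫ ω, ‖φ (Y ω)‖ ^ 2 ∂μ ≤ B := by
  have hi : Integrable (fun x => ‖φ x‖ ^ 2) P := hφ.integrable_norm_sq
  rw [← hYP] at hi hB
  refine ⟨hi.comp_aemeasurable hY, ?_⟩
  rwa [integral_map hY hi.1] at hB

/-- Second moment bounds for a fixed dimension and sample size. -/
theorem HasSpectrum.integral_norm_sq_le (h : HasSpectrum R lam mult) (hN : 0 < N) (hNK : N ≤ K)
    (hlam : ∀ i, 0 ≤ lam i ∧ lam i ≤ Λ) (hΛ : 0 < Λ)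
    (hlaw : ∀ i j, HasLaw (fun ω => X ω i j) stdComplexGaussian μ)
    (hindep : iIndepFun (fun (p : Fin N × Fin K) (ω : Ω) => X ω p.1 p.2) μ) {z : ℂ}
    (hz : z.im ≠ 0) :
    (Integrable (fun ω => ‖sampleStieltjes (observation R (X ω)) z
        - limitStieltjes N K lam mult z‖ ^ 2) μ ∧
      ∫ ω, ‖sampleStieltjes (observation R (X ω)) z - limitStieltjes N K lam mult z‖ ^ 2 ∂μ
        ≤ momentConst Λ * ((1 + ‖z‖) ^ 10 * (1 + |z.im|⁻¹) ^ 20) / N ^ 2) ∧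
    (Integrable (fun ω => ‖deriv (sampleStieltjes (observation R (X ω))) z
        - deriv (limitStieltjes N K lam mult) z‖ ^ 2) μ ∧
      ∫ ω, ‖deriv (sampleStieltjes (observation R (X ω))) z
          - deriv (limitStieltjes N K lam mult) z‖ ^ 2 ∂μ
        ≤ 2 ^ 32 * momentConst Λ * ((1 + ‖z‖) ^ 10 * (1 + |z.im|⁻¹) ^ 22) / N ^ 2) := by
  have : Nonempty (Fin N) := ⟨⟨0, hN⟩⟩
  have : Nonempty (Fin K) := ⟨⟨0, hN.trans_le hNK⟩⟩
  have hF := isLimitSpectralMeasure_limitSpectralMeasure hN hNK h.sum_mult hlam hΛ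
  set F := limitSpectralMeasure N lam mult ((N : ℝ) / K) with hFdef
  have := hF.isProbabilityMeasure
  have hlim : limitStieltjes N K lam mult = resolventTransform F := by
    funext w
    rw [limitStieltjes]
  have hSS : CFC.sqrt R * (CFC.sqrt R)ᴴ = R :=
    sqrt_mul_conjTranspose_sqrt (h.posSemidef fun i => (hlam i).1)
  have hS : ‖CFC.sqrt R * (CFC.sqrt R)ᴴ‖ ≤ Λ := by
    rw [hSS]
    refine h.isHermitian.norm_le_of_eigenvalues hΛ.le fun k => ?_
    obtain ⟨i, hi⟩ := h.exists_eigenvalue_eq k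
    rw [hi, abs_of_nonneg (hlam i).1]
    exact (hlam i).2
  have hcard : Fintype.card (Fin N) ≤ Fintype.card (Fin K) := by simpa using hNK
  have hR : (CFC.sqrt R * (CFC.sqrt R)ᴴ).IsHermitian := isHermitian_mul_conjTranspose_self _
  -- `eigenvalues` depends on the matrix and on the proof that it is Hermitian; quantifying over `A`
  -- allows `CFC.sqrt R * (CFC.sqrt R)ᴴ` to be exchanged for `R` without rewriting inside that
  -- dependency.
  have hsum : ∀ {A : Matrix (Fin N) (Fin N) ℂ} (hA : A.IsHermitian), A = R → ∀ f : ℝ → ℂ,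
      ∑ k, f (hA.eigenvalues k) = ∑ i, (mult i : ℂ) * f (lam i) := by
    rintro A hA rfl f
    exact h.sum_eigenvalues f
  have hFeq : ∀ w : ℂ, w.im ≠ 0 → resolventTransform F w = selfMap hR.eigenvalues
      (Fintype.card (Fin N) / Fintype.card (Fin K)) w (resolventTransform F w) := fun w hw => by
    refine (hF.equation w hw).trans ?_
    rw [selfMap, Fintype.card_fin, Fintype.card_fin,
      hsum hR hSS fun x => ((x : ℂ) * (1 - ((N / K : ℝ) : ℂ) - ((N / K : ℝ) : ℂ) * w *
        resolventTransform F w) - w)⁻¹]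
    simp only [div_eq_mul_inv]
  have hcol := aemeasurable_observation_columns R hlaw
  have hmap := map_observation_columns R hlaw hindep
  rw [hlim]
  simp_rw [sampleStieltjes_sub_eq _ hz F, deriv_sampleStieltjes_sub_eq _ hz F]
  have b1 := integral_norm_stieltjesDev_sq_le_poly hS hcard hR hFeq hz
  obtain ⟨b2, b3⟩ := integral_norm_deriv_stieltjesDev_sq_le_poly hS hcard hR hFeq hz
  rw [Fintype.card_fin] at b1 b3
  exact ⟨(isBddMeas_stieltjesDev hz).integrable_comp_and_integral_comp_le hcol hmap b1,
    b2.integrable_comp_and_integral_comp_le hcol hmap b3⟩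

end FixedDimension

/-! ### Choice of the polynomials and conclusion -/

theorem isNonnegPoly_C_mul_X_add_one_pow {a : ℝ} (ha : 0 < a) (m : ℕ) :
    IsNonnegPoly m (Polynomial.C a * (Polynomial.X + Polynomial.C 1) ^ m) := by
  constructor
  · rw [Polynomial.natDegree_C_mul ha.ne', Polynomial.natDegree_pow, Polynomial.natDegree_X_add_C,
      mul_one]
  · intro n
    rw [Polynomial.coeff_C_mul, Polynomial.coeff_X_add_C_pow]
    positivity

/-- Trades `N⁻²` for `K⁻²` at the cost of `4 / c²`, using `N ≥ c K / 2`, and leaves room to enlarge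
the polynomial factors. -/
theorem div_sq_le_of_div_two_mul_le {A B a b s t c N K : ℝ} (hc : 0 < c) (hK : 0 < K)
    (hN : c / 2 * K ≤ N) (hA : 0 ≤ A) (hB : 4 / c ^ 2 * A ≤ B) (ha : 0 ≤ a) (hs : a ≤ s)
    (hb : 0 ≤ b) (ht : b ≤ t) :
    A * (a * b) / N ^ 2 ≤ 1 / K ^ 2 * (B * s) * (1 * t) := by
  have hN0 : 0 < c / 2 * K := by positivity
  have hB0 : 0 ≤ B := le_trans (by positivity) hB
  have hs0 := ha.trans hs
  calc A * (a * b) / N ^ 2 ≤ A * (a * b) / (c / 2 * K) ^ 2 := by gcongr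
    _ = 1 / K ^ 2 * (4 / c ^ 2 * A * a) * (1 * b) := by field_simp; ring
    _ ≤ _ := by gcongr

theorem corollary1
    {L : ℕ} {Ω : Type*} [MeasurableSpace Ω] (μ : Measure Ω) [IsProbabilityMeasure μ]
    -- the dimension, the covariance matrix, its eigenvalues and their multiplicities,
    -- all indexed by the sample size `K`
    (N : ℕ → ℕ) (R : ∀ K, Matrix (Fin (N K)) (Fin (N K)) ℂ)
    (lam : ℕ → Fin L → ℝ) (mult : ℕ → Fin L → ℕ)
    -- (A1)
    (hR : ∀ᶠ K in atTop, HasSpectrum (R K) (lam K) (mult K))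
    (lamMin lamMax : ℝ) (hlamMin : 0 < lamMin)
    (hlam : ∀ᶠ K in atTop, ∀ i, lamMin < lam K i ∧ lam K i < lamMax)
    -- (A2)
    (c : ℝ) (hc : c ∈ Set.Ioo (0 : ℝ) 1)
    (hN : Tendsto (fun K : ℕ => (N K : ℝ) / (K : ℝ)) atTop (𝓝 c))
    (ci : Fin L → ℝ) (hci : ∀ i, ci i ∈ Set.Ioo (0 : ℝ) 1)
    (hmult : ∀ i, Tendsto (fun K : ℕ => (mult K i : ℝ) / (K : ℝ)) atTop (𝓝 (ci i)))
    -- (A3)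
    (X : ∀ K, Ω → Matrix (Fin (N K)) (Fin K) ℂ)
    (hlaw : ∀ K i j, HasLaw (fun ω => X K ω i j) stdComplexGaussian μ)
    (hindep : ∀ K, iIndepFun (fun (p : Fin (N K) × Fin K) (ω : Ω) => X K ω p.1 p.2) μ) :
    ∃ P₁₈ P₂₄ P₃₀ P₄₀ : Polynomial ℝ,
      IsNonnegPoly 18 P₁₈ ∧ IsNonnegPoly 24 P₂₄ ∧ IsNonnegPoly 30 P₃₀ ∧ IsNonnegPoly 40 P₄₀ ∧
      ∀ᶠ K : ℕ in atTop, ∀ z : ℂ, z.im ≠ 0 →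
        (Integrable (fun ω => ‖sampleStieltjes (observation (R K) (X K ω)) z
            - limitStieltjes (N K) K (lam K) (mult K) z‖ ^ 2) μ ∧
          ∫ ω, ‖sampleStieltjes (observation (R K) (X K ω)) z
              - limitStieltjes (N K) K (lam K) (mult K) z‖ ^ 2 ∂μ
            ≤ 1 / (K : ℝ) ^ 2 * P₁₈.eval ‖z‖ * P₂₄.eval |z.im|⁻¹) ∧
        (Integrable (fun ω => ‖deriv (sampleStieltjes (observation (R K) (X K ω))) z
            - deriv (limitStieltjes (N K) K (lam K) (mult K)) z‖ ^ 2) μ ∧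
          ∫ ω, ‖deriv (sampleStieltjes (observation (R K) (X K ω))) z
              - deriv (limitStieltjes (N K) K (lam K) (mult K)) z‖ ^ 2 ∂μ
            ≤ 1 / (K : ℝ) ^ 2 * P₃₀.eval ‖z‖ * P₄₀.eval |z.im|⁻¹) := by
  have hc0 := hc.1
  have hA := momentConst_nonneg lamMax
  set A := 4 / c ^ 2 * momentConst lamMax with hAdef
  have hA0 : 0 ≤ A := by positivity
  -- Adding `1` to the constants keeps the leading coefficients positive, so the degrees are exact
  -- without knowing that `A` is nonzero.
  refine ⟨_, _, _, _, isNonnegPoly_C_mul_X_add_one_pow (a := A + 1) (by positivity) 18,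
    isNonnegPoly_C_mul_X_add_one_pow one_pos 24,
    isNonnegPoly_C_mul_X_add_one_pow (a := 2 ^ 32 * A + 1) (by positivity) 30,
    isNonnegPoly_C_mul_X_add_one_pow one_pos 40, ?_⟩
  filter_upwards [hR, hlam, hN.eventually_const_lt (half_lt_self hc0),
    hN.eventually_lt_const hc.2, eventually_gt_atTop 0] with K hRK hlamK hN1 hN2 hK z hz
  have hK' : (0 : ℝ) < K := by exact_mod_cast hK
  have hNK : c / 2 * K ≤ N K := ((lt_div_iff₀ hK').1 hN1).le
  have hN0 : 0 < N K := by
    have : (0 : ℝ) < N K := lt_of_lt_of_le (by positivity) hNK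
    exact_mod_cast this
  have hNleK : N K ≤ K := by
    have := (div_lt_one hK').1 hN2
    exact_mod_cast this.le
  -- Since `N K > 0` is a sum over `Fin L`, there is at least one eigenvalue, and it lies between
  -- `lamMin > 0` and `lamMax`.
  have hL : 0 < lamMax := by
    obtain ⟨i, -⟩ : ∃ i, i ∈ (Finset.univ : Finset (Fin L)) := by
      by_contra hne
      have := hRK.sum_mult
      rw [Finset.sum_eq_zero fun i hi => absurd ⟨i, hi⟩ hne] at this
      exact hN0.ne this
    exact hlamMin.trans ((hlamK i).1.trans (hlamK i).2)
  obtain ⟨⟨h1, h2⟩, h3, h4⟩ := hRK.integral_norm_sq_le hN0 hNleK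
    (fun i => ⟨(hlamMin.trans (hlamK i).1).le, (hlamK i).2.le⟩) hL (hlaw K) (hindep K) hz
  have hr : 0 ≤ ‖z‖ := norm_nonneg z
  have hv : 0 ≤ |z.im|⁻¹ := by positivity
  simp only [Polynomial.eval_mul, Polynomial.eval_C, Polynomial.eval_pow, Polynomial.eval_add,
    Polynomial.eval_X, add_comm _ (1 : ℝ)]
  -- The exponents obtained, `10` and `20` for the transform and `10` and `22` for its derivative,
  -- lie below the required degrees; since `1 + ‖z‖` and `1 + |z.im|⁻¹` are at least `1`, raising
  -- the powers is harmless.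
  refine ⟨⟨h1, h2.trans ?_⟩, h3, h4.trans ?_⟩
  · refine div_sq_le_of_div_two_mul_le hc0 hK' hNK hA (by linarith) (by positivity)
      (pow_le_pow_right₀ ?_ ?_) (by positivity) (pow_le_pow_right₀ ?_ ?_) <;>
      linarith
  · refine div_sq_le_of_div_two_mul_le hc0 hK' hNK (by positivity) (by rw [mul_left_comm]; linarith)
      (by positivity) (pow_le_pow_right₀ ?_ ?_) (by positivity) (pow_le_pow_right₀ ?_ ?_) <;>
      linarith
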